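/- Let $n\ge 2$, let $\Omega\subset\mathbb R^n$ be a bounded open set with Lipschitz boundary, and let $\mathbb M^{n\times n}_{\rm sym}$ be the space of symmetric $n\times n$ real matrices with the Euclidean scalar product. Let $V:\mathbb R\to[0,\infty]$ and $H:\Omega\times\mathbb M^{n\times n}_{\rm sym}\to[0,\infty]$ be lower semicontinuous, and assume that for every $x\in\Omega$ the function $H(x,\cdot)$ is convex and positively $1$-homogeneous (i.e. $H(x,t\xi)=tH(x,\xi)$ for $t>0$). Write $\mathcal M_b(\Omega;\mathbb M^{n\times n}_{\rm sym})$ for the bounded Radon measures on $\Omega$ with values in $\mathbb M^{n\times n}_{\rm sym}$, with the weak* convergence in duality with $C_0(\Omega;\mathbb M^{n\times n}_{\rm sym})$, and $BD(\Omega)$ for the space of all $u\in L^1(\Omega;\mathbb R^n)$ whose distributional symmetrised gradient ${\rm E}u$, ${\rm E}_{ij}u=\frac12(D_ju^i+D_iu^j)$, belongs to $\mathcal M_b(\Omega;\mathbb M^{n\times n}_{\rm sym})$; $u_k\stackrel{*}{\rightharpoonup}u$ weakly* in $BD(\Omega)$ means that $u_k\to u$ in $L^1(\Omega;\mathbb R^n)$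 and ${\rm E}u_k\stackrel{*}{\rightharpoonup}{\rm E}u$ weakly* in $\mathcal M_b(\Omega;\mathbb M^{n\times n}_{\rm sym})$. An integrable function $e$ is identified with the measure $e\,\mathcal L^n$. Let $q>1$, $\alpha_k,\alpha\in W^{1,n}(\Omega)$, $u_k,u\in BD(\Omega)$, $e_k,e\in L^q(\Omega;\mathbb M^{n\times n}_{\rm sym})$ and $p_k,p\in\mathcal M_b(\Omega;\mathbb M^{n\times n}_{\rm sym})$ be such that $${\rm E}u_k=e_k+p_k\ \text{ for all }k,\qquad {\rm E}u=e+p\qquad\text{in }\mathcal M_b(\Omega;\mathbb M^{n\times n}_{\rm sym}),$$ $u_k\stackrel{*}{\rightharpoonup}u$ weakly* in $BD(\Omega)$, $e_k\rightharpoonup e$ weakly in $L^q(\Omega;\mathbb M^{n\times n}_{\rm sym})$, and $\alpha_k\rightharpoonup\alpha$ weakly in $W^{1,n}(\Omega)$. Then $$\int_\Omega V(\widetilde\alpha(x))\,H\Big(x,\frac{{\rm d}p}{{\rm d}|p|}(x)\Big)\,{\rm d}|p|(x)\ \le\ \liminf_{k\to\infty}\int_\Omega V(\widetilde\alpha_k(x))\,H\Big(x,\frac{{\rm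 d}p_k}{{\rm d}|p_k|}(x)\Big)\,{\rm d}|p_k|(x),$$ with the convention $0\cdot\infty=0$. Here $|p|$ is the total variation of $p$, ${\rm d}p/{\rm d}|p|$ is the Radon–Nikodym derivative, and $\widetilde\alpha,\widetilde\alpha_k$ are any $\mathrm{Cap}_n$-quasicontinuous representatives of $\alpha,\alpha_k$: a function $a:\Omega\to\mathbb R$ is $\mathrm{Cap}_n$-quasicontinuous if for every $\varepsilon>0$ there is $A\subset\Omega$ with $\mathrm{Cap}_n(A,\Omega)<\varepsilon$ such that $a|_{\Omega\setminus A}$ is continuous, where $\mathrm{Cap}_n(A,\Omega)$ is the infimum of $\int_\Omega|\nabla v|^n\,{\rm d}x$ over all $v\in W^{1,n}_0(\Omega)$ with $v\ge1$ a.e. in a neighbourhood of $A$. -/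

import Mathlib

open MeasureTheory Filter Topology TopologicalSpace Set
open scoped ENNReal NNReal Distributions ZeroAtInfty

noncomputable section

namespace PlasticDamage

/-- The Euclidean space `ℝⁿ`. -/
abbrev Space (n : ℕ) : Type := EuclideanSpace ℝ (Fin n)

/-- The subspace of symmetric matrices in the space of `n × n` real matrices with the Euclidean
(Frobenius) scalar product `A : B = ∑ i j, A i j * B i j`. -/
def symSubmodule (n : ℕ) : Submodule ℝ (EuclideanSpace ℝ (Fin n × Fin n)) where
  carrier := {A | ∀ i j, A (i, j) = A (j, i)}
  add_mem' := fun hA hB i j => by simp [hA i j, hB i j]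
  zero_mem' := fun i j => by simp
  smul_mem' := fun c A hA i j => by simp [hA i j]

/-- Symmetric `n × n` matrices with the Euclidean scalar product and norm. -/
abbrev SymMat (n : ℕ) : Type := symSubmodule n

instance instFactOneLeCast {n : ℕ} [h : Fact (2 ≤ n)] : Fact ((1 : ℝ≥0∞) ≤ (n : ℝ≥0∞)) :=
  ⟨by exact_mod_cast (one_le_two.trans h.out)⟩

variable {n : ℕ}

/-- `Ω` has Lipschitz boundary: near each of its boundary points, `Ω` is, for some unit vector `ν`,
the set of points lying strictly above the graph, in direction `ν`, of a Lipschitz function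
on the hyperplane orthogonal to `ν`. -/
def HasLipschitzBoundary (Ω : Opens (Space n)) : Prop :=
  ∀ x₀ ∈ frontier (Ω : Set (Space n)), ∃ ν : Space n, ‖ν‖ = 1 ∧
    ∃ (γ : (Submodule.span ℝ {ν})ᗮ → ℝ) (K : ℝ≥0) (r : ℝ), LipschitzWith K γ ∧ 0 < r ∧
      ∀ y ∈ Metric.ball x₀ r,
        (y ∈ Ω ↔ γ ((Submodule.span ℝ {ν})ᗮ.orthogonalProjectionOnto y) < inner ℝ ν y)

/-- The `i`-th partial derivative. -/
def partialDeriv (φ : Space n → ℝ) (i : Fin n) (x : Space n) : ℝ :=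
  fderiv ℝ φ x (EuclideanSpace.single i 1)

variable (Ω : Opens (Space n))

/-- The Lebesgue measure on `Ω`. -/
instance instMeasureSpaceOpens : MeasureSpace Ω := Measure.Subtype.measureSpace

lemma isLocallyFinite_volume : IsLocallyFiniteMeasure (volume : Measure Ω) := by
  refine ⟨fun x => ?_⟩
  obtain ⟨s, hs, hfin⟩ := (volume : Measure (Space n)).finiteAt_nhds x.1
  refine ⟨Subtype.val ⁻¹' s, continuous_subtype_val.continuousAt.preimage_mem_nhds hs, ?_⟩
  have h := (MeasurableEmbedding.subtype_coe Ω.isOpen.measurableSet).comap_apply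
    (volume : Measure (Space n)) (Subtype.val ⁻¹' s)
  exact h.trans_lt ((measure_mono (Set.image_preimage_subset _ _)).trans_lt hfin)

/-! ### Sobolev spaces -/

/-- `g` is the weak gradient of `a` in `Ω`. -/
def IsWeakGradient (a : Ω → ℝ) (g : Ω → Space n) : Prop :=
  ∀ (φ : 𝓓(Ω, ℝ)) (i : Fin n),
    ∫ x : Ω, a x * partialDeriv φ i x = - ∫ x : Ω, g x i * φ x

variable {Ω} in
lemma hasCompactSupport_restrict {f : Space n → ℝ} (hf : HasCompactSupport f)
    (hs : tsupport f ⊆ Ω) : HasCompactSupport (fun x : Ω => f x) := by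
  refine HasCompactSupport.intro (K := (Subtype.val : Ω → Space n) ⁻¹' tsupport f) ?_ ?_
  · exact Topology.IsInducing.subtypeVal.isCompact_preimage' hf (by simpa using hs)
  · intro x hx
    exact image_eq_zero_of_notMem_tsupport hx

variable {Ω} in
lemma integrable_mul_test {q : ℝ≥0∞} [Fact (1 ≤ q)] {a : Ω → ℝ} (ha : MemLp a q volume)
    {f : Space n → ℝ} (hc : Continuous f) (hf : HasCompactSupport f) (hs : tsupport f ⊆ Ω) :
    Integrable (fun x : Ω => a x * f x) := by
  have := isLocallyFinite_volume Ω
  have := (ha.locallyIntegrable Fact.out).integrable_smul_right_of_hasCompactSupport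
    (hc.comp continuous_subtype_val) (hasCompactSupport_restrict hf hs)
  simpa using this

variable {Ω} in
lemma integrable_mul_test' {q : ℝ≥0∞} [Fact (1 ≤ q)] {a : Ω → ℝ} (ha : MemLp a q volume)
    (φ : 𝓓(Ω, ℝ)) : Integrable (fun x : Ω => a x * φ x) :=
  integrable_mul_test ha φ.continuous φ.hasCompactSupport φ.tsupport_subset

variable {Ω} in
lemma integrable_mul_partialDeriv {q : ℝ≥0∞} [Fact (1 ≤ q)] {a : Ω → ℝ} (ha : MemLp a q volume)
    (φ : 𝓓(Ω, ℝ)) (i : Fin n) : Integrable (fun x : Ω => a x * partialDeriv φ i x) := by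
  refine integrable_mul_test ha ?_ ?_ ?_
  · exact (φ.contDiff.continuous_fderiv (by simp)).clm_apply continuous_const
  · exact φ.hasCompactSupport.fderiv_apply (𝕜 := ℝ) _
  · exact (tsupport_fderiv_apply_subset ℝ _).trans φ.tsupport_subset

/-- The Sobolev space `W^{1,q}(Ω)`, as the space of the pairs `(a, ∇a)` with `a ∈ L^q(Ω)` and
weak gradient `∇a ∈ L^q(Ω; ℝⁿ)`, with (a norm equivalent to) the usual norm. -/
def sobolev (q : ℝ≥0∞) [Fact (1 ≤ q)] :
    Submodule ℝ (Lp ℝ q (volume : Measure Ω) × Lp (Space n) q (volume : Measure Ω)) where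
  carrier := {w | IsWeakGradient Ω w.1 w.2}
  zero_mem' := by
    intro φ i
    have h1 : ∀ᵐ x : Ω, (0 : Lp ℝ q (volume : Measure Ω)) x * partialDeriv φ i x = 0 := by
      filter_upwards [Lp.coeFn_zero ℝ q (volume : Measure Ω)] with x hx
      rw [hx]; simp
    have h2 : ∀ᵐ x : Ω, (0 : Lp (Space n) q (volume : Measure Ω)) x i * φ x = 0 := by
      filter_upwards [Lp.coeFn_zero (Space n) q (volume : Measure Ω)] with x hx
      rw [hx]; simp
    simp only [Prod.fst_zero, Prod.snd_zero]
    rw [integral_congr_ae h1, integral_congr_ae h2]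
    simp
  add_mem' := by
    intro v w hv hw φ i
    have h1 : ∀ᵐ x : Ω, (v + w).1 x * partialDeriv φ i x =
        v.1 x * partialDeriv φ i x + w.1 x * partialDeriv φ i x := by
      filter_upwards [Lp.coeFn_add v.1 w.1] with x hx
      rw [Prod.fst_add, hx]; simp [add_mul]
    have h2 : ∀ᵐ x : Ω, (v + w).2 x i * φ x = v.2 x i * φ x + w.2 x i * φ x := by
      filter_upwards [Lp.coeFn_add v.2 w.2] with x hx
      rw [Prod.snd_add, hx]; simp [add_mul]
    rw [integral_congr_ae h1, integral_congr_ae h2,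
      integral_add (integrable_mul_partialDeriv (Lp.memLp v.1) φ i)
        (integrable_mul_partialDeriv (Lp.memLp w.1) φ i),
      integral_add (integrable_mul_test' ((Lp.memLp v.2).eval_piLp i) φ)
        (integrable_mul_test' ((Lp.memLp w.2).eval_piLp i) φ), hv φ i, hw φ i]
    ring
  smul_mem' := by
    intro c v hv φ i
    have h1 : ∀ᵐ x : Ω, (c • v).1 x * partialDeriv φ i x = c * (v.1 x * partialDeriv φ i x) := by
      filter_upwards [Lp.coeFn_smul c v.1] with x hx
      simp [hx, mul_assoc]
    have h2 : ∀ᵐ x : Ω, (c • v).2 x i * φ x = c * (v.2 x i * φ x) := by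
      filter_upwards [Lp.coeFn_smul c v.2] with x hx
      simp [hx, mul_assoc]
    rw [integral_congr_ae h1, integral_congr_ae h2, integral_const_mul, integral_const_mul, hv φ i]
    ring

/-- The space `W₀^{1,q}(Ω)`: the closure of `C_c^∞(Ω)` in `W^{1,q}(Ω)`. -/
def sobolevZero (q : ℝ≥0∞) [Fact (1 ≤ q)] : Set (sobolev Ω q) :=
  closure {v | ∃ φ : 𝓓(Ω, ℝ), ∀ᵐ x : Ω, v.1.1 x = φ x}

/-! ### Capacity and quasicontinuity -/

/-- The capacity `Cap_q(A, Ω)` of a subset `A` of `Ω`, for `1 ≤ q < ∞`: the infimum of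
`∫_Ω |∇v|^q` over all `v ∈ W₀^{1,q}(Ω)` with `v ≥ 1` a.e. in a neighbourhood of `A`. -/
def capacity (q : ℝ≥0∞) [Fact (1 ≤ q)] (A : Set Ω) : ℝ≥0∞ :=
  ⨅ v ∈ {v : sobolev Ω q | v ∈ sobolevZero Ω q ∧
      ∃ U : Set Ω, IsOpen U ∧ A ⊆ U ∧ ∀ᵐ x : Ω, x ∈ U → 1 ≤ v.1.1 x},
    ∫⁻ x : Ω, ‖v.1.2 x‖ₑ ^ q.toReal

/-- `Cap_q`-quasicontinuity of a function on `Ω`. -/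
def IsQuasicontinuous (q : ℝ≥0∞) [Fact (1 ≤ q)] (a : Ω → ℝ) : Prop :=
  ∀ ε : ℝ≥0∞, 0 < ε → ∃ A : Set Ω, capacity Ω q A < ε ∧ ContinuousOn a Aᶜ

/-- `a` is a `Cap_q`-quasicontinuous representative of `α ∈ W^{1,q}(Ω)`. -/
def IsQuasicontinuousRep (q : ℝ≥0∞) [Fact (1 ≤ q)] (α : sobolev Ω q) (a : Ω → ℝ) : Prop :=
  IsQuasicontinuous Ω q a ∧ ∀ᵐ x : Ω, a x = α.1.1 x

/-! ### Vector measures and functions of bounded deformation -/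

/-- Weak* convergence in `M_b(Ω; M_sym)`, in duality with `C₀(Ω; M_sym)`. -/
def WeakStarTendsto (μ : ℕ → VectorMeasure Ω (SymMat n)) (μ₀ : VectorMeasure Ω (SymMat n)) :
    Prop :=
  ∀ φ : C₀(Ω, SymMat n),
    Tendsto (fun k => ∫ᵛ x, φ x ∂[innerSL ℝ; μ k]) atTop (𝓝 (∫ᵛ x, φ x ∂[innerSL ℝ; μ₀]))

/-- The measure `μ` is the distributional symmetrised gradient of `u`, i.e.
`μ_{ij} = (D_j u_i + D_i u_j) / 2` in the sense of distributions on `Ω`. -/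
def IsSymGradient (u : Ω → Space n) (μ : VectorMeasure Ω (SymMat n)) : Prop :=
  ∀ (φ : 𝓓(Ω, ℝ)) (i j : Fin n),
    (∫ᵛ x, φ x ∂•μ : SymMat n).1 (i, j) =
      - (1 / 2) * ∫ x : Ω, (u x i * partialDeriv φ j x + u x j * partialDeriv φ i x)

/-- The functions of bounded deformation `BD(Ω)`: the `u ∈ L¹(Ω; ℝⁿ)` whose distributional
symmetrised gradient is a bounded Radon measure. -/
def BD : Set (Lp (Space n) 1 (volume : Measure Ω)) :=
  {u | ∃ μ : VectorMeasure Ω (SymMat n), IsSymGradient Ω u μ}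

variable {Ω}

/-- The symmetrised gradient `Eu` of `u ∈ BD(Ω)`. -/
def BD.strain (u : BD Ω) : VectorMeasure Ω (SymMat n) := Classical.choose u.2

/-- Weak* convergence in `BD(Ω)`. -/
def BD.WeakStarTendsto (u : ℕ → BD Ω) (u₀ : BD Ω) : Prop :=
  Tendsto (fun k => (u k : Lp (Space n) 1 (volume : Measure Ω))) atTop (𝓝 (u₀ : Lp _ 1 _)) ∧
    PlasticDamage.WeakStarTendsto Ω (fun k => BD.strain (u k)) (BD.strain u₀)

/-- The Radon-Nikodym derivative `dp/d|p|` of a matrix-valued measure with respect to its total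
variation, computed componentwise in an orthonormal basis. -/
def polarDensity (p : VectorMeasure Ω (SymMat n)) (x : Ω) : SymMat n :=
  ∑ i, SignedMeasure.rnDeriv
    (p.mapRange (innerSL ℝ (stdOrthonormalBasis ℝ (SymMat n) i)).toLinearMap.toAddMonoidHom
      (innerSL ℝ (stdOrthonormalBasis ℝ (SymMat n) i)).continuous) p.variation x •
    stdOrthonormalBasis ℝ (SymMat n) i

/-- The plastic potential `∫_Ω V(a) H(x, dp/d|p|) d|p|` (with the convention `0 · ∞ = 0`). -/
def plasticPotential (V : ℝ → ℝ≥0∞) (H : Ω × SymMat n → ℝ≥0∞) (a : Ω → ℝ)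
    (p : VectorMeasure Ω (SymMat n)) : ℝ≥0∞ :=
  ∫⁻ x, V (a x) * H (x, polarDensity p x) ∂p.variation

/-- Weak convergence of a sequence in a normed space. -/
def WeakTendsto {X : Type*} [NormedAddCommGroup X] [NormedSpace ℝ X] (f : ℕ → X) (f₀ : X) : Prop :=
  Tendsto (fun k => toWeakSpace ℝ X (f k)) atTop (𝓝 (toWeakSpace ℝ X f₀))

end PlasticDamage

end

/-! On unit matrices `V(s) H(x, ξ)` is, up to `ε`, a countable supremum of smooth functions `φ(x)
v(s) ⟪a, ξ⟫` lying below it: semicontinuity localises in `s` and `x`, and Hahn-Banach supplies `a`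
because `H(x, ·)` is sublinear (`exists_admissibleTest`, `exists_seq_admissibleTest`). The integral
of a finite supremum is a sum over disjoint sets, whose indicators are replaced by smooth cut-offs
with disjoint supports. Lower semicontinuity therefore reduces to the convergence, up to arbitrarily
small errors, of the linear quantities `∫ θ v(α̃_k) ⟪a, dp_k⟫`.

The matrices `ξ ⊗ ξ` span the symmetric ones, and `⟪ξ ⊗ ξ, Eu⟫ = ∂_ξ(u · ξ)`: one component is
differentiated in its own direction. With `Eu = e + p` the chain rule (`integral_comp_plastic`)
reads `∫ θ v(α̃) ⟪ξ ⊗ ξ, dp⟫ = -∫ θ v(α) ⟪ξ ⊗ ξ, e⟫ - ∫ (u · ξ) v(α) ∂_ξθ - ∫ (u · ξ) θ v'(α) ∂_ξα`.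
By Rellich `α_k` converges in `L¹_loc`. The first two integrals on the right then converge, the
first by weak convergence of `e_k` and the second by `L¹` convergence of `u_k`. The third pairs
`L^{n/(n-1)}` with `L^n` critically, and `u_k - u` is small only in `L¹`. If `‖∇α_k‖` is at most `δ`
in `L^n` on small balls, Hölder and a local Sobolev inequality bound the contribution of `u_k - u`
by a constant times `δ` (`exists_eventually_lintegral_le_of_no_concentration`). The points where
this fails form a finite set, because `∇α_k` is bounded in `L^n`. Since `n ≥ 2`, the measure `p`
does not charge points (`variation_singleton`), so the cut-offs may avoid that set. An ultrafilter
finer than `atTop` makes the concentration set well defined without extracting subsequences.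

The chain rule must see the quasicontinuous representative, because `p` may charge Lebesgue null
sets. This is handled by slicing. A set of small capacity meets few lines in a given direction, so
`α̃` is continuous on almost every line. A subsequence of the mollifications of a cut-off of `α̃`
then converges to it outside a set null along lines (`exists_subseq_mollify_tendsto`). A measure
that is a derivative in direction `ξ` does not see such sets (`ae_eq_zero_of_lineNull`), and
dominated convergence applies.

The Sobolev inequality for `BD` (`exists_lintegral_rpow_le_of_deformation`) also uses only the
quantities `∂_ξ(u · ξ)`. A Gagliardo-Nirenberg product estimate is applied along every choice of `n`
among `2n` vectors of the moment curve; for each nonzero value of `u` some choice consists of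
directions in which `u · ξ` does not vanish. -/

noncomputable section

namespace PlasticDamage

open scoped ContDiff Convolution

/-! ### Mollification in `L^p`, translation estimates and a Rellich theorem. -/

section Mollification

variable {E : Type*} [NormedAddCommGroup E] [InnerProductSpace ℝ E] [FiniteDimensional ℝ E]
  [MeasurableSpace E] [BorelSpace E]

/-- A standard sequence of bump functions at the origin with radii tending to `0`. -/
def mollifier (E : Type*) [NormedAddCommGroup E] [InnerProductSpace ℝ E] (j : ℕ) :
    ContDiffBump (0 : E) :=
  ⟨1 / (2 * (j + 1)), 1 / (j + 1), by positivity, by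
    apply one_div_lt_one_div_of_lt <;> (have : (0 : ℝ) ≤ j := by positivity) <;> linarith⟩

/-- The mollification of a function at scale `1 / (j + 1)`. -/
def mollify (j : ℕ) (f : E → ℝ) : E → ℝ :=
  ((mollifier E j).normed volume) ⋆[ContinuousLinearMap.lsmul ℝ ℝ, volume] f

/-- `g` is the weak derivative of `f` in the direction `ξ` on the whole space. -/
def HasWeakDeriv (f g : E → ℝ) (ξ : E) : Prop :=
  ∀ φ : E → ℝ, ContDiff ℝ ∞ φ → HasCompactSupport φ →
    ∫ x, f x * fderiv ℝ φ x ξ = - ∫ x, g x * φ x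

lemma tendsto_mollifier_rOut : Tendsto (fun j => (mollifier E j).rOut) atTop (𝓝 0) :=
  tendsto_one_div_add_atTop_nhds_zero_nat

lemma mollifier_rOut_le_one (j : ℕ) : (mollifier E j).rOut ≤ 1 := by
  change 1 / ((j : ℝ) + 1) ≤ 1
  rw [div_le_one (by positivity)]
  have : (0 : ℝ) ≤ j := by positivity
  linarith

lemma contDiff_mollify {f : E → ℝ} (hf : LocallyIntegrable f) (j : ℕ) :
    ContDiff ℝ ∞ (mollify j f) :=
  (mollifier E j).hasCompactSupport_normed.contDiff_convolution_left _
    (mollifier E j).contDiff_normed hf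

lemma mollify_apply (f : E → ℝ) (j : ℕ) (x : E) :
    mollify j f x = ∫ y, (mollifier E j).normed volume (x - y) * f y := by
  rw [mollify, convolution_eq_swap]; rfl

lemma mollify_apply' (f : E → ℝ) (j : ℕ) (x : E) :
    mollify j f x = ∫ h, (mollifier E j).normed volume h * f (x - h) := rfl

lemma ae_tendsto_mollify {f : E → ℝ} (hf : LocallyIntegrable f) :
    ∀ᵐ x, Tendsto (fun j => mollify j f x) atTop (𝓝 (f x)) := by
  refine ContDiffBump.ae_convolution_tendsto_right_of_locallyIntegrable (K := 2)
    tendsto_mollifier_rOut (Eventually.of_forall fun j => ?_) hf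
  change 1 / ((j : ℝ) + 1) ≤ 2 * (1 / (2 * (j + 1)))
  field_simp; exact le_rfl

lemma contDiff_mollifier_sub (j : ℕ) (x : E) :
    ContDiff ℝ ∞ (fun y => (mollifier E j).normed volume (x - y)) :=
  (mollifier E j).contDiff_normed.comp (contDiff_const.sub contDiff_id)

lemma hasCompactSupport_mollifier_sub (j : ℕ) (x : E) :
    HasCompactSupport (fun y => (mollifier E j).normed volume (x - y)) :=
  (mollifier E j).hasCompactSupport_normed.comp_homeomorph (Homeomorph.subLeft x)

lemma fderiv_mollify_eq_integral {f : E → ℝ} (hf : LocallyIntegrable f) (j : ℕ) (x ξ : E) :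
    fderiv ℝ (mollify j f) x ξ =
      ∫ y, fderiv ℝ ((mollifier E j).normed volume) (x - y) ξ * f y := by
  have h := ((mollifier E j).hasCompactSupport_normed
    (μ := (volume : Measure E))).hasFDerivAt_convolution_left
    (μ := (volume : Measure E)) (ContinuousLinearMap.lsmul ℝ ℝ)
    ((mollifier E j).contDiff_normed (n := 1)) hf x
  rw [mollify, h.fderiv, convolution_eq_swap]
  have hintegrable : Integrable (fun t => ((ContinuousLinearMap.lsmul ℝ ℝ).precompL E)
      (fderiv ℝ ((mollifier E j).normed volume) (x - t)) (f t)) := by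
    have hc : Continuous (fderiv ℝ ((mollifier E j).normed volume)) :=
      ((mollifier E j).contDiff_normed (n := 1)).continuous_fderiv (by simp)
    have := ((mollifier E j).hasCompactSupport_normed (μ := (volume : Measure E))).fderiv
      (𝕜 := ℝ)
    have h2 := this.convolutionExists_left ((ContinuousLinearMap.lsmul ℝ ℝ).precompL E) hc hf x
    exact h2.integrable_swap
  rw [ContinuousLinearMap.integral_apply hintegrable]
  rfl

lemma fderiv_mollifier_sub (j : ℕ) (x ξ y : E) :
    fderiv ℝ (fun y => (mollifier E j).normed volume (x - y)) y ξ =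
      - fderiv ℝ ((mollifier E j).normed volume) (x - y) ξ := by
  have hd : DifferentiableAt ℝ ((mollifier E j).normed (volume : Measure E)) (x - y) :=
    ((mollifier E j).contDiff_normed (n := 1)).differentiable (by simp) _
  have h4 := (hd.hasFDerivAt.comp y ((hasFDerivAt_id y).const_sub x)).fderiv
  simp only [Function.comp_def] at h4
  rw [h4]; simp

lemma fderiv_mollify {f g : E → ℝ} {ξ : E} (h : HasWeakDeriv f g ξ) (hf : LocallyIntegrable f)
    (j : ℕ) (x : E) : fderiv ℝ (mollify j f) x ξ = mollify j g x := by
  rw [fderiv_mollify_eq_integral hf, mollify_apply]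
  have := h _ (contDiff_mollifier_sub j x) (hasCompactSupport_mollifier_sub j x)
  simp only [fderiv_mollifier_sub j x ξ, mul_neg, integral_neg, neg_inj] at this
  rw [← integral_congr_ae (Eventually.of_forall fun y => mul_comm (f y) _), this]
  exact integral_congr_ae (Eventually.of_forall fun y => mul_comm (g y) _)

lemma mollify_eq_zero {f : E → ℝ} {R : ℝ} (hf : ∀ x, R < ‖x‖ → f x = 0) (j : ℕ) {x : E}
    (hx : R + 1 < ‖x‖) : mollify j f x = 0 := by
  rw [mollify_apply']
  refine integral_eq_zero_of_ae (Eventually.of_forall fun h => ?_)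
  by_cases hh : ‖h‖ < (mollifier E j).rOut
  · have : R < ‖x - h‖ := by
      have h1 := norm_sub_norm_le x h
      have h2 := mollifier_rOut_le_one (E := E) j
      linarith
    simp [hf _ this]
  · have : h ∉ Function.support ((mollifier E j).normed (volume : Measure E)) := by
      rw [ContDiffBump.support_normed_eq]; simpa using hh
    simp [Function.notMem_support.1 this]

/-- Translation is continuous in `L^p`. -/
lemma tendsto_eLpNorm_translate_sub {p : ℝ≥0∞} [Fact (1 ≤ p)] (hp : p ≠ ⊤) {f : E → ℝ}
    (hf : MemLp f p) :
    Tendsto (fun h : E => eLpNorm (fun x => f (x - h) - f x) p volume) (𝓝 0) (𝓝 0) := by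
  let g : C(E, C(E, E)) := (ContinuousMap.mk (fun a : E × E => a.2 - a.1) (by fun_prop)).curry
  have hg : ∀ h : E, MeasurePreserving (g h) (volume : Measure E) volume := fun h =>
    measurePreserving_sub_right volume h
  have hc := Continuous.compMeasurePreservingLp (f := fun _ : E => hf.toLp f) (g := g)
    continuous_const g.continuous hg hp
  have h0 := (hc.tendsto 0)
  have h1 : (Lp.compMeasurePreserving (g 0) (hg 0)) (hf.toLp f) = hf.toLp f := by
    rw [Lp.toLp_compMeasurePreserving]
    congr 1
    ext x; simp [g]
  rw [h1, tendsto_iff_edist_tendsto_0] at h0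
  refine h0.congr fun h => ?_
  rw [Lp.toLp_compMeasurePreserving, Lp.edist_toLp_toLp]
  rfl

lemma isProbabilityMeasure_mollifier (j : ℕ) : IsProbabilityMeasure
    ((volume : Measure E).withDensity fun h =>
      ENNReal.ofReal ((mollifier E j).normed volume h)) := by
  constructor
  rw [withDensity_apply _ MeasurableSet.univ, Measure.restrict_univ,
    ← ofReal_integral_eq_lintegral_ofReal (mollifier E j).integrable_normed
      (Eventually.of_forall fun h => (mollifier E j).nonneg_normed h)]
  simp [(mollifier E j).integral_normed]

lemma mollify_sub_eq_integral {f : E → ℝ} (hf : LocallyIntegrable f) (j : ℕ) (x : E) :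
    mollify j f x - f x = ∫ h, (mollifier E j).normed volume h * (f (x - h) - f x) := by
  have h1 : Integrable (fun h => (mollifier E j).normed volume h * f (x - h)) :=
    (mollifier E j).hasCompactSupport_normed.convolutionExists_left
      (ContinuousLinearMap.lsmul ℝ ℝ) (mollifier E j).continuous_normed hf x
  have h2 : Integrable (fun h => (mollifier E j).normed volume h * f x) :=
    (mollifier E j).integrable_normed.mul_const _
  simp only [mul_sub]
  rw [integral_sub h1 h2, mollify_apply', integral_mul_const, (mollifier E j).integral_normed,
    one_mul]

/-- The mollification is an average of translates against a probability density, so Jensen's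
inequality and Tonelli pass any bound on small translates to it. -/
lemma lintegral_enorm_mollify_sub_rpow_le {f : E → ℝ} (hf : LocallyIntegrable f) {r : ℝ}
    (hr : 1 ≤ r) {C : ℝ≥0∞} (j : ℕ)
    (hC : ∀ h : E, ‖h‖ < (mollifier E j).rOut → ∫⁻ x, ‖f (x - h) - f x‖ₑ ^ r ≤ C) :
    ∫⁻ x, ‖mollify j f x - f x‖ₑ ^ r ≤ C := by
  have hr0 : 0 < r := by linarith
  set ρ : E → ℝ := (mollifier E j).normed volume
  set π : Measure E := (volume : Measure E).withDensity fun h => ENNReal.ofReal (ρ h) with hπ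
  have : IsProbabilityMeasure π := isProbabilityMeasure_mollifier j
  have hρm : Measurable fun h => ENNReal.ofReal (ρ h) :=
    ENNReal.measurable_ofReal.comp (mollifier E j).continuous_normed.measurable
  have hfm : AEStronglyMeasurable f volume := hf.aestronglyMeasurable
  have hmx : ∀ x : E, AEStronglyMeasurable (fun h => f (x - h) - f x) volume := fun x =>
    (hfm.comp_quasiMeasurePreserving (quasiMeasurePreserving_sub_left volume x)).sub
      aestronglyMeasurable_const
  have hpt : ∀ x, ‖mollify j f x - f x‖ₑ ^ r ≤
      ∫⁻ h, ENNReal.ofReal (ρ h) * ‖f (x - h) - f x‖ₑ ^ r := by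
    intro x
    rw [mollify_sub_eq_integral hf]
    have e1 : ‖∫ h, ρ h * (f (x - h) - f x)‖ₑ ≤ ∫⁻ h, ‖f (x - h) - f x‖ₑ ∂π := by
      refine (enorm_integral_le_lintegral_enorm _).trans ?_
      rw [hπ, lintegral_withDensity_eq_lintegral_mul₀ hρm.aemeasurable (hmx x).enorm]
      refine lintegral_mono fun h => ?_
      simp only [enorm_mul, Pi.mul_apply]
      gcongr
      rw [Real.enorm_eq_ofReal ((mollifier E j).nonneg_normed h)]
    -- Jensen, in the form that `L^r` norms on a probability space increase with `r`.
    have e2 : ∫⁻ h, ‖f (x - h) - f x‖ₑ ∂π ≤ (∫⁻ h, ‖f (x - h) - f x‖ₑ ^ r ∂π) ^ (1 / r) := by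
      have := eLpNorm_le_eLpNorm_of_exponent_le (p := 1) (q := ENNReal.ofReal r) (μ := π)
        (by simpa using hr) ((hmx x).mono_ac (withDensity_absolutelyContinuous _ _))
      rwa [eLpNorm_one_eq_lintegral_enorm, eLpNorm_eq_lintegral_rpow_enorm_toReal
        (by simpa using hr0) (by simp), ENNReal.toReal_ofReal hr0.le] at this
    calc ‖∫ h, ρ h * (f (x - h) - f x)‖ₑ ^ r
        ≤ ((∫⁻ h, ‖f (x - h) - f x‖ₑ ^ r ∂π) ^ (1 / r)) ^ r := by gcongr; exact e1.trans e2
      _ = ∫⁻ h, ‖f (x - h) - f x‖ₑ ^ r ∂π := by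
          rw [← ENNReal.rpow_mul, one_div_mul_cancel hr0.ne', ENNReal.rpow_one]
      _ = ∫⁻ h, ENNReal.ofReal (ρ h) * ‖f (x - h) - f x‖ₑ ^ r := by
          rw [hπ, lintegral_withDensity_eq_lintegral_mul₀ hρm.aemeasurable
            ((hmx x).enorm.pow_const _)]
          rfl
  have hjoint : AEMeasurable (Function.uncurry fun (x h : E) =>
      ENNReal.ofReal (ρ h) * ‖f (x - h) - f x‖ₑ ^ r)
      ((volume : Measure E).prod (volume : Measure E)) := by
    refine AEMeasurable.mul ((hρm.comp measurable_snd).aemeasurable) ?_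
    refine AEMeasurable.pow_const (AEStronglyMeasurable.enorm ?_) _
    refine AEStronglyMeasurable.sub ?_ ?_
    · exact hfm.comp_quasiMeasurePreserving (quasiMeasurePreserving_sub volume volume)
    · exact hfm.comp_quasiMeasurePreserving Measure.quasiMeasurePreserving_fst
  calc ∫⁻ x, ‖mollify j f x - f x‖ₑ ^ r
      ≤ ∫⁻ x, ∫⁻ h, ENNReal.ofReal (ρ h) * ‖f (x - h) - f x‖ₑ ^ r := lintegral_mono hpt
    _ = ∫⁻ h, ∫⁻ x, ENNReal.ofReal (ρ h) * ‖f (x - h) - f x‖ₑ ^ r := lintegral_lintegral_swap hjoint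
    _ = ∫⁻ h, ENNReal.ofReal (ρ h) * ∫⁻ x, ‖f (x - h) - f x‖ₑ ^ r := by
        refine lintegral_congr fun h => ?_
        rw [lintegral_const_mul' _ _ ENNReal.ofReal_ne_top]
    _ ≤ ∫⁻ h, ENNReal.ofReal (ρ h) * C := by
        refine lintegral_mono fun h => ?_
        by_cases hh : ‖h‖ < (mollifier E j).rOut
        · simp only; gcongr; exact hC h hh
        · have : h ∉ Function.support ρ := by
            rw [ContDiffBump.support_normed_eq]; simpa using hh
          simp [Function.notMem_support.1 this]
    _ = C := by
        rw [lintegral_mul_const _ hρm]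
        have := measure_univ (μ := π)
        rw [hπ, withDensity_apply _ MeasurableSet.univ, Measure.restrict_univ] at this
        rw [this, one_mul]

lemma tendsto_eLpNorm_mollify_sub {p : ℝ≥0∞} [hp1 : Fact (1 ≤ p)] (hp : p ≠ ⊤) {f : E → ℝ}
    (hf : MemLp f p) :
    Tendsto (fun j => eLpNorm (fun x => mollify j f x - f x) p volume) atTop (𝓝 0) := by
  have hloc : LocallyIntegrable f := hf.locallyIntegrable hp1.out
  have hp0 : p ≠ 0 := (zero_lt_one.trans_le hp1.out).ne'
  have hr : 1 ≤ p.toReal := by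
    simpa using ENNReal.toReal_mono hp hp1.out
  have hr0 : 0 < p.toReal := by linarith
  rw [ENNReal.tendsto_nhds_zero]
  intro ε hε
  have h1 := (ENNReal.tendsto_nhds_zero.1 (tendsto_eLpNorm_translate_sub hp hf)) ε hε
  obtain ⟨δ, hδ, hball⟩ := Metric.eventually_nhds_iff_ball.1 h1
  filter_upwards [(tendsto_order.1 (tendsto_mollifier_rOut (E := E))).2 δ hδ] with j hj
  rw [eLpNorm_eq_lintegral_rpow_enorm_toReal hp0 hp, one_div, ENNReal.rpow_inv_le_iff hr0]
  refine lintegral_enorm_mollify_sub_rpow_le hloc hr j fun h hh => ?_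
  have := hball h (by simpa using hh.trans hj)
  rwa [eLpNorm_eq_lintegral_rpow_enorm_toReal hp0 hp, one_div, ENNReal.rpow_inv_le_iff hr0] at this

/-- `g` is the weak gradient of `f` on the whole space. -/
def HasWeakGrad (f : E → ℝ) (g : E → E) : Prop :=
  ∀ ξ : E, HasWeakDeriv f (fun x => inner ℝ (g x) ξ) ξ

lemma lintegral_enorm_mollifier (j : ℕ) :
    ∫⁻ h : E, ‖(mollifier E j).normed volume h‖ₑ = 1 := by
  have := measure_univ (μ := (volume : Measure E).withDensity fun h =>
    ENNReal.ofReal ((mollifier E j).normed volume h)) (self := isProbabilityMeasure_mollifier j)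
  rw [withDensity_apply _ MeasurableSet.univ, Measure.restrict_univ] at this
  rw [← this]
  exact lintegral_congr fun h => Real.enorm_eq_ofReal ((mollifier E j).nonneg_normed h)

lemma lintegral_enorm_mollify_le {f : E → ℝ} (hfm : AEStronglyMeasurable f volume) (j : ℕ) :
    ∫⁻ x, ‖mollify j f x‖ₑ ≤ ∫⁻ x, ‖f x‖ₑ := by
  set ρ : E → ℝ := (mollifier E j).normed volume
  have hρm : Measurable fun h => ‖ρ h‖ₑ :=
    (mollifier E j).continuous_normed.enorm.measurable
  have hjoint : AEMeasurable (Function.uncurry fun (x h : E) => ‖ρ h‖ₑ * ‖f (x - h)‖ₑ)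
      ((volume : Measure E).prod (volume : Measure E)) := by
    refine AEMeasurable.mul ((hρm.comp measurable_snd).aemeasurable) (AEStronglyMeasurable.enorm ?_)
    exact hfm.comp_quasiMeasurePreserving (quasiMeasurePreserving_sub volume volume)
  calc ∫⁻ x, ‖mollify j f x‖ₑ ≤ ∫⁻ x, ∫⁻ h, ‖ρ h‖ₑ * ‖f (x - h)‖ₑ := by
        refine lintegral_mono fun x => ?_
        rw [mollify_apply']
        refine (enorm_integral_le_lintegral_enorm _).trans_eq ?_
        simp only [enorm_mul, ρ]
    _ = ∫⁻ h, ∫⁻ x, ‖ρ h‖ₑ * ‖f (x - h)‖ₑ := lintegral_lintegral_swap hjoint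
    _ = ∫⁻ h, ‖ρ h‖ₑ * ∫⁻ x, ‖f x‖ₑ := by
        refine lintegral_congr fun h => ?_
        rw [lintegral_const_mul' _ _ enorm_ne_top, lintegral_sub_right_eq_self (fun x => ‖f x‖ₑ) h]
    _ = ∫⁻ x, ‖f x‖ₑ := by
        rw [lintegral_mul_const _ hρm]
        rw [lintegral_enorm_mollifier j, one_mul]

/-- The increment is the integral of the derivative along a segment; after Tonelli every point of
the segment contributes the same integral by translation invariance. -/
lemma lintegral_enorm_translate_sub_le_of_contDiff {f : E → ℝ} (hf : ContDiff ℝ 1 f) (h : E) :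
    ∫⁻ x, ‖f (x - h) - f x‖ₑ ≤ ∫⁻ x, ‖fderiv ℝ f x h‖ₑ := by
  have hc : Continuous fun x => fderiv ℝ f x h :=
    (hf.continuous_fderiv (by simp)).clm_apply continuous_const
  have hpt : ∀ x, ‖f (x - h) - f x‖ₑ ≤ ∫⁻ t in Ioc (0 : ℝ) 1, ‖fderiv ℝ f (x - t • h) h‖ₑ := by
    intro x
    have hd : ∀ t ∈ uIcc (0 : ℝ) 1,
        HasDerivAt (fun t : ℝ => f (x - t • h)) (- fderiv ℝ f (x - t • h) h) t := by
      intro t _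
      have h1 : HasDerivAt (fun t : ℝ => x - t • h) (-h) t := by
        simpa using ((hasDerivAt_id t).smul_const h).const_sub x
      have h2 := ((hf.differentiable (by simp)) (x - t • h)).hasFDerivAt.comp_hasDerivAt t h1
      exact h2.congr_deriv (by simp)
    have hcont : Continuous fun t : ℝ => - fderiv ℝ f (x - t • h) h :=
      (hc.comp (by fun_prop : Continuous fun t : ℝ => x - t • h)).neg
    have := intervalIntegral.integral_eq_sub_of_hasDerivAt hd (hcont.intervalIntegrable _ _)
    simp only [one_smul, zero_smul, sub_zero] at this
    rw [← this, intervalIntegral.integral_of_le zero_le_one]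
    refine (enorm_integral_le_lintegral_enorm _).trans_eq ?_
    simp
  calc ∫⁻ x, ‖f (x - h) - f x‖ₑ
      ≤ ∫⁻ x, ∫⁻ t in Ioc (0 : ℝ) 1, ‖fderiv ℝ f (x - t • h) h‖ₑ := lintegral_mono hpt
    _ = ∫⁻ t in Ioc (0 : ℝ) 1, ∫⁻ x, ‖fderiv ℝ f (x - t • h) h‖ₑ := by
        refine lintegral_lintegral_swap (Continuous.aemeasurable ?_)
        exact (hc.comp (by fun_prop : Continuous fun z : E × ℝ => z.1 - z.2 • h)).enorm
    _ = ∫⁻ _t in Ioc (0 : ℝ) 1, ∫⁻ x, ‖fderiv ℝ f x h‖ₑ := by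
        refine lintegral_congr fun t => ?_
        exact lintegral_sub_right_eq_self (fun x => ‖fderiv ℝ f x h‖ₑ) (t • h)
    _ = ∫⁻ x, ‖fderiv ℝ f x h‖ₑ := by simp

/-- The smooth estimate applied to the mollifications, whose derivatives are the mollifications of
`g`, and Fatou's lemma. -/
lemma lintegral_enorm_translate_sub_le {f g : E → ℝ} {h : E} (hfg : HasWeakDeriv f g h)
    (hf : LocallyIntegrable f) (hg : AEStronglyMeasurable g volume) :
    ∫⁻ x, ‖f (x - h) - f x‖ₑ ≤ ∫⁻ x, ‖g x‖ₑ := by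
  have h1 := ae_tendsto_mollify hf
  have h2 : ∀ᵐ x : E, Tendsto (fun j => mollify j f (x - h)) atTop (𝓝 (f (x - h))) :=
    (measurePreserving_sub_right volume h).quasiMeasurePreserving.ae h1
  calc ∫⁻ x, ‖f (x - h) - f x‖ₑ
      ≤ ∫⁻ x, liminf (fun j => ‖mollify j f (x - h) - mollify j f x‖ₑ) atTop := by
        refine lintegral_mono_ae ?_
        filter_upwards [h1, h2] with x hx hx'
        exact ((hx'.sub hx).enorm.liminf_eq).ge
    _ ≤ liminf (fun j => ∫⁻ x, ‖mollify j f (x - h) - mollify j f x‖ₑ) atTop := by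
        refine lintegral_liminf_le fun j => Continuous.measurable ?_
        have := (contDiff_mollify hf j).continuous
        exact ((this.comp (by fun_prop)).sub this).enorm
    _ ≤ liminf (fun _ : ℕ => ∫⁻ x, ‖g x‖ₑ) atTop := by
        refine liminf_le_liminf (Eventually.of_forall fun j => ?_)
        refine (lintegral_enorm_translate_sub_le_of_contDiff
          ((contDiff_mollify hf j).of_le (by exact_mod_cast le_top)) h).trans ?_
        simp only [fderiv_mollify hfg hf]
        exact lintegral_enorm_mollify_le hg j
    _ = ∫⁻ x, ‖g x‖ₑ := liminf_const _

/-- A rate depending on `f` only through the `L¹` norm of its gradient; this uniformity is what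
yields compactness. -/
lemma lintegral_enorm_mollify_sub_le {f : E → ℝ} {g : E → E} (hfg : HasWeakGrad f g)
    (hf : LocallyIntegrable f) (hg : AEStronglyMeasurable g volume) (j : ℕ) :
    ∫⁻ x, ‖mollify j f x - f x‖ₑ ≤ ENNReal.ofReal (mollifier E j).rOut * ∫⁻ x, ‖g x‖ₑ := by
  have := lintegral_enorm_mollify_sub_rpow_le hf le_rfl j
    (C := ENNReal.ofReal (mollifier E j).rOut * ∫⁻ x, ‖g x‖ₑ) (fun h hh => ?_)
  · simpa using this
  · simp only [ENNReal.rpow_one]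
    refine (lintegral_enorm_translate_sub_le (hfg h) hf (hg.inner aestronglyMeasurable_const)).trans
      ?_
    rw [← lintegral_const_mul' _ _ ENNReal.ofReal_ne_top]
    refine lintegral_mono fun x => ?_
    simp only [← ofReal_norm]
    rw [← ENNReal.ofReal_mul (mollifier E j).rOut_pos.le]
    refine ENNReal.ofReal_le_ofReal ((norm_inner_le_norm _ _).trans ?_)
    rw [mul_comm]
    gcongr

/-- A compactness statement of Rellich type: for functions supported in a fixed ball with bounded
weak gradients, weak convergence implies strong convergence in `L¹`. -/
lemma tendsto_lintegral_enorm_sub_of_weak {f : ℕ → E → ℝ} {f₀ : E → ℝ} {g : ℕ → E → E}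
    {g₀ : E → E} {R : ℝ} {M : ℝ≥0∞} (hM : M ≠ ⊤)
    (hf : ∀ k, Integrable (f k)) (hf₀ : Integrable f₀)
    (hfR : ∀ k x, R < ‖x‖ → f k x = 0) (hfR₀ : ∀ x, R < ‖x‖ → f₀ x = 0)
    (hg : ∀ k, AEStronglyMeasurable (g k) volume) (hg₀ : AEStronglyMeasurable g₀ volume)
    (hfg : ∀ k, HasWeakGrad (f k) (g k)) (hfg₀ : HasWeakGrad f₀ g₀)
    (hfM : ∀ k, ∫⁻ x, ‖f k x‖ₑ ≤ M) (hgM : ∀ k, ∫⁻ x, ‖g k x‖ₑ ≤ M) (hgM₀ : ∫⁻ x, ‖g₀ x‖ₑ ≤ M)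
    (hw : ∀ ψ : E → ℝ, Continuous ψ → HasCompactSupport ψ →
      Tendsto (fun k => ∫ x, f k x * ψ x) atTop (𝓝 (∫ x, f₀ x * ψ x))) :
    Tendsto (fun k => ∫⁻ x, ‖f k x - f₀ x‖ₑ) atTop (𝓝 0) := by
  have hsmall : Tendsto (fun j => ENNReal.ofReal (mollifier E j).rOut * M) atTop (𝓝 0) := by
    have := ENNReal.Tendsto.mul_const (b := M)
      (ENNReal.tendsto_ofReal (tendsto_mollifier_rOut (E := E))) (Or.inr hM)
    simpa using this
  -- At a fixed scale, weak convergence tested on the translated kernels gives pointwise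
  -- convergence, and a common bound on a common ball allows dominated convergence.
  have hmoll : ∀ j, Tendsto (fun k => ∫⁻ x, ‖mollify j (f k) x - mollify j f₀ x‖ₑ) atTop
      (𝓝 0) := by
    intro j
    set ρ : E → ℝ := (mollifier E j).normed volume
    obtain ⟨C, hC⟩ := (mollifier E j).hasCompactSupport_normed.exists_bound_of_continuous
      ((mollifier E j).continuous_normed (μ := (volume : Measure E)))
    have hbd : ∀ k x, ‖mollify j (f k) x‖ₑ ≤ ENNReal.ofReal C * M := by
      intro k x
      rw [mollify_apply]
      refine (enorm_integral_le_lintegral_enorm _).trans ?_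
      refine le_trans ?_ (mul_le_mul_right (hfM k) _)
      rw [← lintegral_const_mul' _ _ ENNReal.ofReal_ne_top]
      refine lintegral_mono fun y => ?_
      rw [enorm_mul]
      gcongr
      rw [← ofReal_norm]
      exact ENNReal.ofReal_le_ofReal (hC _)
    have hlim : ∀ x, Tendsto (fun k => mollify j (f k) x) atTop (𝓝 (mollify j f₀ x)) := by
      intro x
      have := hw _ (contDiff_mollifier_sub j x).continuous (hasCompactSupport_mollifier_sub j x)
      simp only [mollify_apply]
      simpa only [mul_comm] using this
    have hbd₀ : ∀ x, ‖mollify j f₀ x‖ₑ ≤ ENNReal.ofReal C * M := fun x =>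
      le_of_tendsto (hlim x).enorm (Eventually.of_forall fun k => hbd k x)
    have h0 : (0 : ℝ≥0∞) = ∫⁻ _x : E, 0 := by simp
    rw [h0]
    refine tendsto_lintegral_of_dominated_convergence
      ((Metric.closedBall (0 : E) (R + 1)).indicator
        fun _ => ENNReal.ofReal C * M + ENNReal.ofReal C * M) (fun k => ?_) (fun k => ?_) ?_ ?_
    · exact ((contDiff_mollify (hf k).locallyIntegrable j).continuous.sub
        (contDiff_mollify hf₀.locallyIntegrable j).continuous).enorm.measurable
    · refine Eventually.of_forall fun x => ?_
      by_cases hx : x ∈ Metric.closedBall (0 : E) (R + 1)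
      · rw [indicator_of_mem hx]
        exact (enorm_sub_le).trans (add_le_add (hbd k x) (hbd₀ x))
      · have hx' : R + 1 < ‖x‖ := by simpa using hx
        simp [mollify_eq_zero (hfR k) j hx', mollify_eq_zero hfR₀ j hx']
    · rw [lintegral_indicator Metric.isClosed_closedBall.measurableSet, lintegral_const,
        Measure.restrict_apply_univ]
      refine ENNReal.mul_ne_top ?_ (measure_closedBall_lt_top).ne
      exact ENNReal.add_ne_top.2 ⟨ENNReal.mul_ne_top ENNReal.ofReal_ne_top hM,
        ENNReal.mul_ne_top ENNReal.ofReal_ne_top hM⟩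
    · refine Eventually.of_forall fun x => ?_
      have := ((hlim x).sub_const (mollify j f₀ x)).enorm
      simpa using this
  rw [ENNReal.tendsto_nhds_zero]
  intro ε hε
  have hε3 : 0 < ε / 3 := ENNReal.div_pos hε.ne' (by simp)
  -- The scale is fixed before `k`: the mollification error is at most the radius times `M` for
  -- every `k`.
  obtain ⟨j, hj⟩ := ((ENNReal.tendsto_nhds_zero.1 hsmall) (ε / 3) hε3).exists
  filter_upwards [(ENNReal.tendsto_nhds_zero.1 (hmoll j)) (ε / 3) hε3] with k hk
  have hmes : ∀ φ : E → ℝ, Integrable φ →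
      AEMeasurable (fun x => ‖mollify j φ x - φ x‖ₑ) volume := fun φ hφ =>
    ((contDiff_mollify hφ.locallyIntegrable j).continuous.aestronglyMeasurable.sub
      hφ.aestronglyMeasurable).enorm
  calc ∫⁻ x, ‖f k x - f₀ x‖ₑ
      ≤ ∫⁻ x, (‖mollify j (f k) x - f k x‖ₑ + ‖mollify j f₀ x - f₀ x‖ₑ +
          ‖mollify j (f k) x - mollify j f₀ x‖ₑ) := by
        refine lintegral_mono fun x => ?_
        have : f k x - f₀ x = -(mollify j (f k) x - f k x) + (mollify j f₀ x - f₀ x) +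
          (mollify j (f k) x - mollify j f₀ x) := by ring
        rw [this]
        refine (enorm_add_le _ _).trans ?_
        gcongr
        refine (enorm_add_le _ _).trans ?_
        rw [enorm_neg]
    _ = (∫⁻ x, ‖mollify j (f k) x - f k x‖ₑ) + (∫⁻ x, ‖mollify j f₀ x - f₀ x‖ₑ) +
          ∫⁻ x, ‖mollify j (f k) x - mollify j f₀ x‖ₑ := by
        rw [lintegral_add_left' (by exact (hmes _ (hf k)).add (hmes _ hf₀)),
          lintegral_add_left' (hmes _ (hf k))]
    _ ≤ ε / 3 + ε / 3 + ε / 3 := by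
        gcongr
        · refine (lintegral_enorm_mollify_sub_le (hfg k) (hf k).locallyIntegrable (hg k) j).trans ?_
          exact (mul_le_mul_right (hgM k) _).trans hj
        · refine (lintegral_enorm_mollify_sub_le hfg₀ hf₀.locallyIntegrable hg₀ j).trans ?_
          exact (mul_le_mul_right hgM₀ _).trans hj
    _ = ε := ENNReal.add_thirds ε

end Mollification

/-! ### Slicing along lines: null sets, pointwise convergence and directional derivatives that are
measures. -/

section Lines

variable {E : Type*} [NormedAddCommGroup E] [InnerProductSpace ℝ E] [FiniteDimensional ℝ E]
  [MeasurableSpace E] [BorelSpace E]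

/-- A set is null along lines in the direction `ξ` if the union of the lines in this direction
that meet it is Lebesgue null. -/
def LineNull (ξ : E) (N : Set E) : Prop :=
  volume {x : E | ∃ t : ℝ, x + t • ξ ∈ N} = 0

lemma lineNull_iff {ξ : E} {N : Set E} : LineNull ξ N ↔ ∀ᵐ x, ∀ t : ℝ, x + t • ξ ∉ N := by
  simp [LineNull, ae_iff]

lemma isClosedEmbedding_line {ξ : E} (hξ : ξ ≠ 0) (x : E) :
    IsClosedEmbedding fun t : ℝ => x + t • ξ :=
  (Homeomorph.addLeft x).isClosedEmbedding.comp (isClosedEmbedding_smul_left hξ)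

lemma enorm_le_lintegral_line {h : E → ℝ} (hh : ContDiff ℝ 1 h) (hc : HasCompactSupport h) {ξ : E}
    (hξ : ξ ≠ 0) (x : E) : ‖h x‖ₑ ≤ ∫⁻ t : ℝ, ‖fderiv ℝ h (x + t • ξ) ξ‖ₑ := by
  have hd : ContDiff ℝ 1 fun t : ℝ => h (x + t • ξ) := hh.comp (by fun_prop)
  have hcs : HasCompactSupport fun t : ℝ => h (x + t • ξ) :=
    hc.comp_isClosedEmbedding (isClosedEmbedding_line hξ x)
  have := hcs.enorm_le_lintegral_Ici_deriv hd 0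
  simp only [zero_smul, add_zero] at this
  refine this.trans ((lintegral_mono' Measure.restrict_le_self le_rfl).trans_eq ?_)
  refine lintegral_congr fun t => ?_
  have h1 : HasDerivAt (fun t : ℝ => x + t • ξ) ξ t := by
    simpa using ((hasDerivAt_id t).smul_const ξ).const_add x
  have h2 := ((hh.differentiable (by simp)) (x + t • ξ)).hasFDerivAt.comp_hasDerivAt t h1
  have h3 := h2.deriv
  simp only [Function.comp_def] at h3
  rw [h3]

lemma quasiMeasurePreserving_line (ξ : E) : Measure.QuasiMeasurePreserving
    (fun z : E × ℝ => z.1 + z.2 • ξ) ((volume : Measure E).prod (volume : Measure ℝ)) volume := by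
  have hm : Measurable fun z : E × ℝ => z.1 + z.2 • ξ := by fun_prop
  refine ⟨hm, Measure.AbsolutelyContinuous.mk fun s hs h0 => ?_⟩
  rw [Measure.map_apply hm hs, Measure.prod_apply_symm (hm hs)]
  refine (lintegral_eq_zero_iff' ?_).2 (Eventually.of_forall fun t => ?_)
  · exact (measurable_measure_prodMk_right (hm hs)).aemeasurable
  · have := measure_preimage_add_right (volume : Measure E) (t • ξ) s
    rw [h0] at this
    exact this

/-- Fubini for the map `(x, t) ↦ x + t ξ`, which for fixed `t` is a translation and hence pulls null
sets back to null sets. -/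
lemma ae_ae_line {P : E → Prop} (h : ∀ᵐ x, P x) (ξ : E) : ∀ᵐ x, ∀ᵐ t : ℝ, P (x + t • ξ) :=
  Measure.ae_ae_of_ae_prod ((quasiMeasurePreserving_line ξ).ae h)

lemma measurable_lintegral_line {F : E → ℝ≥0∞} (hF : Measurable F) (ξ : E) :
    Measurable fun x => ∫⁻ t : ℝ, F (x + t • ξ) :=
  Measurable.lintegral_prod_right' (f := fun z : E × ℝ => F (z.1 + z.2 • ξ))
    (hF.comp (by fun_prop))

/-- A line through a point of the ball of radius `r` lies in the ball of radius `R` only for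
parameters with `|t| ≤ (R + r) / ‖ξ‖`; for each such `t` translation invariance gives the full
integral of `F`. -/
lemma setLIntegral_line_le {F : E → ℝ≥0∞} (hF : Measurable F) {R r : ℝ}
    (hFR : ∀ x, R < ‖x‖ → F x = 0) {ξ : E} (hξ : ξ ≠ 0) :
    ∫⁻ x in Metric.closedBall 0 r, ∫⁻ t : ℝ, F (x + t • ξ) ≤
      ENNReal.ofReal (2 * ((R + r) / ‖ξ‖)) * ∫⁻ x, F x := by
  have hξ' : 0 < ‖ξ‖ := norm_pos_iff.2 hξ
  set T : ℝ := (R + r) / ‖ξ‖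
  have h1 : ∀ x ∈ Metric.closedBall (0 : E) r,
      ∫⁻ t : ℝ, F (x + t • ξ) ≤ ∫⁻ t in Icc (-T) T, F (x + t • ξ) := by
    intro x hx
    rw [← lintegral_indicator measurableSet_Icc]
    refine lintegral_mono fun t => ?_
    by_cases ht : t ∈ Icc (-T) T
    · rw [indicator_of_mem ht]
    · rw [indicator_of_notMem ht, hFR]
      have hx' : ‖x‖ ≤ r := by simpa using hx
      have ht' : T < |t| := by
        rw [mem_Icc, ← abs_le] at ht; exact not_le.1 ht
      have h2 : R + r < ‖t • ξ‖ := by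
        rw [norm_smul, Real.norm_eq_abs]; exact (div_lt_iff₀ hξ').1 ht'
      have h3 := norm_sub_norm_le (t • ξ) (-x)
      rw [sub_neg_eq_add, norm_neg, add_comm] at h3
      linarith
  calc ∫⁻ x in Metric.closedBall 0 r, ∫⁻ t : ℝ, F (x + t • ξ)
      ≤ ∫⁻ x in Metric.closedBall 0 r, ∫⁻ t in Icc (-T) T, F (x + t • ξ) :=
        setLIntegral_mono' Metric.isClosed_closedBall.measurableSet h1
    _ ≤ ∫⁻ x, ∫⁻ t in Icc (-T) T, F (x + t • ξ) :=
        lintegral_mono' Measure.restrict_le_self le_rfl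
    _ = ∫⁻ t in Icc (-T) T, ∫⁻ x, F (x + t • ξ) := by
        refine lintegral_lintegral_swap (Measurable.aemeasurable ?_)
        exact hF.comp (by fun_prop : Measurable fun z : E × ℝ => z.1 + z.2 • ξ)
    _ = ∫⁻ _t in Icc (-T) T, ∫⁻ x, F x := by
        refine lintegral_congr fun t => ?_
        exact lintegral_add_right_eq_self F (t • ξ)
    _ = ENNReal.ofReal (2 * T) * ∫⁻ x, F x := by
        rw [lintegral_const, Measure.restrict_apply_univ, Real.volume_Icc, mul_comm]
        congr 2; ring

lemma ae_lintegral_line_lt_top {F : E → ℝ≥0∞} (hF : Measurable F) {R : ℝ}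
    (hFR : ∀ x, R < ‖x‖ → F x = 0) (hfin : ∫⁻ x, F x ≠ ⊤) {ξ : E} (hξ : ξ ≠ 0) :
    ∀ᵐ x, ∫⁻ t : ℝ, F (x + t • ξ) < ⊤ := by
  have h1 : ∀ r : ℕ, ∀ᵐ x, x ∈ Metric.closedBall (0 : E) r → ∫⁻ t : ℝ, F (x + t • ξ) < ⊤ := by
    intro r
    rw [← ae_restrict_iff' Metric.isClosed_closedBall.measurableSet]
    refine ae_lt_top (measurable_lintegral_line hF ξ) ?_
    exact ((setLIntegral_line_le hF hFR hξ).trans_lt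
      (ENNReal.mul_lt_top ENNReal.ofReal_lt_top hfin.lt_top)).ne
  filter_upwards [ae_all_iff.2 h1] with x hx
  obtain ⟨r, hr⟩ := exists_nat_ge ‖x‖
  exact hx r (by simpa using hr)

lemma hasCompactSupport_of_eq_zero_of_lt_norm {f : E → ℝ} {R : ℝ} (hf : ∀ x, R < ‖x‖ → f x = 0) :
    HasCompactSupport f :=
  HasCompactSupport.intro (isCompact_closedBall (0 : E) R) fun x hx => hf x (by simpa using hx)

/-- If a function with an integrable weak derivative in the direction `ξ` is continuous on almost
every line in this direction, then a subsequence of its mollifications converges to it except on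
a set that is null along these lines. -/
lemma exists_subseq_mollify_tendsto {f g : E → ℝ} {ξ : E} (hξ : ξ ≠ 0) {R : ℝ}
    (hfR : ∀ x, R < ‖x‖ → f x = 0) (hf : Integrable f) (hg : Integrable g)
    (hfg : HasWeakDeriv f g ξ) (hcont : ∀ᵐ x, Continuous fun t : ℝ => f (x + t • ξ)) :
    ∃ s : ℕ → ℕ, StrictMono s ∧
      LineNull ξ {x | ¬ Tendsto (fun j => mollify (s j) f x) atTop (𝓝 (f x))} := by
  have hloc := hf.locallyIntegrable
  have : Fact ((1 : ℝ≥0∞) ≤ 1) := ⟨le_rfl⟩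
  have hconv : Tendsto (fun j => ∫⁻ x, ‖mollify j g x - g x‖ₑ) atTop (𝓝 0) := by
    have := tendsto_eLpNorm_mollify_sub (p := 1) (by simp) (memLp_one_iff_integrable.2 hg)
    simpa only [eLpNorm_one_eq_lintegral_enorm] using this
  -- Geometric rates make the successive differences `h j` have summable directional derivatives in
  -- `L¹`, hence summable on almost every line.
  obtain ⟨s, hs, hsb⟩ := extraction_forall_of_eventually
    (P := fun j k => ∫⁻ x, ‖mollify k g x - g x‖ₑ ≤ (2⁻¹ : ℝ≥0∞) ^ j)
    (fun j => (ENNReal.tendsto_nhds_zero.1 hconv) _ (ENNReal.pow_pos (by simp) j))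
  refine ⟨s, hs, ?_⟩
  set h : ℕ → E → ℝ := fun j x => mollify (s (j + 1)) f x - mollify (s j) f x with hh
  have hsm : ∀ j, ContDiff ℝ ∞ (mollify j f) := fun j => contDiff_mollify hloc j
  have hhsm : ∀ j, ContDiff ℝ 1 (h j) := fun j =>
    ((hsm _).sub (hsm _)).of_le (by exact_mod_cast le_top)
  have hhR : ∀ j x, R + 1 < ‖x‖ → h j x = 0 := fun j x hx => by
    simp [hh, mollify_eq_zero hfR _ hx]
  have hhcs : ∀ j, HasCompactSupport (h j) := fun j =>
    hasCompactSupport_of_eq_zero_of_lt_norm (hhR j)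
  have hder : ∀ j x, fderiv ℝ (h j) x ξ = mollify (s (j + 1)) g x - mollify (s j) g x := by
    intro j x
    have h1 : ∀ k, DifferentiableAt ℝ (mollify k f) x := fun k =>
      (hsm k).differentiable (by simp) x
    rw [hh]
    rw [fderiv_fun_sub (h1 _) (h1 _)]
    simp [fderiv_mollify hfg hloc]
  set F : E → ℝ≥0∞ := fun x => ∑' j, ‖fderiv ℝ (h j) x ξ‖ₑ with hF
  have hFjc : ∀ j, Continuous fun x => fderiv ℝ (h j) x ξ := fun j =>
    ((hhsm j).continuous_fderiv (by simp)).clm_apply continuous_const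
  have hFjm : ∀ j, Measurable fun x => ‖fderiv ℝ (h j) x ξ‖ₑ := fun j => (hFjc j).enorm.measurable
  have hFm : Measurable F := Measurable.tsum hFjm
  have hFR : ∀ x, R + 1 < ‖x‖ → F x = 0 := by
    intro x hx
    simp only [hF, ENNReal.tsum_eq_zero]
    intro j
    have : h j =ᶠ[𝓝 x] fun _ => 0 := by
      filter_upwards [(isOpen_lt continuous_const continuous_norm).mem_nhds hx] with y hy
      exact hhR j y hy
    rw [this.fderiv_eq]; simp
  have hFfin : ∫⁻ x, F x ≠ ⊤ := by
    rw [hF, lintegral_tsum fun j => (hFjm j).aemeasurable]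
    have hb : ∀ j, ∫⁻ x, ‖fderiv ℝ (h j) x ξ‖ₑ ≤ 2 * (2⁻¹ : ℝ≥0∞) ^ j := by
      intro j
      calc ∫⁻ x, ‖fderiv ℝ (h j) x ξ‖ₑ
          ≤ ∫⁻ x, (‖mollify (s (j + 1)) g x - g x‖ₑ + ‖mollify (s j) g x - g x‖ₑ) := by
            refine lintegral_mono fun x => ?_
            rw [hder]
            have : mollify (s (j + 1)) g x - mollify (s j) g x =
              (mollify (s (j + 1)) g x - g x) - (mollify (s j) g x - g x) := by ring
            rw [this]
            exact enorm_sub_le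
        _ = (∫⁻ x, ‖mollify (s (j + 1)) g x - g x‖ₑ) + ∫⁻ x, ‖mollify (s j) g x - g x‖ₑ := by
            refine lintegral_add_left' ?_ _
            exact ((contDiff_mollify hg.locallyIntegrable _).continuous.aestronglyMeasurable.sub
              hg.aestronglyMeasurable).enorm
        _ ≤ (2⁻¹ : ℝ≥0∞) ^ j + (2⁻¹ : ℝ≥0∞) ^ j := by
            refine add_le_add ((hsb (j + 1)).trans ?_) (hsb j)
            exact pow_le_pow_right_of_le_one' (by simp) (Nat.le_succ j)
        _ = 2 * (2⁻¹ : ℝ≥0∞) ^ j := (two_mul _).symm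
    refine ne_top_of_le_ne_top ?_ (ENNReal.tsum_le_tsum hb)
    rw [ENNReal.tsum_mul_left, ENNReal.tsum_geometric]
    simp [ENNReal.mul_eq_top]
  have hae : ∀ᵐ x, ∀ᵐ t : ℝ, Tendsto (fun j => mollify (s j) f (x + t • ξ)) atTop
      (𝓝 (f (x + t • ξ))) := by
    refine ae_ae_line (P := fun x => Tendsto (fun j => mollify (s j) f x) atTop (𝓝 (f x))) ?_ ξ
    filter_upwards [ae_tendsto_mollify hloc] with x hx
    exact hx.comp hs.tendsto_atTop
  have hgood : ∀ᵐ x, ∀ t : ℝ,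
      Tendsto (fun j => mollify (s j) f (x + t • ξ)) atTop (𝓝 (f (x + t • ξ))) := by
    filter_upwards [hae, hcont, ae_lintegral_line_lt_top hFm hFR hFfin hξ] with x hx1 hx2 hx3
    set c : ℕ → ℝ≥0∞ := fun j => ∫⁻ t : ℝ, ‖fderiv ℝ (h j) (x + t • ξ) ξ‖ₑ with hc
    have hcs : ∑' j, c j ≠ ⊤ := by
      have := lintegral_tsum (μ := (volume : Measure ℝ))
        (f := fun j t => ‖fderiv ℝ (h j) (x + t • ξ) ξ‖ₑ)
        (fun j => ((hFjm j).comp (by fun_prop : Measurable fun t : ℝ => x + t • ξ)).aemeasurable)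
      rw [hc, ← this]
      exact hx3.ne
    -- On a good line each `h j` is bounded uniformly by the integral of its derivative, so the
    -- telescoping series obeys the Weierstrass test.
    have hcb : ∀ j (t : ℝ), ‖h j (x + t • ξ)‖ ≤ (c j).toReal := by
      intro j t
      have h1 := enorm_le_lintegral_line (hhsm j) (hhcs j) hξ (x + t • ξ)
      have h2 : ∫⁻ r : ℝ, ‖fderiv ℝ (h j) (x + t • ξ + r • ξ) ξ‖ₑ = c j := by
        rw [hc]
        simp only [add_assoc, ← add_smul]
        exact lintegral_add_left_eq_self (fun r : ℝ => ‖fderiv ℝ (h j) (x + r • ξ) ξ‖ₑ) t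
      rw [h2] at h1
      rw [← toReal_enorm]
      exact ENNReal.toReal_mono (ENNReal.ne_top_of_tsum_ne_top hcs j) h1
    have hsum : Summable fun j => (c j).toReal := ENNReal.summable_toReal hcs
    have hunif := tendstoUniformly_tsum_nat (f := fun j (t : ℝ) => h j (x + t • ξ)) hsum hcb
    set L : ℝ → ℝ := fun t => mollify (s 0) f (x + t • ξ) + ∑' j, h j (x + t • ξ) with hL
    have htel : ∀ N (t : ℝ), mollify (s N) f (x + t • ξ) =
        mollify (s 0) f (x + t • ξ) + ∑ j ∈ Finset.range N, h j (x + t • ξ) := by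
      intro N t
      rw [Finset.sum_range_sub (fun j => mollify (s j) f (x + t • ξ))]
      ring
    have hLlim : ∀ t : ℝ, Tendsto (fun j => mollify (s j) f (x + t • ξ)) atTop (𝓝 (L t)) := by
      intro t
      exact ((hunif.tendsto_at t).const_add _).congr fun N => (htel N t).symm
    have hline : Continuous fun t : ℝ => x + t • ξ := by fun_prop
    have hLc : Continuous L := by
      refine ((hsm _).continuous.comp hline).add ?_
      exact continuous_tsum (fun j => (hhsm j).continuous.comp hline) hsum hcb
    have hLf : L =ᵐ[volume] fun t => f (x + t • ξ) := by
      filter_upwards [hx1] with t ht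
      exact tendsto_nhds_unique (hLlim t) ht
    -- Both the uniform limit and `f` are continuous on this line, so almost everywhere equality
    -- becomes equality at every `t`. Only here is the continuity of `f` along lines used.
    have := (Continuous.ae_eq_iff_eq volume hLc hx2).1 hLf
    intro t
    have h3 := hLlim t
    rwa [congrFun this t] at h3
  rw [lineNull_iff]
  filter_upwards [hgood] with x hx t ht using ht (hx t)

lemma exists_cutoff {K U : Set E} (hK : IsCompact K) (hU : IsOpen U) (hKU : K ⊆ U) :
    ∃ χ : E → ℝ, ContDiff ℝ ∞ χ ∧ HasCompactSupport χ ∧ tsupport χ ⊆ U ∧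
      (∀ᶠ x in 𝓝ˢ K, χ x = 1) ∧ ∀ x, χ x ∈ Icc (0 : ℝ) 1 := by
  obtain ⟨L, hL, hKL, hLU⟩ := exists_compact_between hK hU hKU
  obtain ⟨f, h1, h0, hf⟩ := exists_contMDiffMap_one_nhds_of_subset_interior
    (modelWithCornersSelf ℝ E) (n := ⊤) hK.isClosed hKL
  have hs : tsupport f ⊆ L := closure_minimal
    (fun x hx => by_contra fun hxL => hx (h0 x hxL)) hL.isClosed
  exact ⟨f, f.contMDiff.contDiff, hL.of_isClosed_subset (isClosed_tsupport _) hs, hs.trans hLU,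
    h1, hf⟩

lemma abs_mollify_le (f : BoundedContinuousFunction E ℝ) (j : ℕ) (x : E) :
    |mollify j f x| ≤ ‖f‖ := by
  rw [mollify_apply', ← Real.norm_eq_abs]
  refine (norm_integral_le_integral_norm _).trans ?_
  calc ∫ h, ‖(mollifier E j).normed volume h * f (x - h)‖
      ≤ ∫ h, (mollifier E j).normed volume h * ‖f‖ := by
        refine integral_mono_of_nonneg (Eventually.of_forall fun _ => norm_nonneg _)
          ((mollifier E j).integrable_normed.mul_const _) (Eventually.of_forall fun h => ?_)
        simp only [norm_mul]
        rw [Real.norm_of_nonneg ((mollifier E j).nonneg_normed h)]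
        gcongr
        · exact (mollifier E j).nonneg_normed h
        · exact f.norm_coe_le_norm _
    _ = ‖f‖ := by rw [integral_mul_const, (mollifier E j).integral_normed, one_mul]

lemma tendsto_integral_mul_mollify {Z : Type*} [MeasurableSpace Z] {τ : Measure Z} {a : Z → ℝ}
    {b : Z → E} (ha : Integrable a τ) (hb : Measurable b) (f : BoundedContinuousFunction E ℝ) :
    Tendsto (fun j => ∫ x, a x * mollify j f (b x) ∂τ) atTop (𝓝 (∫ x, a x * f (b x) ∂τ)) := by
  have hfl : LocallyIntegrable f (volume : Measure E) := f.continuous.locallyIntegrable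
  have hlim : ∀ x, Tendsto (fun j => mollify j f x) atTop (𝓝 (f x)) := fun x =>
    ContDiffBump.convolution_tendsto_right_of_continuous tendsto_mollifier_rOut f.continuous x
  refine tendsto_integral_of_dominated_convergence (fun x => ‖a x‖ * ‖f‖) (fun j => ?_)
    (ha.norm.mul_const _) (fun j => Eventually.of_forall fun x => ?_)
    (Eventually.of_forall fun x => (hlim (b x)).const_mul _)
  · exact ha.aestronglyMeasurable.mul
      ((contDiff_mollify hfl j).continuous.measurable.comp hb).aestronglyMeasurable
  · rw [norm_mul]; gcongr; exact abs_mollify_le f j _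

lemma integrable_smul_toReal_ofReal {Z : Type*} [MeasurableSpace Z] {τ : Measure Z} {a : Z → ℝ}
    {b : Z → E} (ha : Integrable a τ) (hb : Measurable b) (f : BoundedContinuousFunction E ℝ) :
    Integrable (fun x => (ENNReal.ofReal (a x)).toReal • f (b x)) τ := by
  have hi : Integrable (fun x => f (b x)) (τ.withDensity fun x => ENNReal.ofReal (a x)) := by
    have : IsFiniteMeasure (τ.withDensity fun x => ENNReal.ofReal (a x)) :=
      isFiniteMeasure_withDensity_ofReal ha.2
    exact Integrable.of_bound (f.continuous.measurable.comp hb).aestronglyMeasurable ‖f‖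
      (Eventually.of_forall fun x => f.norm_coe_le_norm _)
  exact (integrable_withDensity_iff_integrable_smul₀' ha.aemeasurable.ennreal_ofReal
    (Eventually.of_forall fun _ => ENNReal.ofReal_lt_top)).1 hi

lemma integral_map_withDensity_sub {Z : Type*} [MeasurableSpace Z] {τ : Measure Z} {a : Z → ℝ}
    {b : Z → E} (ha : Integrable a τ) (hb : Measurable b) (f : BoundedContinuousFunction E ℝ) :
    ∫ x, f x ∂((τ.withDensity fun x => ENNReal.ofReal (a x)).map b) -
      ∫ x, f x ∂((τ.withDensity fun x => ENNReal.ofReal ((-a) x)).map b) =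
      ∫ x, a x * f (b x) ∂τ := by
  rw [integral_map hb.aemeasurable f.continuous.aestronglyMeasurable,
    integral_map hb.aemeasurable f.continuous.aestronglyMeasurable,
    integral_withDensity_eq_integral_toReal_smul₀ ha.aemeasurable.ennreal_ofReal
      (Eventually.of_forall fun _ => ENNReal.ofReal_lt_top),
    integral_withDensity_eq_integral_toReal_smul₀ ha.neg.aemeasurable.ennreal_ofReal
      (Eventually.of_forall fun _ => ENNReal.ofReal_lt_top),
    ← integral_sub (integrable_smul_toReal_ofReal ha hb f)
      (integrable_smul_toReal_ofReal ha.neg hb f)]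
  refine integral_congr_ae (Eventually.of_forall fun x => ?_)
  simp only [smul_eq_mul, ENNReal.toReal_ofReal', Pi.neg_apply]
  rw [← sub_mul]
  congr 1
  rcases le_total (a x) 0 with h | h <;> simp [h]

lemma setIntegral_preimage_eq_sub {Z : Type*} [MeasurableSpace Z] {τ : Measure Z} {a : Z → ℝ}
    {b : Z → E} (ha : Integrable a τ) (hb : Measurable b) {B : Set E} (hB : MeasurableSet B) :
    ∫ x in b ⁻¹' B, a x ∂τ =
      ((τ.withDensity fun x => ENNReal.ofReal (a x)).map b).real B -
        ((τ.withDensity fun x => ENNReal.ofReal ((-a) x)).map b).real B := by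
  rw [measureReal_def, measureReal_def, Measure.map_apply hb hB, Measure.map_apply hb hB,
    withDensity_apply _ (hb hB), withDensity_apply _ (hb hB),
    integral_eq_lintegral_pos_part_sub_lintegral_neg_part ha.integrableOn]
  rfl

/-- Two densities with the same integrals against smooth bounded functions of two maps into `E`
have the same integrals on the preimages of Borel sets. -/
lemma setIntegral_preimage_eq_of_forall_contDiff {X Y : Type*} [MeasurableSpace X]
    [MeasurableSpace Y] {μ : Measure X} {ν : Measure Y} {w : X → ℝ} {z : Y → ℝ}
    (hw : Integrable w μ) (hz : Integrable z ν) {κ : X → E} {l : Y → E} (hκ : Measurable κ)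
    (hl : Measurable l)
    (h : ∀ f : E → ℝ, ContDiff ℝ ∞ f → (∃ C, ∀ x, |f x| ≤ C) →
      ∫ x, w x * f (κ x) ∂μ = ∫ y, z y * f (l y) ∂ν) {B : Set E} (hB : MeasurableSet B) :
    ∫ x in κ ⁻¹' B, w x ∂μ = ∫ y in l ⁻¹' B, z y ∂ν := by
  have hbc : ∀ f : BoundedContinuousFunction E ℝ,
      ∫ x, w x * f (κ x) ∂μ = ∫ y, z y * f (l y) ∂ν := by
    intro f
    refine tendsto_nhds_unique (tendsto_integral_mul_mollify hw hκ f)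
      ((tendsto_integral_mul_mollify hz hl f).congr fun j => ?_)
    exact (h _ (contDiff_mollify f.continuous.locallyIntegrable j) ⟨_, abs_mollify_le f j⟩).symm
  have : IsFiniteMeasure (μ.withDensity fun x => ENNReal.ofReal (w x)) :=
    isFiniteMeasure_withDensity_ofReal hw.2
  have : IsFiniteMeasure (μ.withDensity fun x => ENNReal.ofReal ((-w) x)) :=
    isFiniteMeasure_withDensity_ofReal hw.neg.2
  have : IsFiniteMeasure (ν.withDensity fun x => ENNReal.ofReal (z x)) :=
    isFiniteMeasure_withDensity_ofReal hz.2
  have : IsFiniteMeasure (ν.withDensity fun x => ENNReal.ofReal ((-z) x)) :=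
    isFiniteMeasure_withDensity_ofReal hz.neg.2
  -- Equality of two signed image measures, written with positive measures by moving the negative
  -- parts across, so that integrals of bounded continuous functions determine it.
  have heq : (μ.withDensity fun x => ENNReal.ofReal (w x)).map κ +
      (ν.withDensity fun x => ENNReal.ofReal ((-z) x)).map l =
      (μ.withDensity fun x => ENNReal.ofReal ((-w) x)).map κ +
      (ν.withDensity fun x => ENNReal.ofReal (z x)).map l := by
    refine ext_of_forall_integral_eq_of_IsFiniteMeasure fun f => ?_
    have hi : ∀ (m : Measure E) [IsFiniteMeasure m], Integrable f m := fun m _ => f.integrable m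
    rw [integral_add_measure (hi _) (hi _), integral_add_measure (hi _) (hi _)]
    have e1 := integral_map_withDensity_sub hw hκ f
    have e2 := integral_map_withDensity_sub hz hl f
    have e3 := hbc f
    linarith
  rw [setIntegral_preimage_eq_sub hw hκ hB, setIntegral_preimage_eq_sub hz hl hB]
  have h5 := congrArg (fun m : Measure E => m.real B) heq
  beta_reduce at h5
  rw [measureReal_add_apply, measureReal_add_apply] at h5
  linarith

/-- A density whose distribution is the derivative in the direction `ξ` of an integrable function
vanishes on the sets that are null along the lines in this direction. -/
lemma ae_eq_zero_of_lineNull {X : Type*} [MeasurableSpace X] {m : Measure X} {ι : X → E}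
    (hι : MeasurableEmbedding ι) {D : X → ℝ} (hD : Integrable D m) {u : E → ℝ} (hu : Integrable u)
    {Ω : Set E} (hΩ : IsOpen Ω) {ξ : E} (hξ : ξ ≠ 0)
    (h : ∀ φ : E → ℝ, ContDiff ℝ ∞ φ → HasCompactSupport φ → tsupport φ ⊆ Ω →
      ∫ x, φ (ι x) * D x ∂m = - ∫ x, u x * fderiv ℝ φ x ξ)
    {N : Set E} (hN : LineNull ξ N) : ∀ᵐ x ∂m, ι x ∈ Ω → ι x ∈ N → D x = 0 := by
  set S : Set E := {x : E | ∃ t : ℝ, x + t • ξ ∈ N}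
  set G : Set E := toMeasurable volume S with hGdef
  have hGm : MeasurableSet G := measurableSet_toMeasurable _ _
  have hG0 : volume G = 0 := by rw [hGdef, measure_toMeasurable]; exact hN
  -- The points whose line lies in `G` for almost every parameter. Unlike the saturation of `N`,
  -- this set is known to be Borel; it is still null, contains `N` and is invariant along `ξ`.
  set G' : Set E := {x | ∫⁻ t : ℝ, Gᶜ.indicator (fun _ => (1 : ℝ≥0∞)) (x + t • ξ) = 0} with hG'
  have hG'm : MeasurableSet G' := by
    refine measurableSet_eq_fun (measurable_lintegral_line ?_ ξ) measurable_const
    exact measurable_const.indicator hGm.compl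
  have hNG : N ⊆ G' := by
    intro x hx
    change ∫⁻ t : ℝ, Gᶜ.indicator (fun _ => (1 : ℝ≥0∞)) (x + t • ξ) = 0
    have : ∀ t : ℝ, Gᶜ.indicator (fun _ => (1 : ℝ≥0∞)) (x + t • ξ) = 0 := by
      intro t
      refine indicator_of_notMem ?_ _
      rw [notMem_compl_iff]
      refine subset_toMeasurable _ _ ⟨-t, ?_⟩
      simpa using hx
    simp [this]
  have hG'0 : volume G' = 0 := by
    have h1 : ∀ᵐ x : E, x ∉ G := by rw [ae_iff]; simpa using hG0
    have h2 := ae_ae_line h1 ξ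
    have h3 : ∀ᵐ x : E, x ∉ G' := by
      filter_upwards [h2] with x hx hx'
      change ∫⁻ t : ℝ, Gᶜ.indicator (fun _ => (1 : ℝ≥0∞)) (x + t • ξ) = 0 at hx'
      have h4 : (fun t : ℝ => Gᶜ.indicator (fun _ => (1 : ℝ≥0∞)) (x + t • ξ)) =ᵐ[volume]
          fun _ => 1 := by
        filter_upwards [hx] with t ht
        exact indicator_of_mem ht _
      rw [lintegral_congr_ae h4] at hx'
      simp at hx'
    rw [ae_iff] at h3; simpa using h3
  have hinv : ∀ (x : E) (s : ℝ), x + s • ξ ∈ G' ↔ x ∈ G' := by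
    intro x s
    change ∫⁻ t : ℝ, Gᶜ.indicator (fun _ => (1 : ℝ≥0∞)) (x + s • ξ + t • ξ) = 0 ↔
      ∫⁻ t : ℝ, Gᶜ.indicator (fun _ => (1 : ℝ≥0∞)) (x + t • ξ) = 0
    simp only [add_assoc, ← add_smul]
    rw [lintegral_add_left_eq_self
      (fun t : ℝ => Gᶜ.indicator (fun _ => (1 : ℝ≥0∞)) (x + t • ξ)) s]
  -- The orthogonal projection along `ξ`. Functions `f ∘ P` have no derivative along `ξ`, so testing
  -- with `φ · (f ∘ P)` identifies the projection of `φ D m` with that of `-u ∂_ξφ dx`, which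
  -- vanishes on the null set `G'`.
  set P : E →L[ℝ] E := ContinuousLinearMap.id ℝ E -
    (((‖ξ‖ ^ 2)⁻¹ • innerSL ℝ ξ).smulRight ξ) with hP
  have hPξ : P ξ = 0 := by
    have : ‖ξ‖ ^ 2 ≠ 0 := by positivity
    simp [hP, inv_mul_cancel₀ this]
  have hPG : ∀ x, P x ∈ G' ↔ x ∈ G' := by
    intro x
    have : P x = x + (-((‖ξ‖ ^ 2)⁻¹ * inner ℝ ξ x)) • ξ := by
      simp [hP, sub_eq_add_neg]
    rw [this, hinv]
  have hPpre : P ⁻¹' G' = G' := by ext x; exact hPG x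
  have hzero : ∀ φ : E → ℝ, ContDiff ℝ ∞ φ → HasCompactSupport φ → tsupport φ ⊆ Ω →
      ∫ x in ι ⁻¹' G', φ (ι x) * D x ∂m = 0 := by
    intro φ hφ hφc hφΩ
    obtain ⟨C, hC⟩ := hφc.exists_bound_of_continuous hφ.continuous
    have hdφ : Continuous fun x => fderiv ℝ φ x ξ :=
      (hφ.continuous_fderiv (by simp)).clm_apply continuous_const
    obtain ⟨C', hC'⟩ := (hφc.fderiv_apply (𝕜 := ℝ) ξ).exists_bound_of_continuous hdφ
    have hi1 : Integrable (fun x => φ (ι x) * D x) m :=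
      hD.bdd_mul (c := C) (hφ.continuous.measurable.comp hι.measurable).aestronglyMeasurable
        (Eventually.of_forall fun x => hC _)
    have hi2 : Integrable (fun x => - (u x * fderiv ℝ φ x ξ)) := by
      refine (hu.mul_bdd (c := C') hdφ.aestronglyMeasurable
        (Eventually.of_forall fun x => hC' _)).neg
    have := setIntegral_preimage_eq_of_forall_contDiff hi1 hi2 (κ := P ∘ ι) (l := P)
      (P.continuous.measurable.comp hι.measurable) P.continuous.measurable (fun f hf _ => ?_) hG'm
    · rw [preimage_comp, hPpre] at this
      rw [this]
      exact setIntegral_measure_zero _ hG'0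
    · have hfP : ContDiff ℝ ∞ fun x => f (P x) := hf.comp P.contDiff
      have h1 := h (fun x => φ x * f (P x)) (hφ.mul hfP) hφc.mul_right
        ((tsupport_mul_subset_left).trans hφΩ)
      have hder : ∀ x, fderiv ℝ (fun x => φ x * f (P x)) x ξ = fderiv ℝ φ x ξ * f (P x) := by
        intro x
        have hd1 : DifferentiableAt ℝ φ x := hφ.differentiable (by simp) x
        have hd2 : DifferentiableAt ℝ (fun x => f (P x)) x := hfP.differentiable (by simp) x
        rw [fderiv_fun_mul hd1 hd2]
        have hd3 : fderiv ℝ (fun x => f (P x)) x ξ = 0 := by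
          have hd4 := ((hf.differentiable (by simp) (P x)).hasFDerivAt.comp x P.hasFDerivAt).fderiv
          simp only [Function.comp_def] at hd4
          rw [hd4]
          simp [hPξ]
        simp [hd3, mul_comm]
      simp only [hder] at h1
      rw [← integral_neg] at h1
      calc ∫ x, φ (ι x) * D x * f ((P ∘ ι) x) ∂m = ∫ x, φ (ι x) * f (P (ι x)) * D x ∂m := by
            refine integral_congr_ae (Eventually.of_forall fun x => ?_)
            simp only [Function.comp_apply]; ring
        _ = ∫ x, -(u x * (fderiv ℝ φ x ξ * f (P x))) := h1
        _ = ∫ x, -(u x * fderiv ℝ φ x ξ) * f (P x) := by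
            refine integral_congr_ae (Eventually.of_forall fun x => ?_)
            simp only; ring
  have hK : ∀ K ⊆ Ω, IsCompact K → ∀ᵐ x ∂m, ι x ∈ K → ι x ∈ N → D x = 0 := by
    intro K hKΩ hKc
    obtain ⟨χ, hχ, hχc, hχΩ, hχ1, hχb⟩ := exists_cutoff hKc hΩ hKΩ
    -- The vanishing integrals over the whole of `G'` hold for every `χ f` with `f` smooth, which
    -- forces the density itself to vanish on `G'`.
    set w : X → ℝ := fun x => (ι ⁻¹' G').indicator (fun x => χ (ι x) * D x) x with hw
    have hi1 : Integrable (fun x => χ (ι x) * D x) m :=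
      hD.bdd_mul (c := 1) (hχ.continuous.measurable.comp hι.measurable).aestronglyMeasurable
        (Eventually.of_forall fun x => by
          rw [Real.norm_of_nonneg (hχb _).1]; exact (hχb _).2)
    have hwi : Integrable w m := hi1.indicator (hι.measurable hG'm)
    have hw0 : w =ᵐ[m] 0 := by
      refine hwi.ae_eq_zero_of_forall_setIntegral_eq_zero fun s hs _ => ?_
      have h1 := setIntegral_preimage_eq_of_forall_contDiff hwi (integrable_zero E ℝ volume)
        hι.measurable measurable_id (fun f hf _ => ?_) (hι.measurableSet_image.2 hs)
      · rw [preimage_image_eq _ hι.injective] at h1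
        simpa using h1
      · have h2 := hzero (fun x => χ x * f x) (hχ.mul hf) hχc.mul_right
          ((tsupport_mul_subset_left).trans hχΩ)
        rw [← integral_indicator (hι.measurable hG'm)] at h2
        simp only [Pi.zero_apply, zero_mul, integral_zero]
        rw [← h2]
        refine integral_congr_ae (Eventually.of_forall fun x => ?_)
        by_cases hx : x ∈ ι ⁻¹' G'
        · simp only [hw, indicator_of_mem hx]; ring
        · simp only [hw, indicator_of_notMem hx]; ring
    filter_upwards [hw0] with x hx hxK hxN
    have hx' : x ∈ ι ⁻¹' G' := hNG hxN
    simp only [hw, indicator_of_mem hx', Pi.zero_apply] at hx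
    have : χ (ι x) = 1 := hχ1.self_of_nhdsSet _ hxK
    simpa [this] using hx
  have := hΩ.locallyCompactSpace
  obtain ⟨K, hKc, hKU⟩ : IsSigmaCompact Ω := isSigmaCompact_iff_sigmaCompactSpace.mpr inferInstance
  have hall := ae_all_iff.2 fun i => hK (K i) (hKU ▸ subset_iUnion K i) (hKc i)
  filter_upwards [hall] with x hx hxΩ hxN
  rw [← hKU] at hxΩ
  obtain ⟨i, hi⟩ := mem_iUnion.1 hxΩ
  exact hx i hi hxN

end Lines

/-! ### A Sobolev inequality from the directional derivatives of `u · ξ` along `ξ`. -/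

section KornSobolev

variable {n : ℕ}

/-- The vector `(1, t, t², …)`. -/
def momentVector (n : ℕ) (t : ℕ) : Space n := WithLp.toLp 2 fun i => (t : ℝ) ^ (i : ℕ)

lemma inner_momentVector (z : Space n) (t : ℕ) :
    inner ℝ z (momentVector n t) = ∑ i : Fin n, (t : ℝ) ^ (i : ℕ) * z i := by
  simp [momentVector, PiLp.inner_apply]

/-- Vandermonde. -/
lemma linearIndependent_momentVector {σ : Fin n → ℕ} (hσ : Function.Injective σ) :
    LinearIndependent ℝ fun i => momentVector n (σ i) := by
  rw [Fintype.linearIndependent_iff]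
  intro g hg
  have : g = 0 := by
    refine Matrix.eq_zero_of_forall_pow_sum_mul_pow_eq_zero (f := fun i => ((σ i : ℕ) : ℝ))
      (fun i j hij => hσ (Nat.cast_injective hij)) fun k => ?_
    have := congrArg (fun v : Space n => v k) hg
    simpa [momentVector] using this
  simp [this]

/-- Any `n` of the moment vectors span, so a nonzero `z` is orthogonal to at most `n` of the `2n`;
at least `n` remain. -/
lemma exists_embedding_inner_ne_zero {z : Space n} (hz : z ≠ 0) :
    ∃ σ : Fin n ↪ Fin (2 * n), ∀ i, inner ℝ z (momentVector n (σ i)) ≠ 0 := by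
  classical
  set Z : Finset (Fin (2 * n)) := Finset.univ.filter fun t =>
    inner ℝ z (momentVector n t) = 0 with hZ
  have hZc : Z.card ≤ n := by
    by_contra hcon
    push Not at hcon
    obtain ⟨σ⟩ : Nonempty (Fin n ↪ Z) := Function.Embedding.nonempty_of_card_le (by simpa using hcon.le)
    apply hz
    have : z.ofLp = 0 := by
      refine Matrix.eq_zero_of_forall_index_sum_pow_mul_eq_zero
        (f := fun i => (((σ i : Fin (2 * n)) : ℕ) : ℝ)) (fun i j hij => ?_) fun j => ?_
      · apply σ.injective
        apply Subtype.ext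
        apply Fin.ext
        exact Nat.cast_injective (R := ℝ) hij
      · have := (Finset.mem_filter.1 (σ j).2).2
        rwa [inner_momentVector] at this
    ext i
    exact congrFun this i
  have hcard : n ≤ (Zᶜ).card := by
    rw [Finset.card_compl, Fintype.card_fin]; omega
  obtain ⟨σ⟩ : Nonempty (Fin n ↪ (Zᶜ : Finset (Fin (2 * n)))) :=
    Function.Embedding.nonempty_of_card_le (by rwa [Fintype.card_fin, Fintype.card_coe])
  refine ⟨σ.trans (Function.Embedding.subtype _), fun i => ?_⟩
  have h1 := Finset.mem_compl.1 (σ i).2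
  exact fun h2 => h1 (Finset.mem_filter.2 ⟨Finset.mem_univ _, h2⟩)

/-- The sum is continuous, positive off the origin, and homogeneous of degree `n / (n - 1)`, each
product having `n` factors of degree `1 / (n - 1)`; compactness of the sphere gives the constant. It
splits a power of `‖u‖` into products of components each controlled by the derivative in its own
direction. -/
lemma exists_norm_rpow_le_sum_prod (hn : 2 ≤ n) :
    ∃ C : ℝ, 0 < C ∧ ∀ z : Space n, ‖z‖ ^ ((n : ℝ) / (n - 1)) ≤
      C * ∑ σ : Fin n ↪ Fin (2 * n),
        ∏ i, |inner ℝ z (momentVector n (σ i))| ^ ((1 : ℝ) / (n - 1)) := by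
  have hn' : (0 : ℝ) < n - 1 := by
    have : (2 : ℝ) ≤ n := by exact_mod_cast hn
    linarith
  have hr : (0 : ℝ) < 1 / (n - 1) := by positivity
  set r : ℝ := (1 : ℝ) / (n - 1)
  set Φ : Space n → ℝ := fun z => ∑ σ : Fin n ↪ Fin (2 * n),
        ∏ i, |inner ℝ z (momentVector n (σ i))| ^ r with hΦ
  have hΦc : Continuous Φ := by
    refine continuous_finsetSum _ fun σ _ => continuous_finsetProd _ fun i _ => ?_
    exact ((continuous_id.inner continuous_const).abs).rpow_const fun _ => Or.inr hr.le
  have hΦpos : ∀ z : Space n, z ≠ 0 → 0 < Φ z := by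
    intro z hz
    obtain ⟨σ, hσ⟩ := exists_embedding_inner_ne_zero hz
    refine Finset.sum_pos' (fun σ _ => Finset.prod_nonneg fun i _ => by positivity)
      ⟨σ, Finset.mem_univ _, Finset.prod_pos fun i _ => ?_⟩
    exact Real.rpow_pos_of_pos (abs_pos.2 (hσ i)) _
  have hne : Nonempty (Fin n) := ⟨⟨0, by omega⟩⟩
  have : Nontrivial (Space n) := inferInstance
  obtain ⟨z₀, hz₀, hmin⟩ := (isCompact_sphere (0 : Space n) 1).exists_isMinOn
    (NormedSpace.sphere_nonempty.2 zero_le_one) hΦc.continuousOn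
  have hz₀' : z₀ ≠ 0 := by
    rintro rfl; simp at hz₀
  have hm := hΦpos z₀ hz₀'
  have hhom : ∀ (c : ℝ), 0 ≤ c → ∀ z, Φ (c • z) = c ^ ((n : ℝ) / (n - 1)) * Φ z := by
    intro c hc z
    simp only [hΦ, Finset.mul_sum]
    refine Finset.sum_congr rfl fun σ _ => ?_
    have : ∀ i, |inner ℝ (c • z) (momentVector n (σ i))| ^ r =
        c ^ r * |inner ℝ z (momentVector n (σ i))| ^ r := by
      intro i
      rw [real_inner_smul_left, abs_mul, abs_of_nonneg hc, Real.mul_rpow hc (abs_nonneg _)]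
    simp only [this, Finset.prod_mul_distrib, Finset.prod_const, Finset.card_univ, Fintype.card_fin]
    congr 1
    rw [← Real.rpow_natCast, ← Real.rpow_mul hc]
    congr 1
    simp only [r]; ring
  refine ⟨(Φ z₀)⁻¹, inv_pos.2 hm, fun z => ?_⟩
  by_cases hz : z = 0
  · subst hz
    rw [norm_zero, Real.zero_rpow (by positivity)]
    refine mul_nonneg (inv_nonneg.2 hm.le) ?_
    exact Finset.sum_nonneg fun σ _ => Finset.prod_nonneg fun i _ => by positivity
  · have hzn : 0 < ‖z‖ := norm_pos_iff.2 hz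
    have h1 : Φ z = ‖z‖ ^ ((n : ℝ) / (n - 1)) * Φ (‖z‖⁻¹ • z) := by
      rw [← hhom _ hzn.le, smul_smul, mul_inv_cancel₀ hzn.ne', one_smul]
    have h2 : Φ z₀ ≤ Φ (‖z‖⁻¹ • z) := hmin (by simp [norm_smul, inv_mul_cancel₀ hzn.ne'])
    change _ ≤ (Φ z₀)⁻¹ * Φ z
    rw [h1, ← mul_assoc, mul_comm (Φ z₀)⁻¹, mul_assoc]
    refine le_mul_of_one_le_right (by positivity) ?_
    rw [← div_eq_inv_mul, one_le_div hm]
    exact h2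

/-- The Gagliardo-Nirenberg argument with a different function for each direction: `h i` at a point
is bounded by the integral of its derivative on the line along `b i`, and the grid-lines inequality
multiplies these bounds. A linear change of variables turns the directions into coordinate axes. -/
lemma exists_lintegral_prod_le (hn : 2 ≤ n) {b : Fin n → Space n} (hb : LinearIndependent ℝ b) :
    ∃ C : ℝ≥0, ∀ h : Fin n → Space n → ℝ, (∀ i, ContDiff ℝ 1 (h i)) →
      (∀ i, HasCompactSupport (h i)) →
      ∫⁻ x, ∏ i, ‖h i x‖ₑ ^ ((1 : ℝ) / (n - 1)) ≤
        C * (∑ i, ∫⁻ x, ‖fderiv ℝ (h i) x (b i)‖ₑ) ^ ((n : ℝ) / (n - 1)) := by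
  classical
  have hne : Nonempty (Fin n) := ⟨⟨0, by omega⟩⟩
  have hn1 : (1 : ℝ) < n := by exact_mod_cast (by omega : 1 < n)
  have hn' : (0 : ℝ) < n - 1 := by linarith
  have hp0 : (0 : ℝ) ≤ n / (n - 1) := by positivity
  set B := basisOfLinearIndependentOfCardEqFinrank hb (by simp) with hB
  set L : (Fin n → ℝ) ≃L[ℝ] Space n := B.equivFun.symm.toContinuousLinearEquiv with hL
  have hLapp : ∀ y, L y = ∑ i, y i • b i := by
    intro y
    simp [hL, hB, Module.Basis.equivFun_symm_apply]
  have hLm : MeasurableEmbedding L := L.toHomeomorph.measurableEmbedding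
  have : (Measure.map L (volume : Measure (Fin n → ℝ))).IsAddHaarMeasure :=
    L.isAddHaarMeasure_map _
  obtain ⟨c, hc0, hct, hc⟩ : ∃ c : ℝ≥0∞, c ≠ 0 ∧ c ≠ ⊤ ∧
      (volume : Measure (Space n)) = c • Measure.map L (volume : Measure (Fin n → ℝ)) :=
    ⟨_, ENNReal.coe_ne_zero.2 (Measure.addHaarScalarFactor_pos_of_isAddHaarMeasure _ _).ne',
      ENNReal.coe_ne_top, Measure.isAddLeftInvariant_eq_smul _ _⟩
  have hintegrable : ∀ F : Space n → ℝ≥0∞, ∫⁻ x, F x = c * ∫⁻ y : Fin n → ℝ, F (L y) := by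
    intro F
    rw [hc, lintegral_smul_measure, hLm.lintegral_map, smul_eq_mul]
  have hp : (Fintype.card (Fin n) : ℝ).HolderConjugate ((n : ℝ) / (n - 1)) := by
    rw [Fintype.card_fin]; exact Real.HolderConjugate.conjExponent hn1
  -- Here `c` is the density of Lebesgue measure relative to the image of the product measure. It
  -- enters once on the left, and its inverse enters inside the power on the right.
  refine ⟨(c * (c⁻¹) ^ ((n : ℝ) / (n - 1))).toNNReal, fun h hh hhc => ?_⟩
  have hCt : c * (c⁻¹) ^ ((n : ℝ) / (n - 1)) ≠ ⊤ :=
    ENNReal.mul_ne_top hct (ENNReal.rpow_ne_top_of_nonneg hp0 (ENNReal.inv_ne_top.2 hc0))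
  rw [ENNReal.coe_toNNReal hCt]
  set f : (Fin n → ℝ) → ℝ≥0∞ := fun y => ∑ i, ‖fderiv ℝ (h i) (L y) (b i)‖ₑ with hf
  have hfc : ∀ i, Continuous fun x => ‖fderiv ℝ (h i) x (b i)‖ₑ := fun i =>
    (((hh i).continuous_fderiv (by simp)).clm_apply continuous_const).enorm
  have hfm : Measurable f := Finset.measurable_sum _ fun i _ =>
    ((hfc i).comp L.continuous).measurable
  have hline : ∀ (y : Fin n → ℝ) i, ‖h i (L y)‖ₑ ≤ ∫⁻ t : ℝ, f (Function.update y i t) := by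
    intro y i
    refine (enorm_le_lintegral_line (hh i) (hhc i) (hb.ne_zero i) (L y)).trans ?_
    have h1 : ∀ t : ℝ, L y + (t - y i) • b i = L (Function.update y i t) := by
      intro t
      have : Function.update y i t = y + Pi.single i (t - y i) := by
        ext k
        by_cases hk : k = i
        · subst hk; simp
        · simp [hk]
      rw [this, map_add, hLapp (Pi.single _ _)]
      simp [Pi.single_apply]
    rw [← lintegral_sub_right_eq_self (fun t : ℝ => ‖fderiv ℝ (h i) (L y + t • b i) (b i)‖ₑ) (y i)]
    refine lintegral_mono fun t => ?_
    simp only [h1, hf]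
    exact Finset.single_le_sum (f := fun k => ‖fderiv ℝ (h k) (L (Function.update y i t)) (b k)‖ₑ)
      (fun _ _ => zero_le) (Finset.mem_univ i)
  have hr : (0 : ℝ) ≤ 1 / (n - 1) := by positivity
  have hgrid := lintegral_prod_lintegral_pow_le (fun _ : Fin n => (volume : Measure ℝ)) hp hfm
  rw [← volume_pi, Fintype.card_fin] at hgrid
  calc ∫⁻ x, ∏ i, ‖h i x‖ₑ ^ ((1 : ℝ) / (n - 1))
      = c * ∫⁻ y : Fin n → ℝ, ∏ i, ‖h i (L y)‖ₑ ^ ((1 : ℝ) / (n - 1)) := hintegrable _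
    _ ≤ c * ∫⁻ y : Fin n → ℝ, ∏ i, (∫⁻ t : ℝ, f (Function.update y i t)) ^ ((1 : ℝ) / (n - 1)) := by
        gcongr with y i
        exact hline y i
    _ ≤ c * (∫⁻ y, f y) ^ ((n : ℝ) / (n - 1)) := by gcongr
    _ = c * (c⁻¹ * ∑ i, ∫⁻ x, ‖fderiv ℝ (h i) x (b i)‖ₑ) ^ ((n : ℝ) / (n - 1)) := by
        congr 2
        rw [hf, lintegral_finsetSum _ fun i _ => by exact ((hfc i).comp L.continuous).measurable,
          Finset.mul_sum]
        refine Finset.sum_congr rfl fun i _ => ?_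
        rw [hintegrable, ← mul_assoc, ENNReal.inv_mul_cancel hc0 hct, one_mul]
    _ = c * (c⁻¹) ^ ((n : ℝ) / (n - 1)) *
          (∑ i, ∫⁻ x, ‖fderiv ℝ (h i) x (b i)‖ₑ) ^ ((n : ℝ) / (n - 1)) := by
        rw [ENNReal.mul_rpow_of_nonneg _ _ hp0, mul_assoc]

/-- If the distributional derivatives `∂_ξ (u · ξ)` are bounded by `‖ξ‖² μ`, then so are the
integrals of the derivatives of the mollifications. -/
lemma lintegral_fderiv_mollify_le {E : Type*} [NormedAddCommGroup E] [InnerProductSpace ℝ E]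
    [FiniteDimensional ℝ E] [MeasurableSpace E] [BorelSpace E] {u : E → ℝ}
    (hu : LocallyIntegrable u) {μ : Measure E} [IsFiniteMeasure μ] {ξ : E} {c : ℝ} (hc : 0 ≤ c)
    (h : ∀ φ : E → ℝ, ContDiff ℝ ∞ φ → HasCompactSupport φ →
      |∫ x, u x * fderiv ℝ φ x ξ| ≤ c * ∫ x, |φ x| ∂μ) (j : ℕ) :
    ∫⁻ x, ‖fderiv ℝ (mollify j u) x ξ‖ₑ ≤ ENNReal.ofReal c * μ univ := by
  set ρ : E → ℝ := (mollifier E j).normed volume with hρ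
  have hρc : Continuous ρ := (mollifier E j).continuous_normed
  have hpt : ∀ x, ‖fderiv ℝ (mollify j u) x ξ‖ₑ ≤ ENNReal.ofReal c * ∫⁻ y, ‖ρ (x - y)‖ₑ ∂μ := by
    intro x
    have h1 := h _ (contDiff_mollifier_sub j x) (hasCompactSupport_mollifier_sub j x)
    have h2 : ∀ y, fderiv ℝ (fun y => (mollifier E j).normed volume (x - y)) y ξ =
        - fderiv ℝ ((mollifier E j).normed volume) (x - y) ξ := fderiv_mollifier_sub j x ξ
    simp only [h2, mul_neg, integral_neg, abs_neg] at h1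
    rw [fderiv_mollify_eq_integral hu]
    have hi : Integrable (fun y => ρ (x - y)) μ := by
      obtain ⟨C, hC⟩ := (mollifier E j).hasCompactSupport_normed.exists_bound_of_continuous hρc
      exact Integrable.of_bound (hρc.comp (by fun_prop)).aestronglyMeasurable C
        (Eventually.of_forall fun y => hC _)
    rw [← ofReal_norm, Real.norm_eq_abs]
    have h3 : ∫⁻ y, ‖ρ (x - y)‖ₑ ∂μ = ENNReal.ofReal (∫ y, |ρ (x - y)| ∂μ) := by
      rw [ofReal_integral_eq_lintegral_ofReal hi.abs (Eventually.of_forall fun _ => abs_nonneg _)]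
      refine lintegral_congr fun y => ?_
      rw [← ofReal_norm, Real.norm_eq_abs]
    rw [h3, ← ENNReal.ofReal_mul hc]
    refine ENNReal.ofReal_le_ofReal (le_trans (le_of_eq ?_) h1)
    congr 1
    exact integral_congr_ae (Eventually.of_forall fun y => mul_comm _ _)
  calc ∫⁻ x, ‖fderiv ℝ (mollify j u) x ξ‖ₑ
      ≤ ∫⁻ x, ENNReal.ofReal c * ∫⁻ y, ‖ρ (x - y)‖ₑ ∂μ := lintegral_mono hpt
    _ = ENNReal.ofReal c * ∫⁻ x, ∫⁻ y, ‖ρ (x - y)‖ₑ ∂μ :=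
        lintegral_const_mul' _ _ ENNReal.ofReal_ne_top
    _ = ENNReal.ofReal c * ∫⁻ y, (∫⁻ x, ‖ρ (x - y)‖ₑ) ∂μ := by
        rw [lintegral_lintegral_swap]
        exact ((hρc.comp (by fun_prop : Continuous fun z : E × E => z.1 - z.2)).enorm).aemeasurable
    _ = ENNReal.ofReal c * ∫⁻ _y, 1 ∂μ := by
        congr 1
        refine lintegral_congr fun y => ?_
        rw [lintegral_sub_right_eq_self (fun x => ‖ρ x‖ₑ) y]
        exact lintegral_enorm_mollifier j
    _ = ENNReal.ofReal c * μ univ := by simp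

/-- The embedding of functions of bounded deformation into `L^{n/(n-1)}`. -/
lemma exists_lintegral_rpow_le_of_deformation (hn : 2 ≤ n) :
    ∃ C : ℝ≥0, ∀ (u : Space n → Space n) (R : ℝ) (μ : Measure (Space n)) [IsFiniteMeasure μ],
      Integrable u → (∀ x, R < ‖x‖ → u x = 0) →
      (∀ (ξ : Space n) (φ : Space n → ℝ), ContDiff ℝ ∞ φ → HasCompactSupport φ →
        |∫ x, inner ℝ (u x) ξ * fderiv ℝ φ x ξ| ≤ ‖ξ‖ ^ 2 * ∫ x, |φ x| ∂μ) →
      ∫⁻ x, ‖u x‖ₑ ^ ((n : ℝ) / (n - 1)) ≤ C * (μ univ) ^ ((n : ℝ) / (n - 1)) := by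
  have hn1 : (1 : ℝ) < n := by exact_mod_cast (by omega : 1 < n)
  have hn' : (0 : ℝ) < n - 1 := by linarith
  have hp0 : (0 : ℝ) ≤ n / (n - 1) := by positivity
  have hr : (0 : ℝ) ≤ 1 / (n - 1) := by positivity
  obtain ⟨C₀, hC₀, hnorm⟩ := exists_norm_rpow_le_sum_prod hn
  have hσ : ∀ σ : Fin n ↪ Fin (2 * n), ∃ C : ℝ≥0, ∀ h : Fin n → Space n → ℝ,
      (∀ i, ContDiff ℝ 1 (h i)) → (∀ i, HasCompactSupport (h i)) →
      ∫⁻ x, ∏ i, ‖h i x‖ₑ ^ ((1 : ℝ) / (n - 1)) ≤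
        C * (∑ i, ∫⁻ x, ‖fderiv ℝ (h i) x (momentVector n (σ i))‖ₑ) ^ ((n : ℝ) / (n - 1)) :=
    fun σ => exists_lintegral_prod_le hn (b := fun i => momentVector n (σ i))
      (linearIndependent_momentVector (σ := fun i => ((σ i : Fin (2 * n)) : ℕ))
        (fun i j hij => σ.injective (Fin.ext hij)))
  choose Cσ hCσ using hσ
  set A : (Fin n ↪ Fin (2 * n)) → ℝ≥0∞ := fun σ =>
    ∑ i, ENNReal.ofReal (‖momentVector n (σ i)‖ ^ 2) with hA
  have hAt : ∀ σ, A σ ≠ ⊤ := fun σ => by simp [hA]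
  set K : ℝ≥0∞ := ENNReal.ofReal C₀ * ∑ σ, (Cσ σ : ℝ≥0∞) * A σ ^ ((n : ℝ) / (n - 1)) with hK
  have hKt : K ≠ ⊤ := by
    refine ENNReal.mul_ne_top ENNReal.ofReal_ne_top (ENNReal.sum_ne_top.2 fun σ _ => ?_)
    exact ENNReal.mul_ne_top ENNReal.coe_ne_top (ENNReal.rpow_ne_top_of_nonneg hp0 (hAt σ))
  refine ⟨K.toNNReal, fun u R μ _ hu huR hμ => ?_⟩
  rw [ENNReal.coe_toNNReal hKt]
  have hui : ∀ ξ, Integrable fun x => inner ℝ (u x) ξ := fun ξ => hu.inner_const ξ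
  have huz : ∀ ξ x, R < ‖x‖ → inner ℝ (u x) ξ = 0 := fun ξ x hx => by simp [huR x hx]
  -- The product estimate holds for the smooth mollified components, uniformly in the scale, and
  -- passes to the limit by Fatou.
  have hprod : ∀ σ : Fin n ↪ Fin (2 * n),
      ∫⁻ x, ∏ i, ‖inner ℝ (u x) (momentVector n (σ i))‖ₑ ^ ((1 : ℝ) / (n - 1)) ≤
        Cσ σ * (A σ * μ univ) ^ ((n : ℝ) / (n - 1)) := by
    intro σ
    set h : ℕ → Fin n → Space n → ℝ := fun j i =>
      mollify j fun x => inner ℝ (u x) (momentVector n (σ i))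
    have hsm : ∀ j i, ContDiff ℝ 1 (h j i) := fun j i =>
      (contDiff_mollify (hui _).locallyIntegrable j).of_le (by exact_mod_cast le_top)
    have hcs : ∀ j i, HasCompactSupport (h j i) := fun j i =>
      hasCompactSupport_of_eq_zero_of_lt_norm fun x hx => mollify_eq_zero (huz _) j hx
    have hlim : ∀ᵐ x, ∀ i, Tendsto (fun j => h j i x) atTop
        (𝓝 (inner ℝ (u x) (momentVector n (σ i)))) :=
      ae_all_iff.2 fun i => ae_tendsto_mollify (hui _).locallyIntegrable
    calc ∫⁻ x, ∏ i, ‖inner ℝ (u x) (momentVector n (σ i))‖ₑ ^ ((1 : ℝ) / (n - 1))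
        ≤ ∫⁻ x, liminf (fun j => ∏ i, ‖h j i x‖ₑ ^ ((1 : ℝ) / (n - 1))) atTop := by
          refine lintegral_mono_ae ?_
          filter_upwards [hlim] with x hx
          refine (Tendsto.liminf_eq ?_).ge
          refine ENNReal.tendsto_finsetProd_of_ne_top _ (fun i _ => ?_) (fun i _ => ?_)
          · exact (ENNReal.continuous_rpow_const.tendsto _).comp (hx i).enorm
          · exact ENNReal.rpow_ne_top_of_nonneg hr enorm_ne_top
      _ ≤ liminf (fun j => ∫⁻ x, ∏ i, ‖h j i x‖ₑ ^ ((1 : ℝ) / (n - 1))) atTop := by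
          refine lintegral_liminf_le fun j => Finset.measurable_prod _ fun i _ => ?_
          exact (hsm j i).continuous.enorm.measurable.pow_const _
      _ ≤ liminf (fun _ : ℕ => Cσ σ * (A σ * μ univ) ^ ((n : ℝ) / (n - 1))) atTop := by
          refine liminf_le_liminf (Eventually.of_forall fun j => ?_)
          refine (hCσ σ (h j) (hsm j) (hcs j)).trans ?_
          gcongr
          rw [hA, Finset.sum_mul]
          refine Finset.sum_le_sum fun i _ => ?_
          exact lintegral_fderiv_mollify_le (hui _).locallyIntegrable (by positivity) (hμ _) j
      _ = _ := liminf_const _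
  have hm : ∀ σ : Fin n ↪ Fin (2 * n), AEMeasurable (fun x =>
      ∏ i, ‖inner ℝ (u x) (momentVector n (σ i))‖ₑ ^ ((1 : ℝ) / (n - 1))) volume := fun σ =>
    Finset.aemeasurable_fun_prod _ fun i _ => ((hui _).aestronglyMeasurable.enorm).pow_const _
  calc ∫⁻ x, ‖u x‖ₑ ^ ((n : ℝ) / (n - 1))
      ≤ ∫⁻ x, ENNReal.ofReal C₀ * ∑ σ : Fin n ↪ Fin (2 * n),
          ∏ i, ‖inner ℝ (u x) (momentVector n (σ i))‖ₑ ^ ((1 : ℝ) / (n - 1)) := by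
        refine lintegral_mono fun x => ?_
        have h1 := ENNReal.ofReal_le_ofReal (hnorm (u x))
        rw [← ENNReal.ofReal_rpow_of_nonneg (norm_nonneg _) hp0, ofReal_norm,
          ENNReal.ofReal_mul hC₀.le, ENNReal.ofReal_sum_of_nonneg fun σ _ =>
            Finset.prod_nonneg fun i _ => by positivity] at h1
        refine h1.trans_eq ?_
        congr 1
        refine Finset.sum_congr rfl fun σ _ => ?_
        rw [ENNReal.ofReal_prod_of_nonneg fun i _ => by positivity]
        refine Finset.prod_congr rfl fun i _ => ?_
        rw [← ENNReal.ofReal_rpow_of_nonneg (abs_nonneg _) hr, ← Real.norm_eq_abs, ofReal_norm]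
    _ = ENNReal.ofReal C₀ * ∑ σ : Fin n ↪ Fin (2 * n),
          ∫⁻ x, ∏ i, ‖inner ℝ (u x) (momentVector n (σ i))‖ₑ ^ ((1 : ℝ) / (n - 1)) := by
        rw [lintegral_const_mul' _ _ ENNReal.ofReal_ne_top, lintegral_finsetSum' _ fun σ _ => hm σ]
    _ ≤ ENNReal.ofReal C₀ * ∑ σ : Fin n ↪ Fin (2 * n),
          Cσ σ * (A σ * μ univ) ^ ((n : ℝ) / (n - 1)) := by
        gcongr with σ
        exact hprod σ
    _ = K * μ univ ^ ((n : ℝ) / (n - 1)) := by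
        rw [hK, mul_assoc, Finset.sum_mul]
        congr 1
        refine Finset.sum_congr rfl fun σ _ => ?_
        rw [ENNReal.mul_rpow_of_nonneg _ _ hp0, mul_assoc]

end KornSobolev

/-! ### Finiteness of the variation and integration against densities. -/

section VectorMeasures

variable {X F : Type*} [MeasurableSpace X] [NormedAddCommGroup F] [InnerProductSpace ℝ F]
  [FiniteDimensional ℝ F]

/-- In an orthonormal basis the variation is dominated by the sum of the total variations of the
finitely many components, which are finite signed measures. -/
lemma isFiniteMeasure_variation (p : VectorMeasure X F) : IsFiniteMeasure p.variation := by
  set b := stdOrthonormalBasis ℝ F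
  set c : Fin (Module.finrank ℝ F) → SignedMeasure X := fun i =>
    p.mapRange (innerSL ℝ (b i)).toLinearMap.toAddMonoidHom (innerSL ℝ (b i)).continuous with hc
  have hle : p.variation ≤ ∑ i, (c i).totalVariation := by
    refine VectorMeasure.variation_le_of_forall_enorm_le fun s hs => ?_
    rw [Measure.finsetSum_apply]
    conv_lhs => rw [← b.sum_repr' (p s)]
    refine (enorm_sum_le _ _).trans (Finset.sum_le_sum fun i _ => ?_)
    refine le_trans (le_of_eq ?_) (SignedMeasure.enorm_le_totalVariation (c i) s)
    rw [enorm_smul, ← ofReal_norm (b i), b.orthonormal.1 i]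
    simp [hc]
  have : IsFiniteMeasure (∑ i, (c i).totalVariation) := by
    refine ⟨?_⟩
    rw [Measure.finsetSum_apply]
    exact ENNReal.sum_lt_top.2 fun i _ => measure_lt_top _ _
  exact isFiniteMeasure_of_le _ hle

/-- The integral of a bounded function against a vector measure with a density. -/
lemma vectorMeasure_integral_withDensity {E G : Type*} [NormedAddCommGroup E] [NormedSpace ℝ E]
    [NormedAddCommGroup G] [NormedSpace ℝ G] [CompleteSpace G]
    {ν : Measure X} {D : X → F} (hD : Integrable D ν) (B : E →L[ℝ] F →L[ℝ] G) {φ : X → E}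
    (hφ : StronglyMeasurable φ) {C : ℝ} (hC : ∀ x, ‖φ x‖ ≤ C) :
    ∫ᵛ x, φ x ∂[B; ν.withDensityᵥ D] = ∫ x, B (φ x) (D x) ∂ν := by
  have := isFiniteMeasure_variation (ν.withDensityᵥ D)
  have hintegrable : ∀ ψ : X → E, StronglyMeasurable ψ → (∃ C, ∀ x, ‖ψ x‖ ≤ C) →
      Integrable (fun x => B (ψ x) (D x)) ν := by
    rintro ψ hψ ⟨C, hC⟩
    refine (hD.norm.const_mul (‖B‖ * C)).mono' ?_ ?_
    · exact B.aestronglyMeasurable_comp₂ hψ.aestronglyMeasurable hD.1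
    · refine Eventually.of_forall fun x => ?_
      refine (B.le_opNorm₂ _ _).trans ?_
      gcongr
      exact hC x
  have hsimple : ∀ s : SimpleFunc X E,
      ∫ᵛ x, s x ∂[B; ν.withDensityᵥ D] = ∫ x, B (s x) (D x) ∂ν := by
    intro s
    induction s using SimpleFunc.induction with
    | @const c s hs =>
      have h1 : ∀ x, (SimpleFunc.piecewise s hs (SimpleFunc.const X c) (SimpleFunc.const X 0)) x
          = s.indicator (fun _ => c) x := by
        intro x
        simp [SimpleFunc.piecewise_apply, Set.indicator]
      simp_rw [h1]
      rw [VectorMeasure.integral_indicator_const _ hs, withDensityᵥ_apply hD hs,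
        ← (B c).integral_comp_comm hD.integrableOn, ← integral_indicator hs]
      refine integral_congr_ae (Eventually.of_forall fun x => ?_)
      by_cases hx : x ∈ s <;> simp [hx]
    | @add f g hfg hf hg =>
      have hi : ∀ f : SimpleFunc X E, Integrable f (ν.withDensityᵥ D).variation :=
        fun f => f.integrable_of_isFiniteMeasure
      have hb : ∀ f : SimpleFunc X E, ∃ C, ∀ x, ‖f x‖ ≤ C := fun f => f.exists_forall_norm_le
      simp only [SimpleFunc.coe_add, Pi.add_apply, map_add, add_apply]
      rw [VectorMeasure.integral_fun_add (hi f) (hi g), hf, hg,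
        integral_add (hintegrable f f.stronglyMeasurable (hb f)) (hintegrable g g.stronglyMeasurable (hb g))]
  have hC0 : 0 ≤ C ∨ IsEmpty X := by
    rcases isEmpty_or_nonempty X with h | ⟨⟨x⟩⟩
    · exact Or.inr h
    · exact Or.inl ((norm_nonneg _).trans (hC x))
  rcases hC0 with hC0 | hX
  swap
  · simp [VectorMeasure.integral_of_isEmpty, Measure.eq_zero_of_isEmpty]
  have h1 : Tendsto (fun j => ∫ᵛ x, hφ.approxBounded C j x ∂[B; ν.withDensityᵥ D]) atTop
      (𝓝 (∫ᵛ x, φ x ∂[B; ν.withDensityᵥ D])) := by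
    refine VectorMeasure.tendsto_integral_of_dominated_convergence (fun _ => C)
      (fun j => (hφ.approxBounded C j).stronglyMeasurable.aestronglyMeasurable)
      (integrable_const _) (fun j => Eventually.of_forall fun x => ?_)
      (Eventually.of_forall fun x => ?_)
    · exact hφ.norm_approxBounded_le hC0 j x
    · exact hφ.tendsto_approxBounded_of_norm_le (hC x)
  have h2 : Tendsto (fun j => ∫ x, B (hφ.approxBounded C j x) (D x) ∂ν) atTop
      (𝓝 (∫ x, B (φ x) (D x) ∂ν)) := by
    refine tendsto_integral_of_dominated_convergence (fun x => ‖B‖ * C * ‖D x‖)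
      (fun j => (hintegrable _ (hφ.approxBounded C j).stronglyMeasurable
        ⟨C, hφ.norm_approxBounded_le hC0 j⟩).1)
      (hD.norm.const_mul _) (fun j => Eventually.of_forall fun x => ?_)
      (Eventually.of_forall fun x => ?_)
    · refine (B.le_opNorm₂ _ _).trans ?_
      gcongr
      exact hφ.norm_approxBounded_le hC0 j x
    · exact ((B.flip (D x)).continuous.tendsto _).comp (hφ.tendsto_approxBounded_of_norm_le (hC x))
  simp_rw [hsimple] at h1
  exact tendsto_nhds_unique h1 h2

end VectorMeasures

/-! ### Polar decomposition of a matrix-valued measure. -/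

section Polar

variable {n : ℕ} {Ω : Opens (Space n)}

instance instIsFiniteMeasureVariation (p : VectorMeasure Ω (SymMat n)) :
    IsFiniteMeasure p.variation :=
  isFiniteMeasure_variation (F := SymMat n) p

lemma measurable_polarDensity (p : VectorMeasure Ω (SymMat n)) : Measurable (polarDensity p) := by
  unfold polarDensity
  exact Finset.measurable_fun_sum _ fun i _ =>
    (SignedMeasure.measurable_rnDeriv _ _).smul_const _

lemma integrable_polarDensity (p : VectorMeasure Ω (SymMat n)) :
    Integrable (polarDensity p) p.variation := by
  unfold polarDensity
  exact integrable_finsetSum _ fun i _ => (SignedMeasure.integrable_rnDeriv _ _).smul_const _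

/-- Every component is absolutely continuous with respect to the variation, so Radon-Nikodym applies
componentwise. -/
lemma withDensityᵥ_polarDensity (p : VectorMeasure Ω (SymMat n)) :
    p.variation.withDensityᵥ (polarDensity p) = p := by
  ext1 s hs
  rw [withDensityᵥ_apply (integrable_polarDensity p) hs]
  unfold polarDensity
  rw [integral_finsetSum _ fun i _ =>
    ((SignedMeasure.integrable_rnDeriv _ _).smul_const _).integrableOn]
  conv_rhs => rw [← (stdOrthonormalBasis ℝ (SymMat n)).sum_repr' (p s)]
  refine Finset.sum_congr rfl fun i _ => ?_
  rw [integral_smul_const]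
  congr 1
  rw [← withDensityᵥ_apply (SignedMeasure.integrable_rnDeriv _ _) hs,
    SignedMeasure.withDensityᵥ_rnDeriv_eq]
  · rfl
  · refine VectorMeasure.AbsolutelyContinuous.mk fun t ht h0 => ?_
    rw [Measure.toENNRealVectorMeasure_apply_measurable ht] at h0
    have h1 := VectorMeasure.enorm_measure_le_variation p t
    rw [h0] at h1
    have h2 : p t = 0 := by simpa using h1
    simp [h2]

/-- The variation of the measure with density `D` has density `‖D‖`; here it is the reference
measure itself, and densities are unique. -/
lemma norm_polarDensity (p : VectorMeasure Ω (SymMat n)) :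
    ∀ᵐ x ∂p.variation, ‖polarDensity p x‖ = 1 := by
  have h := Measure.variation_withDensityᵥ (integrable_polarDensity p)
  rw [withDensityᵥ_polarDensity] at h
  have h1 : p.variation.withDensity (fun x => ‖polarDensity p x‖ₑ)
      = p.variation.withDensity 1 := by
    rw [withDensity_one]
    exact h.symm
  have h2 := (withDensity_eq_iff (measurable_polarDensity p).enorm.aemeasurable
    measurable_one.aemeasurable (integrable_polarDensity p).2.ne).1 h1
  filter_upwards [h2] with x hx
  rw [← toReal_enorm, hx]
  simp

lemma integral_eq_integral_polarDensity {E G : Type*} [NormedAddCommGroup E] [NormedSpace ℝ E]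
    [NormedAddCommGroup G] [NormedSpace ℝ G] [CompleteSpace G] (p : VectorMeasure Ω (SymMat n))
    (B : E →L[ℝ] SymMat n →L[ℝ] G) {φ : Ω → E}
    (hφ : StronglyMeasurable φ) {C : ℝ} (hC : ∀ x, ‖φ x‖ ≤ C) :
    ∫ᵛ x, φ x ∂[B; p] = ∫ x, B (φ x) (polarDensity p x) ∂p.variation := by
  conv_lhs => rw [← withDensityᵥ_polarDensity p]
  exact vectorMeasure_integral_withDensity (integrable_polarDensity p) B hφ hC

end Polar

/-! ### The strain tested against `ξ ⊗ ξ`. -/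

section Strain

variable {n : ℕ}

/-- The symmetric matrix `ξ ⊗ ξ`. -/
def symSq (ξ : Space n) : SymMat n :=
  ⟨WithLp.toLp 2 fun ij => ξ ij.1 * ξ ij.2, fun i j => by simp [mul_comm]⟩

lemma inner_symSq (ξ : Space n) (A : SymMat n) :
    inner ℝ (symSq ξ) A = ∑ i, ∑ j, A.1 (i, j) * (ξ i * ξ j) := by
  rw [Submodule.coe_inner, PiLp.inner_apply, Fintype.sum_prod_type]
  simp [symSq]

lemma norm_symSq (ξ : Space n) : ‖symSq ξ‖ = ‖ξ‖ ^ 2 := by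
  have h : ‖symSq ξ‖ ^ 2 = (‖ξ‖ ^ 2) ^ 2 := by
    rw [← real_inner_self_eq_norm_sq, inner_symSq, EuclideanSpace.norm_sq_eq, sq,
      Finset.sum_mul_sum]
    refine Finset.sum_congr rfl fun i _ => Finset.sum_congr rfl fun j _ => ?_
    simp only [symSq, Real.norm_eq_abs, sq_abs]
    ring
  exact (pow_left_inj₀ (norm_nonneg _) (by positivity) two_ne_zero).1 h

/-- Symmetric matrices are combinations of the matrices `ξ ⊗ ξ`. -/
lemma symMat_eq_sum (a : SymMat n) :
    a = ∑ i, ∑ j, (a.1 (i, j) / 2) •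
      (symSq (EuclideanSpace.single i 1 + EuclideanSpace.single j 1)
        - symSq (EuclideanSpace.single i 1) - symSq (EuclideanSpace.single j 1)) := by
  ext ⟨k, l⟩
  have hs := a.2 k l
  simp only [AddSubmonoidClass.coe_finsetSum, WithLp.ofLp_sum, Finset.sum_apply, symSq,
    Submodule.coe_smul, Submodule.coe_sub, PiLp.smul_apply, PiLp.sub_apply, smul_eq_mul,
    PiLp.add_apply, PiLp.single_apply]
  have h : ∀ i j, a.1 (i, j) / 2 * (((if k = i then (1:ℝ) else 0) + if k = j then 1 else 0) *
      ((if l = i then 1 else 0) + if l = j then 1 else 0) -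
      (if k = i then 1 else 0) * (if l = i then 1 else 0) -
      (if k = j then 1 else 0) * if l = j then 1 else 0)
      = (if k = i then (if l = j then a.1 (i, j) / 2 else 0) else 0)
        + (if l = i then (if k = j then a.1 (i, j) / 2 else 0) else 0) := by
    intro i j
    split_ifs <;> ring
  simp_rw [h, Finset.sum_add_distrib]
  simp
  linarith

variable {Ω : Opens (Space n)}

/-- Contracting with the symmetric weights `ξ i * ξ j` makes the two halves of the symmetrised
gradient equal, leaving the scalar identity `⟪ξ ⊗ ξ, Eu⟫ = ∂_ξ(u · ξ)`. All later analysis of the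
strain goes through it. -/
lemma inner_symSq_integral_of_isSymGradient {u : Ω → Space n} (hu : Integrable u)
    {μ : VectorMeasure Ω (SymMat n)} (h : IsSymGradient Ω u μ) {φ : Space n → ℝ}
    (hφ : ContDiff ℝ ∞ φ) (hφc : HasCompactSupport φ) (hφΩ : tsupport φ ⊆ Ω) (ξ : Space n) :
    inner ℝ (symSq ξ) (∫ᵛ x, φ (x : Ω) ∂•μ : SymMat n)
      = - ∫ x : Ω, inner ℝ (u x) ξ * fderiv ℝ φ x ξ := by
  have h' := h ⟨φ, hφ, hφc, hφΩ⟩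
  have hpd : ∀ i, Continuous (partialDeriv φ i) := fun i =>
    (hφ.continuous_fderiv (by simp)).clm_apply continuous_const
  have hbd : ∀ i, ∃ C, ∀ x, ‖partialDeriv φ i x‖ ≤ C := fun i =>
    (hφc.fderiv_apply (𝕜 := ℝ) _).exists_bound_of_continuous (hpd i)
  have hintegrable : ∀ i j, Integrable (fun x : Ω => u x i * partialDeriv φ j x) := by
    intro i j
    obtain ⟨C, hC⟩ := hbd j
    refine (((EuclideanSpace.proj (𝕜 := ℝ) i).integrable_comp hu)).mul_bdd (c := C)
      ((hpd j).comp continuous_subtype_val).aestronglyMeasurable ?_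
    exact Eventually.of_forall fun x => hC x
  have hξ : ∀ x : Space n, fderiv ℝ φ x ξ = ∑ j, ξ j * partialDeriv φ j x := by
    intro x
    have hb : ξ = ∑ j, ξ j • EuclideanSpace.single j (1 : ℝ) := by
      ext k
      simp [Pi.single_apply]
    conv_lhs => rw [hb, map_sum]
    exact Finset.sum_congr rfl fun j _ => by rw [map_smul, smul_eq_mul]; rfl
  have hintegrable' : ∀ i j, Integrable (fun x : Ω => ξ i * ξ j * (u x i * partialDeriv φ j x)) :=
    fun i j => (hintegrable i j).const_mul _
  have e1 : ∫ x : Ω, inner ℝ (u x) ξ * fderiv ℝ φ x ξ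
      = ∑ i, ∑ j, ξ i * ξ j * ∫ x : Ω, u x i * partialDeriv φ j x := by
    have : ∀ x : Ω, inner ℝ (u x) ξ * fderiv ℝ φ x ξ
        = ∑ i, ∑ j, ξ i * ξ j * (u x i * partialDeriv φ j x) := by
      intro x
      rw [hξ, PiLp.inner_apply, Finset.sum_mul_sum]
      refine Finset.sum_congr rfl fun i _ => Finset.sum_congr rfl fun j _ => ?_
      simp
      ring
    simp_rw [this]
    rw [integral_finsetSum _ fun i _ => integrable_finsetSum _ fun j _ => hintegrable' i j]
    refine Finset.sum_congr rfl fun i _ => ?_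
    rw [integral_finsetSum _ fun j _ => hintegrable' i j]
    exact Finset.sum_congr rfl fun j _ => integral_const_mul _ _
  rw [inner_symSq, e1]
  have h2 : ∀ i j, (∫ᵛ x, φ (x : Ω) ∂•μ : SymMat n).1 (i, j) = - (1 / 2) *
      ((∫ x : Ω, u x i * partialDeriv φ j x) + ∫ x : Ω, u x j * partialDeriv φ i x) := by
    intro i j
    rw [← integral_add (hintegrable i j) (hintegrable j i)]
    exact h' i j
  simp_rw [h2]
  have h3 : ∑ i, ∑ j, ξ i * ξ j * ∫ x : Ω, u x j * partialDeriv φ i x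
      = ∑ i, ∑ j, ξ i * ξ j * ∫ x : Ω, u x i * partialDeriv φ j x := by
    rw [Finset.sum_comm]
    exact Finset.sum_congr rfl fun i _ => Finset.sum_congr rfl fun j _ => by ring
  have h4 : ∀ i j, - (1 / 2) * ((∫ x : Ω, u x i * partialDeriv φ j x)
      + ∫ x : Ω, u x j * partialDeriv φ i x) * (ξ i * ξ j)
      = - (1 / 2) * (ξ i * ξ j * ∫ x : Ω, u x i * partialDeriv φ j x)
        + - (1 / 2) * (ξ i * ξ j * ∫ x : Ω, u x j * partialDeriv φ i x) := by
    intro i j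
    ring
  simp_rw [h4, Finset.sum_add_distrib, ← Finset.mul_sum]
  rw [h3]
  ring

lemma integral_symSq_strain (u : BD Ω) {φ : Space n → ℝ}
    (hφ : ContDiff ℝ ∞ φ) (hφc : HasCompactSupport φ) (hφΩ : tsupport φ ⊆ Ω) (ξ : Space n) :
    ∫ x : Ω, φ x * inner ℝ (symSq ξ) (polarDensity (BD.strain u) x) ∂(BD.strain u).variation
      = - ∫ x : Ω, inner ℝ (u.1 x) ξ * fderiv ℝ φ x ξ := by
  rw [← inner_symSq_integral_of_isSymGradient (L1.integrable_coeFn u.1)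
    (Classical.choose_spec u.2) hφ hφc hφΩ ξ]
  obtain ⟨C, hC⟩ := hφc.exists_bound_of_continuous hφ.continuous
  have hm : StronglyMeasurable fun x : Ω => φ x :=
    (hφ.continuous.comp continuous_subtype_val).stronglyMeasurable
  change _ = innerSL ℝ (symSq ξ) (∫ᵛ x, φ (x : Ω) ∂•(BD.strain u) : SymMat n)
  rw [integral_eq_integral_polarDensity _ _ hm fun x => hC x]
  rw [← ContinuousLinearMap.integral_comp_comm]
  · simp
  · refine (integrable_polarDensity _).bdd_smul C hm.aestronglyMeasurable
      (Eventually.of_forall fun x : Ω => hC x)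

lemma integral_symSq_split (u : BD Ω) {p : VectorMeasure Ω (SymMat n)} {e : Ω → SymMat n}
    (he : Integrable e)
    (h : BD.strain u = (volume : Measure Ω).withDensityᵥ e + p) {φ : Space n → ℝ}
    (hφ : ContDiff ℝ ∞ φ) (hφc : HasCompactSupport φ) (hφΩ : tsupport φ ⊆ Ω) (ξ : Space n) :
    (∫ x : Ω, φ x * inner ℝ (symSq ξ) (polarDensity p x) ∂p.variation)
      + (∫ x : Ω, φ x * inner ℝ (symSq ξ) (e x))
      = - ∫ x : Ω, inner ℝ (u.1 x) ξ * fderiv ℝ φ x ξ := by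
  rw [← inner_symSq_integral_of_isSymGradient (L1.integrable_coeFn u.1)
    (Classical.choose_spec u.2) hφ hφc hφΩ ξ]
  obtain ⟨C, hC⟩ := hφc.exists_bound_of_continuous hφ.continuous
  have hm : StronglyMeasurable fun x : Ω => φ x :=
    (hφ.continuous.comp continuous_subtype_val).stronglyMeasurable
  change _ = innerSL ℝ (symSq ξ) (∫ᵛ x, φ (x : Ω) ∂•(BD.strain u) : SymMat n)
  rw [h]
  have hi : ∀ q : VectorMeasure Ω (SymMat n), Integrable (fun x : Ω => φ x) q.variation :=
    fun q => Integrable.of_bound hm.aestronglyMeasurable C (Eventually.of_forall fun x : Ω => hC x)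
  have h1 : (∫ᵛ x, φ (x : Ω) ∂•((volume : Measure Ω).withDensityᵥ e + p) : SymMat n)
      = (∫ᵛ x, φ (x : Ω) ∂•((volume : Measure Ω).withDensityᵥ e))
        + ∫ᵛ x, φ (x : Ω) ∂•p :=
    VectorMeasure.integral_add_vectorMeasure (hi _) (hi _)
  rw [h1, integral_eq_integral_polarDensity p _ hm fun x => hC x,
    vectorMeasure_integral_withDensity he _ hm fun x => hC x, map_add,
    ← ContinuousLinearMap.integral_comp_comm, ← ContinuousLinearMap.integral_comp_comm, add_comm]
  · simp
  · refine (integrable_polarDensity _).bdd_smul C hm.aestronglyMeasurable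
      (Eventually.of_forall fun x : Ω => hC x)
  · refine he.bdd_smul C hm.aestronglyMeasurable
      (Eventually.of_forall fun x : Ω => hC x)

end Strain

/-! ### Bounded variation of weakly* convergent sequences. -/

section Bound

/-- Radial truncation to the unit ball moves `x` by at most `‖x‖ - 1` when it moves it at all, and
this is at most the distance from `x` to the unit vector `y`. -/
lemma norm_inv_max_smul_sub_le {F : Type*} [NormedAddCommGroup F] [NormedSpace ℝ F] {x y : F}
    (hy : ‖y‖ = 1) : ‖(max 1 ‖x‖)⁻¹ • x - y‖ ≤ 2 * ‖x - y‖ := by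
  have h1 : ‖(max 1 ‖x‖)⁻¹ • x - x‖ ≤ ‖x - y‖ := by
    rcases le_total ‖x‖ 1 with h | h
    · rw [max_eq_left h]
      simp
    · rw [max_eq_right h]
      have : (‖x‖)⁻¹ • x - x = ((‖x‖)⁻¹ - 1) • x := by rw [sub_smul, one_smul]
      have hx : 0 < ‖x‖ := by linarith
      rw [this, norm_smul, Real.norm_eq_abs, abs_sub_comm,
        abs_of_nonneg (by rw [sub_nonneg]; exact inv_le_one_of_one_le₀ h), sub_mul,
        inv_mul_cancel₀ hx.ne', one_mul, ← hy]
      exact norm_sub_norm_le x y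
  calc _ ≤ ‖(max 1 ‖x‖)⁻¹ • x - x‖ + ‖x - y‖ := norm_sub_le_norm_sub_add_norm_sub _ _ _
    _ ≤ _ := by linarith

lemma norm_inv_max_smul_le {F : Type*} [NormedAddCommGroup F] [NormedSpace ℝ F] (x : F) :
    ‖(max 1 ‖x‖)⁻¹ • x‖ ≤ 1 := by
  have : 0 < max 1 ‖x‖ := lt_max_of_lt_left one_pos
  rw [norm_smul, norm_inv, Real.norm_of_nonneg this.le, inv_mul_le_iff₀ this, mul_one]
  exact le_max_right _ _

/-- A compactly supported `L¹` approximation of the unit field `D`, truncated to the unit ball, has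
inner product with `D` at least `1` minus twice the approximation error. -/
lemma exists_hasCompactSupport_le_integral_inner {X F : Type*} [TopologicalSpace X] [R1Space X] [NormalSpace X]
    [WeaklyLocallyCompactSpace X] [MeasurableSpace X] [BorelSpace X] [NormedAddCommGroup F]
    [InnerProductSpace ℝ F] [SecondCountableTopologyEither X F] {m : Measure X}
    [IsFiniteMeasure m] [m.Regular] {D : X → F}
    (hD : Integrable D m) (hD1 : ∀ᵐ x ∂m, ‖D x‖ = 1) {ε : ℝ} (hε : 0 < ε) :
    ∃ h : X → F, Continuous h ∧ HasCompactSupport h ∧ (∀ x, ‖h x‖ ≤ 1) ∧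
      m.real univ - ε ≤ ∫ x, inner ℝ (h x) (D x) ∂m := by
  obtain ⟨g, hgc, hg, hgcont, hgi⟩ :=
    hD.exists_hasCompactSupport_integral_sub_le (half_pos hε)
  set h : X → F := fun x => (max 1 ‖g x‖)⁻¹ • g x with hh
  have hcont : Continuous h := by
    refine Continuous.smul (Continuous.inv₀ (continuous_const.max hgcont.norm) fun x => ?_) hgcont
    exact (lt_max_of_lt_left one_pos).ne'
  have hb : ∀ x, ‖h x‖ ≤ 1 := fun x => norm_inv_max_smul_le _
  refine ⟨h, hcont, hgc.smul_left, hb, ?_⟩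
  have hi0 : Integrable (fun x => 2 * ‖D x - g x‖) m := ((hD.sub hgi).norm).const_mul 2
  have hi1 : Integrable (fun x => 1 - 2 * ‖D x - g x‖) m := (integrable_const _).sub hi0
  have hi2 : Integrable (fun x => inner ℝ (h x) (D x)) m := by
    refine hD.norm.mono' ?_ (Eventually.of_forall fun x => ?_)
    · exact hcont.aestronglyMeasurable.inner hD.1
    · refine (norm_inner_le_norm _ _).trans ?_
      exact mul_le_of_le_one_left (norm_nonneg _) (hb x)
  have hle : ∫ x, (1 - 2 * ‖D x - g x‖) ∂m ≤ ∫ x, inner ℝ (h x) (D x) ∂m := by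
    refine integral_mono_ae hi1 hi2 ?_
    filter_upwards [hD1] with x hx
    have h1 : inner ℝ (h x) (D x) = 1 + inner ℝ (h x - D x) (D x) := by
      rw [inner_sub_left, real_inner_self_eq_norm_sq, hx]
      ring
    have h2 := neg_le_of_abs_le (abs_real_inner_le_norm (h x - D x) (D x))
    have h3 : ‖h x - D x‖ ≤ 2 * ‖g x - D x‖ := norm_inv_max_smul_sub_le hx
    change 1 - 2 * ‖D x - g x‖ ≤ inner ℝ (h x) (D x)
    rw [h1, norm_sub_rev]
    rw [hx, mul_one] at h2
    linarith
  refine le_trans ?_ hle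
  rw [integral_sub (integrable_const _) hi0, integral_const_mul]
  simp only [integral_const, smul_eq_mul, mul_one]
  linarith

variable {n : ℕ} {Ω : Opens (Space n)}

instance instLocallyCompactSpaceOpens : LocallyCompactSpace Ω := Ω.isOpen.locallyCompactSpace

/-- The total variation of a measure is attained, up to `ε`, on fields bounded by one. -/
lemma exists_zeroAtInfty_le_integral (p : VectorMeasure Ω (SymMat n)) {ε : ℝ} (hε : 0 < ε) :
    ∃ φ : C₀(Ω, SymMat n), ‖φ‖ ≤ 1 ∧ p.variation.real univ - ε ≤ ∫ᵛ x, φ x ∂[innerSL ℝ; p] := by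
  obtain ⟨h, hcont, hsupp, hb, hle⟩ := exists_hasCompactSupport_le_integral_inner
    (integrable_polarDensity p) (norm_polarDensity p) hε
  refine ⟨⟨⟨h, hcont⟩, hsupp.is_zero_at_infty⟩, ?_, ?_⟩
  · rw [← ZeroAtInftyContinuousMap.norm_toBCF_eq_norm]
    exact (BoundedContinuousFunction.norm_le zero_le_one).2 hb
  · exact hle.trans_eq
      (integral_eq_integral_polarDensity p (innerSL ℝ) hcont.stronglyMeasurable hb).symm

/-- Banach-Steinhaus on `C₀` bounds the norms of the functionals, and testing on nearly optimal unit
fields turns this into a bound on the variations. -/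
lemma exists_variation_le_of_weakStarTendsto {μ : ℕ → VectorMeasure Ω (SymMat n)}
    {μ₀ : VectorMeasure Ω (SymMat n)} (h : WeakStarTendsto Ω μ μ₀) :
    ∃ C : ℝ, ∀ k, (μ k).variation.real univ ≤ C := by
  have hintegrable : ∀ k (φ : C₀(Ω, SymMat n)), Integrable φ (μ k).variation := fun k φ =>
    Integrable.of_bound φ.continuous.aestronglyMeasurable ‖φ‖
      (Eventually.of_forall fun x => by
        rw [← ZeroAtInftyContinuousMap.norm_toBCF_eq_norm]
        exact φ.toBCF.norm_coe_le_norm x)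
  have hle : ∀ k (φ : C₀(Ω, SymMat n)), ‖∫ᵛ x, φ x ∂[innerSL ℝ; μ k]‖
      ≤ (μ k).variation.real univ * ‖φ‖ := by
    intro k φ
    have hb : ∀ x, ‖φ x‖ ≤ ‖φ‖ := fun x => by
      rw [← ZeroAtInftyContinuousMap.norm_toBCF_eq_norm]
      exact φ.toBCF.norm_coe_le_norm x
    have hm : StronglyMeasurable fun x => φ x := φ.continuous.stronglyMeasurable
    rw [integral_eq_integral_polarDensity (μ k) (innerSL ℝ) hm hb]
    refine (norm_integral_le_of_norm_le_const (C := ‖φ‖) ?_).trans_eq (mul_comm _ _)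
    filter_upwards [norm_polarDensity (μ k)] with x hx
    refine (norm_inner_le_norm (𝕜 := ℝ) (φ x) (polarDensity (μ k) x)).trans ?_
    rw [hx, mul_one]
    exact hb x
  let T : ℕ → C₀(Ω, SymMat n) →L[ℝ] ℝ := fun k => LinearMap.mkContinuous
    { toFun := fun φ => ∫ᵛ x, φ x ∂[innerSL ℝ; μ k]
      map_add' := fun φ ψ => VectorMeasure.integral_fun_add (hintegrable k φ) (hintegrable k ψ)
      map_smul' := fun c φ => VectorMeasure.integral_fun_smul _ _ c φ }
    ((μ k).variation.real univ) (hle k)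
  obtain ⟨C, hC⟩ := banach_steinhaus (g := T) fun φ => by
    obtain ⟨C, hC⟩ := (h φ).norm.bddAbove_range
    exact ⟨C, fun k => hC ⟨k, rfl⟩⟩
  refine ⟨C, fun k => le_of_forall_pos_le_add fun ε hε => ?_⟩
  obtain ⟨φ, hφ, hle⟩ := exists_zeroAtInfty_le_integral (μ k) hε
  have h1 : T k φ ≤ C := by
    refine (le_abs_self _).trans (((T k).le_opNorm φ).trans ?_)
    exact (mul_le_of_le_one_right (norm_nonneg _) hφ).trans (hC k)
  have h2 : T k φ = ∫ᵛ x, φ x ∂[innerSL ℝ; μ k] := rfl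
  linarith

end Bound

/-! ### Transfer between `Ω` and the whole space. -/

section ZeroExtension

variable {n : ℕ} {Ω : Opens (Space n)} {F : Type*}

/-- The extension by zero of a function on `Ω` to the whole space. -/
def zeroExt [Zero F] (f : Ω → F) : Space n → F := Function.extend Subtype.val f 0

@[simp] lemma zeroExt_coe [Zero F] (f : Ω → F) (x : Ω) : zeroExt f x = f x :=
  Subtype.val_injective.extend_apply _ _ _

lemma zeroExt_of_notMem [Zero F] (f : Ω → F) {x : Space n} (hx : x ∉ Ω) : zeroExt f x = 0 :=
  Function.extend_apply' _ _ _ fun ⟨y, hy⟩ => hx (hy ▸ y.2)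

lemma measurableEmbedding_coe : MeasurableEmbedding (Subtype.val : Ω → Space n) :=
  MeasurableEmbedding.subtype_coe Ω.isOpen.measurableSet

lemma map_coe_volume :
    (volume : Measure Ω).map Subtype.val = (volume : Measure (Space n)).restrict Ω :=
  map_comap_subtype_coe Ω.isOpen.measurableSet _

lemma ae_coe_iff {P : Space n → Prop} : (∀ᵐ x : Ω, P x) ↔ ∀ᵐ x : Space n, x ∈ Ω → P x := by
  rw [← measurableEmbedding_coe.ae_map_iff, map_coe_volume,
    ae_restrict_iff' Ω.isOpen.measurableSet]
  rfl

lemma lintegral_coe {f : Space n → ℝ≥0∞} (hf : ∀ x, x ∉ Ω → f x = 0) :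
    ∫⁻ x : Ω, f x = ∫⁻ x, f x := by
  rw [← measurableEmbedding_coe.lintegral_map, map_coe_volume]
  refine setLIntegral_eq_of_support_subset fun x hx => ?_
  by_contra h
  exact hx (hf x h)

lemma integral_coe [NormedAddCommGroup F] [NormedSpace ℝ F] {f : Space n → F}
    (hf : ∀ x, x ∉ Ω → f x = 0) : ∫ x : Ω, f x = ∫ x, f x := by
  rw [← measurableEmbedding_coe.integral_map, map_coe_volume]
  exact setIntegral_eq_integral_of_forall_compl_eq_zero hf

lemma aestronglyMeasurable_zeroExt [NormedAddCommGroup F] {f : Ω → F}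
    (hf : AEStronglyMeasurable f) : AEStronglyMeasurable (zeroExt f) := by
  have h1 : AEStronglyMeasurable (zeroExt f) ((volume : Measure (Space n)).restrict Ω) := by
    rw [← map_coe_volume, measurableEmbedding_coe.aestronglyMeasurable_map_iff]
    exact hf.congr (Eventually.of_forall fun x => (zeroExt_coe f x).symm)
  rw [← aestronglyMeasurable_indicator_iff Ω.isOpen.measurableSet] at h1
  refine h1.congr (Eventually.of_forall fun x => ?_)
  by_cases hx : x ∈ (Ω : Set (Space n))
  · simp [hx]
  · simp [hx, zeroExt_of_notMem f hx]

lemma integrable_zeroExt [NormedAddCommGroup F] {f : Ω → F} (hf : Integrable f) :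
    Integrable (zeroExt f) := by
  refine ⟨aestronglyMeasurable_zeroExt hf.1, ?_⟩
  have : ∫⁻ x : Ω, ‖zeroExt f x‖ₑ = ∫⁻ x, ‖zeroExt f x‖ₑ :=
    lintegral_coe (f := fun x => ‖zeroExt f x‖ₑ) fun x hx => by simp [zeroExt_of_notMem f hx]
  rw [HasFiniteIntegral, ← this]
  simpa [HasFiniteIntegral] using hf.2

lemma integrable_coe_iff [NormedAddCommGroup F] {f : Space n → F}
    (hf : ∀ x, x ∉ Ω → f x = 0) : Integrable (fun x : Ω => f x) ↔ Integrable f := by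
  have h := (measurableEmbedding_coe (Ω := Ω)).integrable_map_iff (μ := volume) (g := f)
  rw [map_coe_volume] at h
  exact h.symm.trans (integrableOn_iff_integrable_of_support_subset fun x hx => by
    by_contra h'
    exact hx (hf x h'))

lemma volume_opens_lt_top (hΩ : Bornology.IsBounded (Ω : Set (Space n))) :
    volume (univ : Set Ω) < ⊤ := by
  have h := measurableEmbedding_coe.map_apply (μ := (volume : Measure Ω)) univ
  rw [map_coe_volume] at h
  rw [preimage_univ] at h
  rw [← h, Measure.restrict_apply_univ]
  exact hΩ.measure_lt_top

end ZeroExtension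

/-! ### Weak gradients of test functions. -/

section Capacity

variable {n : ℕ} {Ω : Opens (Space n)}

lemma fderiv_eq_sum_partialDeriv (φ : Space n → ℝ) (x ξ : Space n) :
    fderiv ℝ φ x ξ = ∑ j, ξ j * partialDeriv φ j x := by
  have hb : ξ = ∑ j, ξ j • EuclideanSpace.single j (1 : ℝ) := by
    ext k
    simp [Pi.single_apply]
  conv_lhs => rw [hb, map_sum]
  exact Finset.sum_congr rfl fun j _ => by rw [map_smul, smul_eq_mul]; rfl

/-- The weak gradient of a test function is its classical gradient. -/
lemma partialDeriv_eq_of_isWeakGradient {a : Ω → ℝ} {g : Ω → Space n}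
    (hg : Integrable g) (h : IsWeakGradient Ω a g) {φ : Space n → ℝ} (hφ : ContDiff ℝ ∞ φ)
    (hφc : HasCompactSupport φ) (ha : ∀ᵐ x : Ω, a x = φ x) (i : Fin n) :
    ∀ᵐ x : Ω, g x i = partialDeriv φ i x := by
  have hpd : Continuous (partialDeriv φ i) :=
    (hφ.continuous_fderiv (by simp)).clm_apply continuous_const
  have hloc : LocallyIntegrableOn (fun x : Space n => zeroExt g x i - partialDeriv φ i x) Ω := by
    refine LocallyIntegrableOn.sub ?_ (hpd.locallyIntegrable.locallyIntegrableOn _)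
    exact ((EuclideanSpace.proj (𝕜 := ℝ) i).integrable_comp
      (integrable_zeroExt hg)).locallyIntegrable.locallyIntegrableOn _
  have key := Ω.isOpen.ae_eq_zero_of_integral_contDiff_smul_eq_zero hloc ?_
  · replace key := ae_coe_iff.2 key
    filter_upwards [key] with x hx
    simpa [sub_eq_zero] using hx
  · intro ψ hψ hψc hψΩ
    have hzero : ∀ x, x ∉ Ω → ψ x • (zeroExt g x i - partialDeriv φ i x) = 0 := fun x hx => by
      rw [image_eq_zero_of_notMem_tsupport fun hx' => hx (hψΩ hx'), zero_smul]
    rw [← integral_coe (Ω := Ω) hzero]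
    simp only [zeroExt_coe, smul_eq_mul, mul_sub]
    have hpsi := hψ.continuous
    have h1 := h ⟨ψ, hψ, hψc, hψΩ⟩ i
    have h2 : ∫ x : Ω, a x * partialDeriv ψ i x = ∫ x : Ω, φ x * partialDeriv ψ i x :=
      integral_congr_ae (by filter_upwards [ha] with x hx; rw [hx])
    have hz : ∀ x, x ∉ Ω → partialDeriv ψ i x = 0 := fun x hx => by
      have : x ∉ tsupport (partialDeriv ψ i) := fun h' =>
        hx (hψΩ (tsupport_fderiv_apply_subset ℝ _ h'))
      exact image_eq_zero_of_notMem_tsupport this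
    have h3 : ∫ x : Ω, φ x * partialDeriv ψ i x = ∫ x, φ x * partialDeriv ψ i x :=
      integral_coe (f := fun x => φ x * partialDeriv ψ i x) fun x hx => by simp [hz x hx]
    have h4 : ∫ x : Ω, partialDeriv φ i x * ψ x = ∫ x, partialDeriv φ i x * ψ x :=
      integral_coe (f := fun x => partialDeriv φ i x * ψ x) fun x hx => by
        simp [image_eq_zero_of_notMem_tsupport fun hx' => hx (hψΩ hx')]
    have h5 : ∫ x, φ x * partialDeriv ψ i x = - ∫ x, partialDeriv φ i x * ψ x := by
      refine integral_mul_fderiv_eq_neg_fderiv_mul_of_integrable ?_ ?_ ?_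
        (fun x _ => hφ.differentiable (by simp) x) (fun x _ => hψ.differentiable (by simp) x)
      · exact (hpd.mul hpsi).integrable_of_hasCompactSupport hψc.mul_left
      · exact (hφ.continuous.mul ((hψ.continuous_fderiv (by simp)).clm_apply
          continuous_const)).integrable_of_hasCompactSupport hφc.mul_right
      · exact (hφ.continuous.mul hpsi).integrable_of_hasCompactSupport hφc.mul_right
    have hint1 : Integrable fun x : Ω => ψ x * g x i := by
      obtain ⟨C, hC⟩ := hψc.exists_bound_of_continuous hpsi
      exact ((EuclideanSpace.proj (𝕜 := ℝ) i).integrable_comp hg).bdd_mul (c := C)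
        (hpsi.comp continuous_subtype_val).aestronglyMeasurable
        (Eventually.of_forall fun x : Ω => hC x)
    have hint2 : Integrable fun x : Ω => ψ x * partialDeriv φ i x :=
      (integrable_coe_iff (f := fun x => ψ x * partialDeriv φ i x) fun x hx => by
        simp [image_eq_zero_of_notMem_tsupport fun hx' => hx (hψΩ hx')]).2
        ((hpsi.mul hpd).integrable_of_hasCompactSupport hψc.mul_right)
    rw [integral_sub hint1 hint2]
    have h6 : ∫ x : Ω, ψ x * g x i = ∫ x : Ω, g x i * ψ x := by simp only [mul_comm]
    have h7 : ∫ x : Ω, ψ x * partialDeriv φ i x = ∫ x : Ω, partialDeriv φ i x * ψ x := by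
      simp only [mul_comm]
    have h1' : ∫ x : Ω, a x * partialDeriv ψ i x = - ∫ x : Ω, g x i * ψ x := h1
    linarith

end Capacity

/-! ### Capacity and lines: quasicontinuous functions are continuous on almost every line. -/

section CapacityLines

variable {n : ℕ} {Ω : Opens (Space n)}

/-- The approximants in `sobolevZero` come as pairs whose first entry is only almost everywhere a
test function; this controls the classical derivative of that test function by the second entry. -/
lemma lintegral_fderiv_le_of_isWeakGradient {a : Ω → ℝ} {g : Ω → Space n}
    (hg : Integrable g) (h : IsWeakGradient Ω a g) {φ : Space n → ℝ} (hφ : ContDiff ℝ ∞ φ)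
    (hφc : HasCompactSupport φ) (hφΩ : tsupport φ ⊆ Ω) (ha : ∀ᵐ x : Ω, a x = φ x) (ξ : Space n) :
    ∫⁻ x, ‖fderiv ℝ φ x ξ‖ₑ ≤ ‖ξ‖ₑ * ∫⁻ x : Ω, ‖g x‖ₑ := by
  have hae : ∀ᵐ x : Ω, ∀ i, g x i = partialDeriv φ i x :=
    ae_all_iff.2 fun i => partialDeriv_eq_of_isWeakGradient hg h hφ hφc ha i
  rw [← lintegral_coe (Ω := Ω) (f := fun x => ‖fderiv ℝ φ x ξ‖ₑ) fun x hx => ?_,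
    ← lintegral_const_mul' _ _ (by simp)]
  · refine lintegral_mono_ae ?_
    filter_upwards [hae] with x hx
    have : fderiv ℝ φ x ξ = inner ℝ (g x) ξ := by
      rw [fderiv_eq_sum_partialDeriv, PiLp.inner_apply]
      exact Finset.sum_congr rfl fun j _ => by simp [hx j]
    rw [this, ← ofReal_norm, ← ofReal_norm, ← ofReal_norm,
      ← ENNReal.ofReal_mul (norm_nonneg _), mul_comm]
    exact ENNReal.ofReal_le_ofReal (norm_inner_le_norm _ _)
  · have : x ∉ tsupport (fderiv ℝ φ · ξ) := fun h' =>
      hx (hφΩ (tsupport_fderiv_apply_subset ℝ _ h'))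
    simp [image_eq_zero_of_notMem_tsupport this]

set_option maxHeartbeats 1000000 in
/-- A set of small capacity meets few lines of a given direction. -/
lemma volume_lines_le_of_capacity_lt {q : ℝ≥0∞} [hq : Fact (1 ≤ q)] (hq' : q ≠ ⊤) {R : ℝ}
    (hΩ : (Ω : Set (Space n)) ⊆ Metric.closedBall 0 R) {A : Set Ω} {ε : ℝ≥0∞}
    (hA : capacity Ω q A < ε) {ξ : Space n} (hξ : ξ ≠ 0) (r : ℝ) :
    volume (Metric.closedBall 0 r ∩ {x | ∃ t : ℝ, ∃ y ∈ A, x + t • ξ = y}) ≤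
      ENNReal.ofReal (2 * ((R + r) / ‖ξ‖)) * (‖ξ‖ₑ *
        (ε ^ (1 / q.toReal) * volume (univ : Set Ω) ^ (1 - 1 / q.toReal))) := by
  have hbdd : Bornology.IsBounded (Ω : Set (Space n)) := Metric.isBounded_closedBall.subset hΩ
  have hfin : IsFiniteMeasure (volume : Measure Ω) := ⟨volume_opens_lt_top hbdd⟩
  have hq0 : q ≠ 0 := (zero_lt_one.trans_le hq.out).ne'
  have hqr : 0 < q.toReal := ENNReal.toReal_pos hq0 hq'
  simp only [capacity, iInf_lt_iff] at hA
  obtain ⟨v, ⟨hv0, U, hU, hAU, hvU⟩, hvε⟩ := hA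
  obtain ⟨w, hw, hwv⟩ := mem_closure_iff_seq_limit.1 hv0
  choose φ hφ using hw
  have hw1 : Tendsto (fun k => (w k).1.1) atTop (𝓝 v.1.1) :=
    ((continuous_fst.comp continuous_subtype_val).tendsto v).comp hwv
  have hw2 : Tendsto (fun k => (w k).1.2) atTop (𝓝 v.1.2) :=
    ((continuous_snd.comp continuous_subtype_val).tendsto v).comp hwv
  obtain ⟨s, hs, hsae⟩ := (tendstoInMeasure_of_tendsto_Lp hw1).exists_seq_tendsto_ae
  have hvnorm : ‖v.1.2‖ₑ < ε ^ (1 / q.toReal) := by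
    rw [Lp.enorm_def, eLpNorm_eq_lintegral_rpow_enorm_toReal hq0 hq']
    exact ENNReal.rpow_lt_rpow hvε (by positivity)
  have hev : ∀ᶠ k in atTop, ‖(w (s k)).1.2‖ₑ < ε ^ (1 / q.toReal) :=
    ((hw2.comp hs.tendsto_atTop).enorm).eventually (gt_mem_nhds hvnorm)
  -- This total variation along the line dominates every value of the test function there. Its
  -- integral over a ball is controlled by the `L^q` norm of the gradient, which is eventually below
  -- `ε ^ (1 / q)`.
  set G : ℕ → Space n → ℝ≥0∞ := fun k x => ∫⁻ t : ℝ, ‖fderiv ℝ (φ (s k)) (x + t • ξ) ξ‖ₑ with hG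
  have hmeas : ∀ k, Measurable fun x => ‖fderiv ℝ (φ (s k)) x ξ‖ₑ := fun k =>
    (((φ (s k)).contDiff.continuous_fderiv (by simp)).clm_apply continuous_const).enorm.measurable
  have hGm : ∀ k, Measurable (G k) := fun k => measurable_lintegral_line (hmeas k) ξ
  have hzero : ∀ k x, R < ‖x‖ → ‖fderiv ℝ (φ (s k)) x ξ‖ₑ = 0 := by
    intro k x hx
    have : x ∉ tsupport (fderiv ℝ (φ (s k)) · ξ) := fun h' => by
      have h1 := hΩ ((φ (s k)).tsupport_subset (tsupport_fderiv_apply_subset ℝ _ h'))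
      rw [mem_closedBall_zero_iff] at h1
      linarith
    simp [image_eq_zero_of_notMem_tsupport this]
  have hbound : ∀ᶠ k in atTop, ∫⁻ x in Metric.closedBall 0 r, G k x ≤
      ENNReal.ofReal (2 * ((R + r) / ‖ξ‖)) * (‖ξ‖ₑ *
        (ε ^ (1 / q.toReal) * volume (univ : Set Ω) ^ (1 - 1 / q.toReal))) := by
    filter_upwards [hev] with k hk
    refine (setLIntegral_line_le (hmeas k) (hzero k) hξ).trans ?_
    gcongr
    have hmem := Lp.memLp (w (s k)).1.2
    refine (lintegral_fderiv_le_of_isWeakGradient (hmem.integrable hq.out)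
      (w (s k)).2 (φ (s k)).contDiff (φ (s k)).hasCompactSupport (φ (s k)).tsupport_subset
      (hφ (s k)) ξ).trans ?_
    gcongr
    rw [← eLpNorm_one_eq_lintegral_enorm]
    refine (eLpNorm_le_eLpNorm_mul_rpow_measure_univ hq.out hmem.1).trans ?_
    rw [← Lp.enorm_def]
    simp only [ENNReal.toReal_one, ne_eq, one_ne_zero, not_false_eq_true, div_self]
    gcongr
  have hone : ∀ᵐ x, x ∈ {x | ∃ t : ℝ, ∃ y ∈ A, x + t • ξ = y} →
      1 ≤ liminf (fun k => G k x) atTop := by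
    have h1 : ∀ᵐ x : Ω, x ∈ U → ∃ c : ℝ, 1 ≤ c ∧ Tendsto (fun k => φ (s k) x) atTop (𝓝 c) := by
      filter_upwards [hsae, hvU, ae_all_iff.2 hφ] with x hx hxU hxφ hU
      exact ⟨_, hxU hU, by simpa only [hxφ] using hx⟩
    obtain ⟨W, hW, hWU⟩ := isOpen_induced_iff.1 hU
    have h2 : ∀ᵐ x : Space n, x ∈ Ω → x ∈ W →
        ∃ c : ℝ, 1 ≤ c ∧ Tendsto (fun k => φ (s k) x) atTop (𝓝 c) := by
      refine ae_coe_iff.1 ?_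
      filter_upwards [h1] with x hx hxW
      exact hx (by rw [← hWU]; exact hxW)
    filter_upwards [ae_ae_line h2 ξ] with x hx
    rintro ⟨t, y, hy, hty⟩
    -- A line that meets `A` stays in the open neighbourhood for an open set of parameters. This has
    -- positive length and so contains a parameter at which the approximants converge to a value at
    -- least `1`. This is why capacity is defined with a neighbourhood of `A`.
    have hopen : IsOpen {t : ℝ | x + t • ξ ∈ (Ω : Set (Space n)) ∩ W} :=
      (Ω.isOpen.inter hW).preimage (by fun_prop)
    have hne : {t : ℝ | x + t • ξ ∈ (Ω : Set (Space n)) ∩ W}.Nonempty := by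
      refine ⟨t, ?_⟩
      change x + t • ξ ∈ (Ω : Set (Space n)) ∩ W
      rw [hty]
      refine ⟨y.2, ?_⟩
      have := hAU hy
      rw [← hWU] at this
      exact this
    have hpos := hopen.measure_pos volume hne
    obtain ⟨τ, hτ, hτP⟩ : ∃ τ ∈ {t : ℝ | x + t • ξ ∈ (Ω : Set (Space n)) ∩ W},
        ∃ c : ℝ, 1 ≤ c ∧ Tendsto (fun k => φ (s k) (x + τ • ξ)) atTop (𝓝 c) := by
      by_contra! hcon
      refine hpos.ne' (measure_mono_null (fun τ hτ => ?_) hx)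
      intro hcc
      obtain ⟨c, hc, hct⟩ := hcc hτ.1 hτ.2
      exact hcon τ hτ c hc hct
    obtain ⟨c, hc, hlim⟩ := hτP
    have hle : ∀ k, ‖φ (s k) (x + τ • ξ)‖ₑ ≤ G k x := by
      intro k
      refine (enorm_le_lintegral_line ((φ (s k)).contDiff.of_le (by simp))
        (φ (s k)).hasCompactSupport hξ _).trans_eq ?_
      have := lintegral_add_left_eq_self (μ := (volume : Measure ℝ))
        (fun t => ‖fderiv ℝ (φ (s k)) (x + t • ξ) ξ‖ₑ) τ
      simpa only [add_smul, add_assoc] using this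
    calc (1 : ℝ≥0∞) ≤ ‖c‖ₑ := by
          rw [← ofReal_norm]
          exact ENNReal.one_le_ofReal.2 (hc.trans (le_abs_self c))
      _ = liminf (fun k => ‖φ (s k) (x + τ • ξ)‖ₑ) atTop := hlim.enorm.liminf_eq.symm
      _ ≤ _ := liminf_le_liminf (Eventually.of_forall hle)
  set S : Set (Space n) := {x | ∃ t : ℝ, ∃ y ∈ A, x + t • ξ = y} with hS
  set L : Space n → ℝ≥0∞ := fun x => liminf (fun k => G k x) atTop with hL
  have hLm : Measurable L := Measurable.liminf hGm
  calc volume (Metric.closedBall 0 r ∩ S)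
      ≤ volume (Metric.closedBall 0 r ∩ {x | 1 ≤ L x}) := by
        refine measure_mono_ae ?_
        filter_upwards [hone] with x hx
        exact fun hx' => ⟨hx'.1, hx hx'.2⟩
    _ = ∫⁻ x in Metric.closedBall 0 r, {x | 1 ≤ L x}.indicator (fun _ => 1) x := by
        rw [lintegral_indicator_const (measurableSet_le measurable_const hLm), one_mul,
          Measure.restrict_apply (measurableSet_le measurable_const hLm), inter_comm]
    _ ≤ ∫⁻ x in Metric.closedBall 0 r, L x := by
        refine lintegral_mono fun x => ?_
        by_cases hx : x ∈ {x | 1 ≤ L x}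
        · rw [indicator_of_mem hx]
          exact hx
        · rw [indicator_of_notMem hx]
          exact zero_le
    _ ≤ liminf (fun k => ∫⁻ x in Metric.closedBall 0 r, G k x) atTop := lintegral_liminf_le hGm
    _ ≤ _ := by
        refine (liminf_le_liminf hbound).trans_eq ?_
        simp

/-- A quasicontinuous function is continuous along almost every line of a given direction. -/
lemma IsQuasicontinuous.ae_continuousOn_line {q : ℝ≥0∞} [hq : Fact (1 ≤ q)] (hq' : q ≠ ⊤)
    (hΩ : Bornology.IsBounded (Ω : Set (Space n))) {a : Ω → ℝ} (ha : IsQuasicontinuous Ω q a)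
    {ξ : Space n} (hξ : ξ ≠ 0) :
    ∀ᵐ x, ContinuousOn (fun t : ℝ => zeroExt a (x + t • ξ)) {t | x + t • ξ ∈ Ω} := by
  obtain ⟨R, hR⟩ := hΩ.subset_closedBall 0
  have hq0 : q ≠ 0 := (zero_lt_one.trans_le hq.out).ne'
  have hqr : 0 < q.toReal := ENNReal.toReal_pos hq0 hq'
  -- A line that avoids the exceptional set `A` stays, inside `Ω`, where `a` is continuous.
  have hcont : ∀ (A : Set Ω), ContinuousOn a Aᶜ → ∀ x, x ∉ {x | ∃ t : ℝ, ∃ y ∈ A, x + t • ξ = y} →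
      ContinuousOn (fun t : ℝ => zeroExt a (x + t • ξ)) {t | x + t • ξ ∈ Ω} := by
    intro A hA x hx
    rw [continuousOn_iff_continuous_domRestrict] at hA ⊢
    let T : {t : ℝ | x + t • ξ ∈ Ω} → (Aᶜ : Set Ω) := fun t =>
      ⟨⟨x + t.1 • ξ, t.2⟩, fun h => hx ⟨t.1, _, h, rfl⟩⟩
    have hT : Continuous T := by
      refine Continuous.subtype_mk (Continuous.subtype_mk ?_ _) _
      fun_prop
    convert hA.comp hT using 1
    ext t
    exact zeroExt_coe a ⟨x + t.1 • ξ, t.2⟩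
  have hr : ∀ r : ℕ, ∀ᵐ x, x ∈ Metric.closedBall (0 : Space n) r →
      ContinuousOn (fun t : ℝ => zeroExt a (x + t • ξ)) {t | x + t • ξ ∈ Ω} := by
    intro r
    set C : ℝ≥0∞ := ENNReal.ofReal (2 * ((R + r) / ‖ξ‖)) * (‖ξ‖ₑ *
        volume (univ : Set Ω) ^ (1 - 1 / q.toReal)) with hC
    have hCtop : C ≠ ⊤ := by
      refine ENNReal.mul_ne_top ENNReal.ofReal_ne_top (ENNReal.mul_ne_top (by simp) ?_)
      refine ENNReal.rpow_ne_top_of_nonneg ?_ (volume_opens_lt_top hΩ).ne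
      rw [sub_nonneg, div_le_one hqr]
      have := ENNReal.toReal_mono hq' hq.out
      simpa using this
    rw [ae_iff]
    refine le_antisymm (ENNReal.le_of_forall_pos_le_add fun δ hδ _ => ?_) zero_le
    rw [zero_add]
    have hlim : Tendsto (fun ε : ℝ≥0∞ => C * ε ^ (1 / q.toReal)) (𝓝[>] 0) (𝓝 0) := by
      have h1 : Tendsto (fun ε : ℝ≥0∞ => ε ^ (1 / q.toReal)) (𝓝[>] 0) (𝓝 0) := by
        have := (ENNReal.continuous_rpow_const (y := 1 / q.toReal)).tendsto 0
        rw [ENNReal.zero_rpow_of_pos (by positivity)] at this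
        exact this.mono_left nhdsWithin_le_nhds
      have := ENNReal.Tendsto.const_mul (a := C) h1 (Or.inr hCtop)
      simpa using this
    obtain ⟨ε, hε, hε0⟩ := ((hlim.eventually (gt_mem_nhds
      (show (0 : ℝ≥0∞) < δ by exact_mod_cast hδ))).and self_mem_nhdsWithin).exists
    obtain ⟨A, hA, hAc⟩ := ha ε hε0
    calc _ ≤ volume (Metric.closedBall 0 (r : ℝ) ∩ {x | ∃ t : ℝ, ∃ y ∈ A, x + t • ξ = y}) := by
          refine measure_mono fun x hx => ?_
          have hx' := Classical.not_imp.1 hx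
          exact ⟨hx'.1, by_contra fun h => hx'.2 (hcont A hAc x h)⟩
      _ ≤ _ := volume_lines_le_of_capacity_lt hq' hR hA hξ r
      _ = C * ε ^ (1 / q.toReal) := by rw [hC]; ring
      _ ≤ δ := hε.le
  filter_upwards [ae_all_iff.2 hr] with x hx
  obtain ⟨r, hr⟩ := exists_nat_ge ‖x‖
  exact hx r (by simpa using hr)

end CapacityLines

/-! ### Vanishing on thin sets in the presence of a second measure. -/

section ThinSets

variable {E : Type*} [NormedAddCommGroup E] [InnerProductSpace ℝ E] [FiniteDimensional ℝ E]
  [MeasurableSpace E] [BorelSpace E]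

lemma LineNull.ae_notMem {ξ : E} {N : Set E} (h : LineNull ξ N) : ∀ᵐ x, x ∉ N := by
  filter_upwards [lineNull_iff.1 h] with x hx
  simpa using hx 0

/-- Both measures are written as densities with respect to their sum. On `N` the second density
vanishes because `m'` does not charge `N`, so the vanishing of the total density on `N` is that of
`D`. In the applications `m` is the variation of the plastic strain and `m'` is Lebesgue measure
carrying the elastic one. -/
lemma ae_eq_zero_of_lineNull_add {X : Type*} [MeasurableSpace X] {m m' : Measure X}
    [IsFiniteMeasure m] [IsFiniteMeasure m'] {ι : X → E} (hι : MeasurableEmbedding ι)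
    {D D' : X → ℝ} (hD : Integrable D m) (hD' : Integrable D' m') {u : E → ℝ} (hu : Integrable u)
    {Ω : Set E} (hΩ : IsOpen Ω) {ξ : E} (hξ : ξ ≠ 0)
    (h : ∀ φ : E → ℝ, ContDiff ℝ ∞ φ → HasCompactSupport φ → tsupport φ ⊆ Ω →
      ∫ x, φ (ι x) * D x ∂m + ∫ x, φ (ι x) * D' x ∂m' = - ∫ x, u x * fderiv ℝ φ x ξ)
    {N : Set E} (hN : LineNull ξ N) (hN' : ∀ᵐ x ∂m', ι x ∉ N) :
    ∀ᵐ x ∂m, ι x ∈ Ω → ι x ∈ N → D x = 0 := by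
  set M := m + m'
  have hm : m ≪ M := Measure.absolutelyContinuous_of_le (Measure.le_add_right le_rfl)
  have hm' : m' ≪ M := Measure.absolutelyContinuous_of_le (Measure.le_add_left le_rfl)
  set r : X → ℝ := fun x => (m.rnDeriv M x).toReal
  set r' : X → ℝ := fun x => (m'.rnDeriv M x).toReal
  have hi : Integrable (fun x => r x * D x) M := (integrable_rnDeriv_smul_iff hm).2 hD
  have hi' : Integrable (fun x => r' x * D' x) M := (integrable_rnDeriv_smul_iff hm').2 hD'
  have key := ae_eq_zero_of_lineNull hι (hi.add hi') hu hΩ hξ (fun φ hφ hφc hφΩ => ?_) hN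
  · have h1 : ∀ᵐ x ∂M, m'.rnDeriv M x ≠ 0 → ι x ∉ N := by
      rw [← ae_withDensity_iff (Measure.measurable_rnDeriv _ _),
        Measure.withDensity_rnDeriv_eq _ _ hm']
      exact hN'
    filter_upwards [hm.ae_le key, hm.ae_le h1, Measure.rnDeriv_pos hm,
      hm.ae_le (Measure.rnDeriv_lt_top m M)] with x hx hx1 hpos hlt
    intro hxΩ hxN
    have h2 : m'.rnDeriv M x = 0 := by_contra fun h => hx1 h hxN
    have h3 := hx hxΩ hxN
    simp only [Pi.add_apply, r', h2, ENNReal.toReal_zero, zero_mul, add_zero, mul_eq_zero] at h3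
    exact h3.resolve_left (ENNReal.toReal_pos hpos.ne' hlt.ne).ne'
  · obtain ⟨C, hC⟩ := hφc.exists_bound_of_continuous hφ.continuous
    have hφm : Measurable fun x => φ (ι x) := hφ.continuous.measurable.comp hι.measurable
    have hb : ∀ {f : X → ℝ}, Integrable f M → Integrable (fun x => φ (ι x) * f x) M := fun hf =>
      hf.bdd_mul (c := C) hφm.aestronglyMeasurable (Eventually.of_forall fun x => hC _)
    rw [← h φ hφ hφc hφΩ, ← integral_rnDeriv_smul hm, ← integral_rnDeriv_smul hm',
      ← integral_add]
    · refine integral_congr_ae (Eventually.of_forall fun x => ?_)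
      simp only [Pi.add_apply, smul_eq_mul, r, r']
      ring
    · refine (hb hi).congr (Eventually.of_forall fun x => ?_)
      simp only [smul_eq_mul, r]
      ring
    · refine (hb hi').congr (Eventually.of_forall fun x => ?_)
      simp only [smul_eq_mul, r']
      ring

end ThinSets

/-! ### Cut-offs of Sobolev functions on `Ω`. -/

section Cutoff

variable {n : ℕ} {Ω : Opens (Space n)}

lemma IsWeakGradient.integral_fderiv {a : Ω → ℝ} {g : Ω → Space n} (ha : Integrable a)
    (hg : Integrable g) (h : IsWeakGradient Ω a g) {φ : Space n → ℝ} (hφ : ContDiff ℝ ∞ φ)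
    (hφc : HasCompactSupport φ) (hφΩ : tsupport φ ⊆ Ω) (ξ : Space n) :
    ∫ x : Ω, a x * fderiv ℝ φ x ξ = - ∫ x : Ω, inner ℝ (g x) ξ * φ x := by
  have hpd : ∀ i, Continuous (partialDeriv φ i) := fun i =>
    (hφ.continuous_fderiv (by simp)).clm_apply continuous_const
  have hi1 : ∀ i, Integrable fun x : Ω => ξ i * (a x * partialDeriv φ i x) := by
    intro i
    obtain ⟨C, hC⟩ := (hφc.fderiv_apply (𝕜 := ℝ)
      (EuclideanSpace.single i (1 : ℝ))).exists_bound_of_continuous (hpd i)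
    exact (ha.mul_bdd (c := C) ((hpd i).comp continuous_subtype_val).aestronglyMeasurable
      (Eventually.of_forall fun x : Ω => hC x)).const_mul _
  have hi2 : ∀ i, Integrable fun x : Ω => ξ i * (g x i * φ x) := by
    intro i
    obtain ⟨C, hC⟩ := hφc.exists_bound_of_continuous hφ.continuous
    exact (((EuclideanSpace.proj (𝕜 := ℝ) i).integrable_comp hg).mul_bdd (c := C)
      (hφ.continuous.comp continuous_subtype_val).aestronglyMeasurable
      (Eventually.of_forall fun x : Ω => hC x)).const_mul _
  have e1 : ∀ x : Ω, a x * fderiv ℝ φ x ξ = ∑ i, ξ i * (a x * partialDeriv φ i x) := by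
    intro x
    rw [fderiv_eq_sum_partialDeriv, Finset.mul_sum]
    exact Finset.sum_congr rfl fun i _ => by ring
  have e2 : ∀ x : Ω, inner ℝ (g x) ξ * φ x = ∑ i, ξ i * (g x i * φ x) := by
    intro x
    rw [PiLp.inner_apply, Finset.sum_mul]
    refine Finset.sum_congr rfl fun i _ => ?_
    simp
    ring
  simp_rw [e1, e2]
  rw [integral_finsetSum _ fun i _ => hi1 i, integral_finsetSum _ fun i _ => hi2 i,
    ← Finset.sum_neg_distrib]
  refine Finset.sum_congr rfl fun i _ => ?_
  rw [integral_const_mul, integral_const_mul]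
  have := h ⟨φ, hφ, hφc, hφΩ⟩ i
  have h' : ∫ x : Ω, a x * partialDeriv φ i x = - ∫ x : Ω, g x i * φ x := this
  rw [h']
  ring

/-- The product of a Sobolev function and a cut-off function, extended by zero. -/
lemma IsWeakGradient.hasWeakDeriv_cutoff {a : Ω → ℝ} {g : Ω → Space n} (ha : Integrable a)
    (hg : Integrable g) (h : IsWeakGradient Ω a g) {χ : Space n → ℝ} (hχ : ContDiff ℝ ∞ χ)
    (hχc : HasCompactSupport χ) (hχΩ : tsupport χ ⊆ Ω) (ξ : Space n) :
    HasWeakDeriv (fun x => χ x * zeroExt a x)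
      (fun x => χ x * inner ℝ (zeroExt g x) ξ + zeroExt a x * fderiv ℝ χ x ξ) ξ := by
  intro φ hφ hφc
  have hχ0 : ∀ x, x ∉ Ω → χ x = 0 := fun x hx =>
    image_eq_zero_of_notMem_tsupport fun hx' => hx (hχΩ hx')
  rw [← integral_coe (Ω := Ω) (f := fun x => χ x * zeroExt a x * fderiv ℝ φ x ξ)
      (fun x hx => by simp [hχ0 x hx]),
    ← integral_coe (Ω := Ω) (f := fun x => (χ x * inner ℝ (zeroExt g x) ξ
      + zeroExt a x * fderiv ℝ χ x ξ) * φ x)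
      (fun x hx => by simp [hχ0 x hx, zeroExt_of_notMem a hx])]
  simp only [zeroExt_coe]
  have hd : ∀ x, fderiv ℝ (fun x => χ x * φ x) x ξ = χ x * fderiv ℝ φ x ξ
      + φ x * fderiv ℝ χ x ξ := by
    intro x
    rw [fderiv_fun_mul (hχ.differentiable (by simp) x) (hφ.differentiable (by simp) x)]
    simp
  have h1 := h.integral_fderiv ha hg (hχ.mul hφ) hχc.mul_right
    ((tsupport_mul_subset_left).trans hχΩ) ξ
  simp only [hd] at h1
  obtain ⟨C₁, hC₁⟩ := hχc.exists_bound_of_continuous hχ.continuous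
  have hbint : ∀ {b : Ω → ℝ} {ψ : Space n → ℝ}, Integrable b → Continuous ψ →
      HasCompactSupport ψ → Integrable fun x : Ω => b x * ψ x := by
    intro b ψ hb hψ hψc
    obtain ⟨C, hC⟩ := hψc.exists_bound_of_continuous hψ
    exact hb.mul_bdd (c := C) (hψ.comp continuous_subtype_val).aestronglyMeasurable
      (Eventually.of_forall fun x : Ω => hC x)
  have hcφ : Continuous fun x => fderiv ℝ φ x ξ :=
    (hφ.continuous_fderiv (by simp)).clm_apply continuous_const
  have hcχ : Continuous fun x => fderiv ℝ χ x ξ :=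
    (hχ.continuous_fderiv (by simp)).clm_apply continuous_const
  have i1 : Integrable fun x : Ω => a x * (χ x * fderiv ℝ φ x ξ) :=
    hbint ha (hχ.continuous.mul hcφ) hχc.mul_right
  have i2 : Integrable fun x : Ω => a x * (φ x * fderiv ℝ χ x ξ) :=
    hbint ha (hφ.continuous.mul hcχ) hφc.mul_right
  have i3 : Integrable fun x : Ω => inner ℝ (g x) ξ * (χ x * φ x) :=
    hbint (hg.inner_const ξ) (hχ.continuous.mul hφ.continuous) hχc.mul_right
  have e1 : ∫ x : Ω, a x * (χ x * fderiv ℝ φ x ξ + φ x * fderiv ℝ χ x ξ)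
      = (∫ x : Ω, χ x * a x * fderiv ℝ φ x ξ) + ∫ x : Ω, a x * (φ x * fderiv ℝ χ x ξ) := by
    simp only [mul_add]
    rw [integral_add i1 i2]
    congr 1
    refine integral_congr_ae (Eventually.of_forall fun x => ?_)
    simp only
    ring
  have e2 : ∫ x : Ω, (χ x * inner ℝ (g x) ξ + a x * fderiv ℝ χ x ξ) * φ x
      = (∫ x : Ω, inner ℝ (g x) ξ * (χ x * φ x)) + ∫ x : Ω, a x * (φ x * fderiv ℝ χ x ξ) := by
    rw [← integral_add i3 i2]
    refine integral_congr_ae (Eventually.of_forall fun x => ?_)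
    simp only
    ring
  rw [e1] at h1
  rw [e2]
  linarith

end Cutoff

/-! ### Limits of triple products with conjugate exponents. -/

section ProductLimit

variable {X : Type*} [MeasurableSpace X] {μ : Measure X} {p q : ℝ≥0∞}

/-- Hölder replaces `G' j` by its strong limit at small cost, since `W` lies in the dual exponent
and `b j` is bounded; dominated convergence then treats `b j`. -/
lemma tendsto_integral_mul_mul_of_tendsto_eLpNorm [ENNReal.HolderConjugate p q]
    {W G : X → ℝ} {b G' : ℕ → X → ℝ} {b₀ : X → ℝ}
    (hW : MemLp W p μ) (hG : MemLp G q μ) (hG' : ∀ j, AEStronglyMeasurable (G' j) μ)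
    (hb : ∀ j, AEStronglyMeasurable (b j) μ) {C : ℝ} (hbC : ∀ j x, ‖b j x‖ ≤ C)
    (hlim : ∀ᵐ x ∂μ, Tendsto (fun j => b j x) atTop (𝓝 (b₀ x)))
    (hGlim : Tendsto (fun j => eLpNorm (fun x => G' j x - G x) q μ) atTop (𝓝 0)) :
    Tendsto (fun j => ∫ x, W x * b j x * G' j x ∂μ) atTop (𝓝 (∫ x, W x * b₀ x * G x ∂μ)) := by
  have hWG : Integrable (fun x => W x * G x) μ := hW.integrable_mul hG
  have h1 : Tendsto (fun j => ∫ x, W x * b j x * G x ∂μ) atTop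
      (𝓝 (∫ x, W x * b₀ x * G x ∂μ)) := by
    refine tendsto_integral_of_dominated_convergence (fun x => C * ‖W x * G x‖)
      (fun j => (hW.1.mul (hb j)).mul hG.1) (hWG.norm.const_mul C)
      (fun j => Eventually.of_forall fun x => ?_) ?_
    · have : W x * b j x * G x = b j x * (W x * G x) := by ring
      rw [this, norm_mul]
      exact mul_le_mul_of_nonneg_right (hbC j x) (norm_nonneg _)
    · filter_upwards [hlim] with x hx
      exact (hx.const_mul _).mul_const _
  have hGm : ∀ j, AEStronglyMeasurable (fun x => G' j x - G x) μ := fun j => (hG' j).sub hG.1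
  have hbnd : ∀ j, ∫⁻ x, ‖W x * b j x * (G' j x - G x)‖ₑ ∂μ
      ≤ ENNReal.ofReal C * (eLpNorm W p μ * eLpNorm (fun x => G' j x - G x) q μ) := by
    intro j
    calc ∫⁻ x, ‖W x * b j x * (G' j x - G x)‖ₑ ∂μ
        ≤ ∫⁻ x, ENNReal.ofReal C * ‖W x * (G' j x - G x)‖ₑ ∂μ := by
          refine lintegral_mono fun x => ?_
          have : W x * b j x * (G' j x - G x) = b j x * (W x * (G' j x - G x)) := by ring
          rw [this, enorm_mul]
          gcongr
          rw [← ofReal_norm]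
          exact ENNReal.ofReal_le_ofReal (hbC j x)
      _ = ENNReal.ofReal C * ∫⁻ x, ‖W x * (G' j x - G x)‖ₑ ∂μ :=
          lintegral_const_mul' _ _ ENNReal.ofReal_ne_top
      _ ≤ _ := by
          gcongr
          rw [← eLpNorm_one_eq_lintegral_enorm]
          exact eLpNorm_smul_le_mul_eLpNorm (p := p) (q := q) (r := 1) (φ := W)
            (f := fun x => G' j x - G x) (hGm j) hW.1
  have hsmall : Tendsto (fun j => ENNReal.ofReal C *
      (eLpNorm W p μ * eLpNorm (fun x => G' j x - G x) q μ)) atTop (𝓝 0) := by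
    have h := ENNReal.Tendsto.const_mul (a := eLpNorm W p μ) hGlim (Or.inr hW.2.ne)
    rw [mul_zero] at h
    have := ENNReal.Tendsto.const_mul (a := ENNReal.ofReal C) h (Or.inr ENNReal.ofReal_ne_top)
    rwa [mul_zero] at this
  have h2 : Tendsto (fun j => ∫ x, W x * b j x * (G' j x - G x) ∂μ) atTop (𝓝 0) := by
    rw [tendsto_zero_iff_enorm_tendsto_zero]
    exact tendsto_of_tendsto_of_tendsto_of_le_of_le tendsto_const_nhds hsmall
      (fun _ => zero_le) fun j => (enorm_integral_le_lintegral_enorm _).trans (hbnd j)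
  have h3 := h1.add h2
  rw [add_zero] at h3
  refine h3.congr' ?_
  filter_upwards [hsmall.eventually (gt_mem_nhds ENNReal.zero_lt_top)] with j hj
  rw [← integral_add]
  · refine integral_congr_ae (Eventually.of_forall fun x => ?_)
    simp only
    ring
  · refine (hWG.norm.const_mul C).mono' ((hW.1.mul (hb j)).mul hG.1)
      (Eventually.of_forall fun x => ?_)
    have : W x * b j x * G x = b j x * (W x * G x) := by ring
    rw [this, norm_mul]
    exact mul_le_mul_of_nonneg_right (hbC j x) (norm_nonneg _)
  · exact ⟨(hW.1.mul (hb j)).mul (hGm j), (hbnd j).trans_lt hj⟩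

end ProductLimit

/-! ### The chain rule along a direction for quasicontinuous representatives. -/

section ChainRule

variable {n : ℕ} {Ω : Opens (Space n)}

lemma memLp_zeroExt {F : Type*} [NormedAddCommGroup F] {q : ℝ≥0∞} {f : Ω → F} (hf : MemLp f q) :
    MemLp (zeroExt f) q := by
  have h1 : MemLp (zeroExt f) q ((volume : Measure (Space n)).restrict Ω) := by
    rw [← map_coe_volume, measurableEmbedding_coe.memLp_map_measure_iff]
    exact hf.ae_eq (Eventually.of_forall fun x => (zeroExt_coe f x).symm)
  rw [← memLp_indicator_iff_restrict Ω.isOpen.measurableSet] at h1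
  refine h1.ae_eq (Eventually.of_forall fun x => ?_)
  by_cases hx : x ∈ (Ω : Set (Space n))
  · simp [hx]
  · simp [hx, zeroExt_of_notMem f hx]

lemma continuous_cutoff_line {a : Space n → ℝ} {χ : Space n → ℝ} (hχ : Continuous χ)
    (hχΩ : tsupport χ ⊆ Ω) {x ξ : Space n}
    (ha : ContinuousOn (fun t : ℝ => a (x + t • ξ)) {t | x + t • ξ ∈ Ω}) :
    Continuous fun t : ℝ => χ (x + t • ξ) * a (x + t • ξ) := by
  rw [continuous_iff_continuousAt]
  intro t
  by_cases ht : x + t • ξ ∈ Ω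
  · have hopen : IsOpen {t : ℝ | x + t • ξ ∈ Ω} := Ω.isOpen.preimage (by fun_prop)
    exact (hχ.comp (by fun_prop : Continuous fun t : ℝ => x + t • ξ)).continuousAt.mul
      (ha.continuousAt (hopen.mem_nhds ht))
  · have hopen : IsOpen {t : ℝ | x + t • ξ ∈ (tsupport χ)ᶜ} :=
      (isClosed_tsupport χ).isOpen_compl.preimage (by fun_prop)
    have hev : (fun t : ℝ => χ (x + t • ξ) * a (x + t • ξ)) =ᶠ[𝓝 t] fun _ => 0 := by
      filter_upwards [hopen.mem_nhds (fun h => ht (hχΩ h))] with s hs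
      rw [image_eq_zero_of_notMem_tsupport hs, zero_mul]
    exact continuousAt_const.congr hev.symm

set_option maxHeartbeats 1000000 in
/-- The chain rule for the product of a function of a quasicontinuous representative and a
measure which is a directional derivative. -/
lemma integral_comp_quasicontinuous (hΩ : Bornology.IsBounded (Ω : Set (Space n)))
    {q q' : ℝ≥0∞} [Fact (1 ≤ q)] [ENNReal.HolderConjugate q' q] (hq : q ≠ ⊤)
    {m : Measure Ω} [IsFiniteMeasure m] {d e w : Ω → ℝ} (hd : Integrable d m)
    (he : Integrable e) (hw : Integrable w) {ξ : Space n} (hξ : ξ ≠ 0)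
    (h : ∀ φ : Space n → ℝ, ContDiff ℝ ∞ φ → HasCompactSupport φ → tsupport φ ⊆ Ω →
      ∫ x : Ω, φ x * d x ∂m + ∫ x : Ω, φ x * e x = - ∫ x : Ω, w x * fderiv ℝ φ x ξ)
    {α : sobolev Ω q} {at' : Ω → ℝ} (hα : IsQuasicontinuousRep Ω q α at')
    {θ : Space n → ℝ} (hθ : ContDiff ℝ ∞ θ) (hθc : HasCompactSupport θ) (hθΩ : tsupport θ ⊆ Ω)
    (hθw : MemLp (fun x => θ x * zeroExt w x) q')
    {v : ℝ → ℝ} (hv : ContDiff ℝ ∞ v) (hvc : HasCompactSupport v) :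
    AEStronglyMeasurable (fun x : Ω => θ x * v (at' x) * d x) m ∧
      ∫ x : Ω, θ x * v (at' x) * d x ∂m + ∫ x : Ω, θ x * v (at' x) * e x =
        - ∫ x : Ω, w x * (v (at' x) * fderiv ℝ θ x ξ
          + θ x * deriv v (at' x) * inner ℝ (α.1.2 x) ξ) := by
  have hfin : IsFiniteMeasure (volume : Measure Ω) := ⟨volume_opens_lt_top hΩ⟩
  have hq1 : (1 : ℝ≥0∞) ≤ q := Fact.out
  set g : Ω → Space n := fun x => α.1.2 x
  have hgq : MemLp g q := Lp.memLp _
  have hg : Integrable g := hgq.integrable hq1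
  have haq : MemLp at' q := (Lp.memLp α.1.1).ae_eq (by filter_upwards [hα.2] with x hx using hx.symm)
  have ha : Integrable at' := haq.integrable hq1
  have hweak : IsWeakGradient Ω at' g := by
    intro φ i
    rw [← α.2 φ i]
    exact integral_congr_ae (by filter_upwards [hα.2] with x hx; rw [hx])
  -- With `χ = 1` near the support of `θ`, the function `f = χ α̃` lives on the whole space and
  -- coincides with `α̃` wherever `θ` is felt.
  obtain ⟨χ, hχ, hχc, hχΩ, hχ1, hχI⟩ := exists_cutoff (E := Space n) hθc Ω.isOpen hθΩ
  set f : Space n → ℝ := fun x => χ x * zeroExt at' x with hf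
  set G : Space n → ℝ := fun x => χ x * inner ℝ (zeroExt g x) ξ
    + zeroExt at' x * fderiv ℝ χ x ξ with hG
  have hfG : HasWeakDeriv f G ξ := hweak.hasWeakDeriv_cutoff ha hg hχ hχc hχΩ ξ
  have hcχ : Continuous fun x => fderiv ℝ χ x ξ :=
    (hχ.continuous_fderiv (by simp)).clm_apply continuous_const
  obtain ⟨Cχ, hCχ⟩ := hχc.exists_bound_of_continuous hχ.continuous
  obtain ⟨Cχ', hCχ'⟩ := (hχc.fderiv_apply (𝕜 := ℝ) ξ).exists_bound_of_continuous hcχ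
  have hfi : Integrable f := (integrable_zeroExt ha).bdd_mul (c := Cχ)
    hχ.continuous.aestronglyMeasurable (Eventually.of_forall hCχ)
  have hGi : Integrable G := ((integrable_zeroExt hg).inner_const ξ).bdd_mul (c := Cχ)
    hχ.continuous.aestronglyMeasurable (Eventually.of_forall hCχ) |>.add
      ((integrable_zeroExt ha).mul_bdd (c := Cχ') hcχ.aestronglyMeasurable
        (Eventually.of_forall hCχ'))
  have hGq : MemLp G q := by
    refine MemLp.add ?_ ?_
    · have hgξ : MemLp (fun x => inner ℝ (zeroExt g x) ξ) q := (memLp_zeroExt hgq).inner_const ξ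
      refine MemLp.of_le_mul (c := Cχ) hgξ (hχ.continuous.aestronglyMeasurable.mul hgξ.1)
        (Eventually.of_forall fun x => ?_)
      rw [norm_mul]
      exact mul_le_mul_of_nonneg_right (hCχ x) (norm_nonneg _)
    · refine MemLp.of_le_mul (c := Cχ') (memLp_zeroExt haq)
        ((memLp_zeroExt haq).1.mul hcχ.aestronglyMeasurable) (Eventually.of_forall fun x => ?_)
      rw [norm_mul, mul_comm]
      exact mul_le_mul_of_nonneg_right (hCχ' x) (norm_nonneg _)
  obtain ⟨R, hR⟩ := hΩ.subset_closedBall 0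
  have hfR : ∀ x, R < ‖x‖ → f x = 0 := by
    intro x hx
    have : x ∉ Ω := fun hxΩ => by
      have := hR hxΩ
      rw [mem_closedBall_zero_iff] at this
      linarith
    simp [hf, zeroExt_of_notMem at' this]
  have hcont : ∀ᵐ x, Continuous fun t : ℝ => f (x + t • ξ) := by
    filter_upwards [hα.1.ae_continuousOn_line hq hΩ hξ] with x hx
    exact continuous_cutoff_line hχ.continuous hχΩ hx
  obtain ⟨s, hs, hN⟩ := exists_subseq_mollify_tendsto hξ hfR hfi hGi hfG hcont
  set N : Set (Space n) := {x | ¬ Tendsto (fun j => mollify (s j) f x) atTop (𝓝 (f x))} with hNdef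
  have hfloc := hfi.locallyIntegrable
  have hNvol : ∀ᵐ x, x ∉ N := hN.ae_notMem
  have hwE : ∀ φ : Space n → ℝ, ∫ x : Ω, w x * φ x = ∫ x, zeroExt w x * φ x := by
    intro φ
    rw [← integral_coe (Ω := Ω) (f := fun x => zeroExt w x * φ x)
      fun x hx => by simp [zeroExt_of_notMem w hx]]
    simp only [zeroExt_coe]
  -- The exceptional set of the mollifications carries no mass of `d m`, so they converge to the
  -- quasicontinuous representative almost everywhere for this measure, however singular it is.
  have hthin : ∀ᵐ x : Ω ∂m, (x : Space n) ∈ N → d x = 0 := by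
    have := ae_eq_zero_of_lineNull_add measurableEmbedding_coe hd he (integrable_zeroExt hw)
      Ω.isOpen hξ (fun φ hφ hφc hφΩ => by rw [h φ hφ hφc hφΩ, hwE fun x => fderiv ℝ φ x ξ]) hN
      (by refine (ae_coe_iff (P := fun x => x ∉ N)).2 ?_; filter_upwards [hNvol] with x hx _ using hx)
    filter_upwards [this] with x hx hxN using hx x.2 hxN
  have hθχ : ∀ x, θ x ≠ 0 → χ x = 1 := fun x hx =>
    hχ1.self_of_nhdsSet x (subset_tsupport θ hx)
  have hθf : ∀ x : Ω, θ x ≠ 0 → f x = at' x := fun x hx => by simp [hf, hθχ x hx]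
  have hfj : ∀ j, ContDiff ℝ ∞ (mollify j f) := fun j => contDiff_mollify hfloc j
  have hvj : ∀ j, ContDiff ℝ ∞ fun x => v (mollify (s j) f x) := fun j => hv.comp (hfj _)
  obtain ⟨Cv, hCv⟩ := hvc.exists_bound_of_continuous hv.continuous
  have hdvc : Continuous (deriv v) := hv.continuous_deriv (by simp)
  obtain ⟨Cv', hCv'⟩ := hvc.deriv.exists_bound_of_continuous hdvc
  obtain ⟨Cθ, hCθ⟩ := hθc.exists_bound_of_continuous hθ.continuous
  have hcθ : Continuous fun x => fderiv ℝ θ x ξ :=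
    (hθ.continuous_fderiv (by simp)).clm_apply continuous_const
  obtain ⟨Cθ', hCθ'⟩ := (hθc.fderiv_apply (𝕜 := ℝ) ξ).exists_bound_of_continuous hcθ
  set φ : ℕ → Space n → ℝ := fun j x => θ x * v (mollify (s j) f x) with hφdef
  have hφ : ∀ j, ContDiff ℝ ∞ (φ j) := fun j => hθ.mul (hvj j)
  have hφc : ∀ j, HasCompactSupport (φ j) := fun j => hθc.mul_right
  have hφΩ : ∀ j, tsupport (φ j) ⊆ Ω := fun j => tsupport_mul_subset_left.trans hθΩ
  have hφd : ∀ j x, fderiv ℝ (φ j) x ξ = v (mollify (s j) f x) * fderiv ℝ θ x ξ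
      + θ x * deriv v (mollify (s j) f x) * mollify (s j) G x := by
    intro j x
    have h1 : HasFDerivAt (fun x => v (mollify (s j) f x))
        (deriv v (mollify (s j) f x) • fderiv ℝ (mollify (s j) f) x) x :=
      (hv.differentiable (by simp) _).hasDerivAt.comp_hasFDerivAt x
        ((hfj _).differentiable (by simp) x).hasFDerivAt
    have h2 := ((hθ.differentiable (by simp) x).hasFDerivAt.mul h1).fderiv
    have h3 : fderiv ℝ (φ j) x = θ x • deriv v (mollify (s j) f x) • fderiv ℝ (mollify (s j) f) x
        + v (mollify (s j) f x) • fderiv ℝ θ x := h2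
    rw [h3]
    simp only [add_apply, smul_apply, smul_eq_mul,
      fderiv_mollify hfG hfloc]
    ring
  have hlimN : ∀ x, x ∉ N → Tendsto (fun j => mollify (s j) f x) atTop (𝓝 (f x)) := fun x hx =>
    not_not.1 hx
  have hφlim : ∀ x : Ω, (x : Space n) ∉ N →
      Tendsto (fun j => φ j x) atTop (𝓝 (θ x * v (at' x))) := by
    intro x hx
    by_cases h0 : θ x = 0
    · simp [hφdef, h0]
    · have := (hv.continuous.tendsto _).comp (hlimN x hx)
      rw [hθf x h0] at this
      exact this.const_mul _
  have hφC : ∀ j x, ‖φ j x‖ ≤ Cθ * Cv := fun j x => by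
    rw [norm_mul]
    exact mul_le_mul (hCθ x) (hCv _) (norm_nonneg _) ((norm_nonneg _).trans (hCθ x))
  have hφm : ∀ j (ν : Measure Ω), AEStronglyMeasurable (fun x : Ω => φ j x) ν := fun j ν =>
    ((hφ j).continuous.comp continuous_subtype_val).aestronglyMeasurable
  have hlimd : ∀ᵐ x : Ω ∂m, Tendsto (fun j => φ j x * d x) atTop
      (𝓝 (θ x * v (at' x) * d x)) := by
    filter_upwards [hthin] with x hx
    by_cases hxN : (x : Space n) ∈ N
    · simp [hx hxN]
    · exact (hφlim x hxN).mul_const _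
  have hlime : ∀ᵐ x : Ω, Tendsto (fun j => φ j x * e x) atTop
      (𝓝 (θ x * v (at' x) * e x)) := by
    have : ∀ᵐ x : Ω, (x : Space n) ∉ N :=
      ae_coe_iff.2 (by filter_upwards [hNvol] with x hx _ using hx)
    filter_upwards [this] with x hxN
    exact (hφlim x hxN).mul_const _
  refine ⟨aestronglyMeasurable_of_tendsto_ae _ (fun j => (hφm j m).mul hd.1) hlimd, ?_⟩
  have t1 : Tendsto (fun j => ∫ x : Ω, φ j x * d x ∂m) atTop
      (𝓝 (∫ x : Ω, θ x * v (at' x) * d x ∂m)) := by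
    refine tendsto_integral_of_dominated_convergence (fun x => Cθ * Cv * ‖d x‖)
      (fun j => (hφm j m).mul hd.1) (hd.norm.const_mul _)
      (fun j => Eventually.of_forall fun x => ?_) hlimd
    rw [norm_mul]
    exact mul_le_mul_of_nonneg_right (hφC j x) (norm_nonneg _)
  have t2 : Tendsto (fun j => ∫ x : Ω, φ j x * e x) atTop
      (𝓝 (∫ x : Ω, θ x * v (at' x) * e x)) := by
    refine tendsto_integral_of_dominated_convergence (fun x => Cθ * Cv * ‖e x‖)
      (fun j => (hφm j _).mul he.1) (he.norm.const_mul _)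
      (fun j => Eventually.of_forall fun x => ?_) hlime
    rw [norm_mul]
    exact mul_le_mul_of_nonneg_right (hφC j x) (norm_nonneg _)
  have hwi : Integrable (zeroExt w) := integrable_zeroExt hw
  have hvlim : ∀ᵐ x, Tendsto (fun j => v (mollify (s j) f x)) atTop (𝓝 (v (f x))) := by
    filter_upwards [hNvol] with x hx using (hv.continuous.tendsto _).comp (hlimN x hx)
  have hv'lim : ∀ᵐ x, Tendsto (fun j => deriv v (mollify (s j) f x)) atTop
      (𝓝 (deriv v (f x))) := by
    filter_upwards [hNvol] with x hx using (hdvc.tendsto _).comp (hlimN x hx)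
  have hvm : ∀ j, Continuous fun x => v (mollify (s j) f x) := fun j => (hvj j).continuous
  have hv'm : ∀ j, Continuous fun x => deriv v (mollify (s j) f x) := fun j =>
    hdvc.comp (hfj _).continuous
  have t3 : Tendsto (fun j => ∫ x, zeroExt w x * (v (mollify (s j) f x) * fderiv ℝ θ x ξ)) atTop
      (𝓝 (∫ x, zeroExt w x * (v (f x) * fderiv ℝ θ x ξ))) := by
    refine tendsto_integral_of_dominated_convergence (fun x => ‖zeroExt w x‖ * (Cv * Cθ'))
      (fun j => hwi.1.mul ((hvm j).mul hcθ).aestronglyMeasurable) (hwi.norm.mul_const _)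
      (fun j => Eventually.of_forall fun x => ?_) ?_
    · rw [norm_mul, norm_mul]
      gcongr
      · exact (norm_nonneg _).trans (hCv 0)
      · exact hCv _
      · exact hCθ' x
    · filter_upwards [hvlim] with x hx
      exact (hx.mul_const _).const_mul _
  have hGmoll : Tendsto (fun j => eLpNorm (fun x => mollify (s j) G x - G x) q volume) atTop
      (𝓝 0) := (tendsto_eLpNorm_mollify_sub hq hGq).comp hs.tendsto_atTop
  have hGm : ∀ j, Continuous (mollify j G) := fun j =>
    (contDiff_mollify hGi.locallyIntegrable j).continuous
  -- The only term needing the dual exponent: `θ w` lies in `L^{q'}`, while the derivatives of the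
  -- mollifications converge in `L^q`.
  have t4 := tendsto_integral_mul_mul_of_tendsto_eLpNorm hθw hGq
    (fun j => (hGm (s j)).aestronglyMeasurable) (fun j => (hv'm j).aestronglyMeasurable)
    (fun j x => hCv' _) hv'lim hGmoll
  have i3 : ∀ j, Integrable fun x => zeroExt w x * (v (mollify (s j) f x) * fderiv ℝ θ x ξ) := by
    intro j
    refine hwi.mul_bdd (c := Cv * Cθ') ((hvm j).mul hcθ).aestronglyMeasurable
      (Eventually.of_forall fun x => ?_)
    rw [norm_mul]
    exact mul_le_mul (hCv _) (hCθ' x) (norm_nonneg _) ((norm_nonneg _).trans (hCv 0))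
  have i4 : ∀ j, Integrable fun x => θ x * zeroExt w x * deriv v (mollify (s j) f x)
      * mollify (s j) G x := by
    intro j
    have hc : Continuous fun x => θ x * deriv v (mollify (s j) f x) * mollify (s j) G x :=
      (hθ.continuous.mul (hv'm j)).mul (hGm (s j))
    obtain ⟨C, hC⟩ := HasCompactSupport.exists_bound_of_continuous
      (f := fun x => θ x * deriv v (mollify (s j) f x) * mollify (s j) G x)
      (hθc.mul_right.mul_right) hc
    refine (hwi.mul_bdd (c := C) hc.aestronglyMeasurable (Eventually.of_forall hC)).congr
      (Eventually.of_forall fun x => ?_)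
    simp only
    ring
  have hid : ∀ j, ∫ x : Ω, φ j x * d x ∂m + ∫ x : Ω, φ j x * e x
      = - ((∫ x, zeroExt w x * (v (mollify (s j) f x) * fderiv ℝ θ x ξ))
        + ∫ x, θ x * zeroExt w x * deriv v (mollify (s j) f x) * mollify (s j) G x) := by
    intro j
    rw [h (φ j) (hφ j) (hφc j) (hφΩ j), hwE fun x => fderiv ℝ (φ j) x ξ, ← integral_add (i3 j) (i4 j)]
    congr 1
    refine integral_congr_ae (Eventually.of_forall fun x => ?_)
    simp only [hφd]
    ring
  have hlim := tendsto_nhds_unique ((t1.add t2).congr hid) (t3.add t4).neg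
  rw [hlim]
  congr 1
  have hfm : AEStronglyMeasurable f := hfi.1
  have i3' : Integrable fun x => zeroExt w x * (v (f x) * fderiv ℝ θ x ξ) := by
    refine hwi.mul_bdd (c := Cv * Cθ')
      ((hv.continuous.comp_aestronglyMeasurable hfm).mul hcθ.aestronglyMeasurable)
      (Eventually.of_forall fun x => ?_)
    rw [norm_mul]
    exact mul_le_mul (hCv _) (hCθ' x) (norm_nonneg _) ((norm_nonneg _).trans (hCv 0))
  have i4' : Integrable fun x => θ x * zeroExt w x * deriv v (f x) * G x := by
    have h1 : Integrable fun x => θ x * zeroExt w x * G x := hθw.integrable_mul hGq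
    refine (h1.mul_bdd (c := Cv') (hdvc.comp_aestronglyMeasurable hfm)
      (Eventually.of_forall fun x => hCv' (f x))).congr (Eventually.of_forall fun x => ?_)
    simp only
    ring
  rw [← integral_add i3' i4', ← integral_coe (Ω := Ω) fun x hx => by
    simp [zeroExt_of_notMem w hx]]
  refine integral_congr_ae (Eventually.of_forall fun x => ?_)
  -- The derivative of the cut-off, which enters through `G`, disappears where `θ` lives.
  have hfθ : fderiv ℝ χ x ξ * θ x = 0 := by
    by_cases hx : (x : Space n) ∈ tsupport θ
    · have h1 : χ =ᶠ[𝓝 (x : Space n)] fun _ => 1 :=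
        hχ1.filter_mono (nhds_le_nhdsSet hx)
      rw [h1.fderiv_eq]
      simp
    · rw [image_eq_zero_of_notMem_tsupport hx, mul_zero]
  have hfθ' : fderiv ℝ θ x ξ * (v (f x) - v (at' x)) = 0 := by
    by_cases hx : (x : Space n) ∈ tsupport θ
    · have : χ x = 1 := hχ1.self_of_nhdsSet x hx
      simp [hf, this]
    · have : (x : Space n) ∉ tsupport (fderiv ℝ θ · ξ) := fun h' =>
        hx (tsupport_fderiv_apply_subset ℝ _ h')
      rw [image_eq_zero_of_notMem_tsupport this, zero_mul]
  simp only [zeroExt_coe, hG]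
  by_cases h0 : θ x = 0
  · rw [h0]
    linear_combination w x * hfθ'
  · have hx1 := hθχ x h0
    have hx2 := hθf x h0
    rw [hx1, hx2]
    linear_combination w x * deriv v (at' x) * at' x * hfθ

end ChainRule

/-! ### Localised Sobolev inequality. -/

section LocalSobolev

variable {n : ℕ}

/-- The local form of the Sobolev inequality for functions of bounded deformation. -/
lemma exists_lintegral_cutoff_rpow_le (hn : 2 ≤ n) (Ω : Opens (Space n)) :
    ∃ C : ℝ≥0, ∀ (u : Ω → Space n) (m : Measure Ω) [IsFiniteMeasure m], Integrable u →
      (∀ (ξ : Space n) (φ : Space n → ℝ), ContDiff ℝ ∞ φ → HasCompactSupport φ → tsupport φ ⊆ Ω →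
        |∫ x : Ω, inner ℝ (u x) ξ * fderiv ℝ φ x ξ| ≤ ‖ξ‖ ^ 2 * ∫ x : Ω, |φ x| ∂m) →
      ∀ θ : Space n → ℝ, ContDiff ℝ ∞ θ → HasCompactSupport θ → tsupport θ ⊆ Ω →
        ∫⁻ x, ‖θ x • zeroExt u x‖ₑ ^ ((n : ℝ) / (n - 1)) ≤
          C * (∫⁻ x : Ω, ‖θ x‖ₑ ∂m + ∫⁻ x : Ω, ‖fderiv ℝ θ x‖ₑ * ‖u x‖ₑ) ^ ((n : ℝ) / (n - 1)) := by
  obtain ⟨C, hC⟩ := exists_lintegral_rpow_le_of_deformation hn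
  refine ⟨C, fun u m _ hu h θ hθ hθc hθΩ => ?_⟩
  have hcθ : Continuous fun x : Ω => θ x := hθ.continuous.comp continuous_subtype_val
  have hfθ : Continuous fun x => fderiv ℝ θ x := hθ.continuous_fderiv (by simp)
  obtain ⟨Cθ, hCθ⟩ := hθc.exists_bound_of_continuous hθ.continuous
  obtain ⟨Cθ', hCθ'⟩ := (hθc.fderiv (𝕜 := ℝ)).exists_bound_of_continuous hfθ
  set ρ : Ω → ℝ≥0 := fun x => ‖θ x‖₊ with hρ
  set σ : Ω → ℝ≥0 := fun x => ‖fderiv ℝ θ x‖₊ * ‖u x‖₊ with hσ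
  have hρm : Measurable ρ := hcθ.measurable.nnnorm
  have hσm : AEMeasurable σ :=
    ((hfθ.comp continuous_subtype_val).nnnorm.measurable.aemeasurable).mul hu.1.aemeasurable.nnnorm
  set μ₁ : Measure Ω := m.withDensity fun x => (ρ x : ℝ≥0∞) with hμ₁
  set μ₂ : Measure Ω := volume.withDensity fun x => (σ x : ℝ≥0∞) with hμ₂
  have hσi : Integrable (fun x : Ω => (σ x : ℝ)) := by
    refine (hu.norm.const_mul Cθ').mono' (hσm.coe_nnreal_real.aestronglyMeasurable)
      (Eventually.of_forall fun x => ?_)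
    simp only [hσ, NNReal.coe_mul, coe_nnnorm, norm_mul, norm_norm]
    exact mul_le_mul_of_nonneg_right (hCθ' x) (norm_nonneg _)
  have hfin₁ : IsFiniteMeasure μ₁ := by
    refine isFiniteMeasure_withDensity ?_
    have : Integrable (fun x : Ω => θ x) m := Integrable.of_bound hcθ.aestronglyMeasurable Cθ
      (Eventually.of_forall fun x : Ω => hCθ x)
    exact this.2.ne
  have hfin₂ : IsFiniteMeasure μ₂ := by
    refine isFiniteMeasure_withDensity ?_
    have := hσi.2.ne
    simpa [HasFiniteIntegral] using this
  have hmeas : Measurable (Subtype.val : Ω → Space n) := measurable_subtype_coe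
  -- By the product rule `∂_ξ(θ u · ξ) = θ ∂_ξ(u · ξ) + (u · ξ) ∂_ξθ`, so the deformation of `θ u`
  -- is dominated by `|θ| m` plus `‖∇θ‖ ‖u‖` times Lebesgue measure.
  set μ : Measure (Space n) := (μ₁ + μ₂).map Subtype.val with hμ
  have hμuniv : μ univ = ∫⁻ x : Ω, ‖θ x‖ₑ ∂m + ∫⁻ x : Ω, ‖fderiv ℝ θ x‖ₑ * ‖u x‖ₑ := by
    rw [hμ, Measure.map_apply hmeas MeasurableSet.univ, preimage_univ, Measure.add_apply, hμ₁, hμ₂,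
      withDensity_apply _ MeasurableSet.univ, withDensity_apply _ MeasurableSet.univ,
      Measure.restrict_univ, Measure.restrict_univ]
    simp [hρ, hσ, enorm_eq_nnnorm]
  obtain ⟨R, hR⟩ := hθc.isCompact.isBounded.subset_closedBall 0
  have hθ0 : ∀ x, x ∉ Ω → θ x = 0 := fun x hx =>
    image_eq_zero_of_notMem_tsupport fun hx' => hx (hθΩ hx')
  have hui : Integrable fun x => θ x • zeroExt u x :=
    (integrable_zeroExt hu).bdd_smul Cθ hθ.continuous.aestronglyMeasurable
      (Eventually.of_forall hCθ)
  rw [← hμuniv]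
  refine hC _ R μ hui (fun x hx => ?_) fun ξ φ hφ hφc => ?_
  · have : x ∉ tsupport θ := fun hx' => by
      have := hR hx'
      rw [mem_closedBall_zero_iff] at this
      linarith
    rw [image_eq_zero_of_notMem_tsupport this, zero_smul]
  · have hcφ : Continuous fun x => fderiv ℝ φ x ξ :=
      (hφ.continuous_fderiv (by simp)).clm_apply continuous_const
    have hcθξ : Continuous fun x => fderiv ℝ θ x ξ := hfθ.clm_apply continuous_const
    obtain ⟨Cφ, hCφ⟩ := hφc.exists_bound_of_continuous hφ.continuous
    have habs : ∀ (ν : Measure Ω) [IsFiniteMeasure ν], Integrable (fun x : Ω => |φ x|) ν :=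
      fun ν _ => Integrable.of_bound
        (hφ.continuous.abs.comp continuous_subtype_val).aestronglyMeasurable Cφ
        (Eventually.of_forall fun x : Ω => by simpa using hCφ x)
    have hμint : ∫ x, |φ x| ∂μ = (∫ x : Ω, |θ x * φ x| ∂m)
        + ∫ x : Ω, ‖fderiv ℝ θ x‖ * ‖u x‖ * |φ x| := by
      rw [hμ, integral_map hmeas.aemeasurable hφ.continuous.abs.aestronglyMeasurable,
        integral_add_measure (habs _) (habs _), hμ₁, hμ₂,
        integral_withDensity_eq_integral_smul hρm, integral_withDensity_eq_integral_smul₀ hσm]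
      congr 1
      refine integral_congr_ae (Eventually.of_forall fun x => ?_)
      simp [hρ, abs_mul, NNReal.smul_def]
    rw [hμint]
    rw [← integral_coe (Ω := Ω) (f := fun x => inner ℝ (θ x • zeroExt u x) ξ * fderiv ℝ φ x ξ)
      fun x hx => by simp [hθ0 x hx]]
    simp only [zeroExt_coe]
    have hd : ∀ x, fderiv ℝ (fun x => θ x * φ x) x ξ = θ x * fderiv ℝ φ x ξ
        + φ x * fderiv ℝ θ x ξ := by
      intro x
      rw [fderiv_fun_mul (hθ.differentiable (by simp) x) (hφ.differentiable (by simp) x)]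
      simp
    have hbint : ∀ {ψ : Space n → ℝ}, Continuous ψ → HasCompactSupport ψ →
        Integrable fun x : Ω => inner ℝ (u x) ξ * ψ x := by
      intro ψ hψ hψc
      obtain ⟨C, hC⟩ := hψc.exists_bound_of_continuous hψ
      exact (hu.inner_const ξ).mul_bdd (c := C) (hψ.comp continuous_subtype_val).aestronglyMeasurable
        (Eventually.of_forall fun x : Ω => hC x)
    have i1 : Integrable fun x : Ω => inner ℝ (u x) ξ * (θ x * fderiv ℝ φ x ξ) :=
      hbint (hθ.continuous.mul hcφ) hθc.mul_right
    have i2 : Integrable fun x : Ω => inner ℝ (u x) ξ * (φ x * fderiv ℝ θ x ξ) :=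
      hbint (hφ.continuous.mul hcθξ) hφc.mul_right
    have e1 : ∫ x : Ω, inner ℝ (θ x • u x) ξ * fderiv ℝ φ x ξ
        = (∫ x : Ω, inner ℝ (u x) ξ * fderiv ℝ (fun x => θ x * φ x) x ξ)
          - ∫ x : Ω, inner ℝ (u x) ξ * (φ x * fderiv ℝ θ x ξ) := by
      simp only [hd, mul_add]
      rw [integral_add i1 i2, add_sub_cancel_right]
      refine integral_congr_ae (Eventually.of_forall fun x => ?_)
      simp only [inner_smul_left, RCLike.conj_to_real]
      ring
    have h1 := h ξ (fun x => θ x * φ x) (hθ.mul hφ) hθc.mul_right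
      (tsupport_mul_subset_left.trans hθΩ)
    have i3 : Integrable fun x : Ω => ‖fderiv ℝ θ x‖ * ‖u x‖ * |φ x| := by
      refine Integrable.mul_bdd (c := Cφ) hσi
        (hφ.continuous.abs.comp continuous_subtype_val).aestronglyMeasurable
        (Eventually.of_forall fun x : Ω => by simpa using hCφ x)
    have h2 : |∫ x : Ω, inner ℝ (u x) ξ * (φ x * fderiv ℝ θ x ξ)|
        ≤ ‖ξ‖ ^ 2 * ∫ x : Ω, ‖fderiv ℝ θ x‖ * ‖u x‖ * |φ x| := by
      rw [← integral_const_mul]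
      refine (norm_integral_le_integral_norm _).trans
        (integral_mono i2.norm (i3.const_mul _) fun x => ?_)
      simp only [norm_mul]
      have a1 : ‖inner ℝ (u x) ξ‖ ≤ ‖u x‖ * ‖ξ‖ := norm_inner_le_norm _ _
      have a2 : ‖fderiv ℝ θ x ξ‖ ≤ ‖fderiv ℝ θ x‖ * ‖ξ‖ := (fderiv ℝ θ x).le_opNorm ξ
      calc ‖inner ℝ (u x) ξ‖ * (‖φ x‖ * ‖fderiv ℝ θ x ξ‖)
          ≤ (‖u x‖ * ‖ξ‖) * (‖φ x‖ * (‖fderiv ℝ θ x‖ * ‖ξ‖)) := by gcongr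
        _ = _ := by rw [Real.norm_eq_abs]; ring
    rw [e1, mul_add]
    exact (abs_sub _ _).trans (add_le_add h1 h2)

end LocalSobolev

/-! ### Products of weakly and strongly convergent sequences. -/

section WeakConvergence

lemma WeakTendsto.tendsto_apply {Y : Type*} [NormedAddCommGroup Y] [NormedSpace ℝ Y] {f : ℕ → Y}
    {f₀ : Y} (h : WeakTendsto f f₀) (ℓ : Y →L[ℝ] ℝ) :
    Tendsto (fun k => ℓ (f k)) atTop (𝓝 (ℓ f₀)) :=
  ((WeakBilin.eval_continuous (topDualPairing ℝ Y).flip ℓ).tendsto _).comp h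

lemma WeakTendsto.map {Y Z : Type*} [NormedAddCommGroup Y] [NormedSpace ℝ Y]
    [NormedAddCommGroup Z] [NormedSpace ℝ Z] {f : ℕ → Y}
    {f₀ : Y} (h : WeakTendsto f f₀) (T : Y →L[ℝ] Z) :
    WeakTendsto (fun k => T (f k)) (T f₀) :=
  ((WeakSpace.map T).continuous.tendsto _).comp h

lemma WeakTendsto.exists_norm_le {Y : Type*} [NormedAddCommGroup Y] [NormedSpace ℝ Y] {f : ℕ → Y}
    {f₀ : Y} (h : WeakTendsto f f₀) : ∃ C, ∀ k, ‖f k‖ ≤ C := by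
  obtain ⟨C, hC⟩ := banach_steinhaus
    (g := fun k => NormedSpace.inclusionInDoubleDualLi ℝ (f k)) fun ℓ => by
      obtain ⟨C, hC⟩ := (h.tendsto_apply ℓ).norm.bddAbove_range
      exact ⟨C, fun k => hC ⟨k, rfl⟩⟩
  exact ⟨C, fun k => ((NormedSpace.inclusionInDoubleDualLi ℝ).norm_map (f k)).symm.trans_le (hC k)⟩

variable {X F : Type*} [MeasurableSpace X] {μ : Measure X} [NormedAddCommGroup F]
  [InnerProductSpace ℝ F]

/-- Every subsequence has a further one along which `ψ` tends to zero almost everywhere, and there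
the uniform bound gives the majorant `H C ^ r`. -/
lemma tendsto_lintegral_mul_rpow_of_bounded {H : X → ℝ≥0∞} (hH : AEMeasurable H μ)
    (hHi : ∫⁻ x, H x ∂μ ≠ ⊤) {ψ : ℕ → X → ℝ} (hψ : ∀ k, AEStronglyMeasurable (ψ k) μ) {C : ℝ}
    (hC : ∀ k x, ‖ψ k x‖ ≤ C) (hlim : Tendsto (fun k => ∫⁻ x, ‖ψ k x‖ₑ ∂μ) atTop (𝓝 0))
    {r : ℝ} (hr : 0 < r) :
    Tendsto (fun k => ∫⁻ x, H x * ‖ψ k x‖ₑ ^ r ∂μ) atTop (𝓝 0) := by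
  refine tendsto_of_subseq_tendsto fun s hs => ?_
  have hm : TendstoInMeasure μ (fun k => ψ (s k)) atTop 0 := by
    refine tendstoInMeasure_of_tendsto_eLpNorm (p := 1) one_ne_zero (fun k => hψ _)
      aestronglyMeasurable_zero ?_
    simp only [sub_zero, eLpNorm_one_eq_lintegral_enorm]
    exact hlim.comp hs
  obtain ⟨t, _, htae⟩ := hm.exists_seq_tendsto_ae
  refine ⟨t, ?_⟩
  have h0 : ∫⁻ x, (0 : ℝ≥0∞) ∂μ = 0 := by simp
  rw [← h0]
  refine tendsto_lintegral_of_dominated_convergence' (fun x => H x * ENNReal.ofReal C ^ r)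
    (fun k => hH.mul ((hψ _).enorm.pow_const _)) (fun k => Eventually.of_forall fun x => ?_) ?_ ?_
  · refine mul_le_mul_right (ENNReal.rpow_le_rpow ?_ hr.le) _
    rw [← ofReal_norm]
    exact ENNReal.ofReal_le_ofReal (hC _ x)
  · have hc : ENNReal.ofReal C ^ r ≠ ⊤ := ENNReal.rpow_ne_top_of_nonneg hr.le ENNReal.ofReal_ne_top
    rw [lintegral_mul_const' _ _ hc]
    exact ENNReal.mul_ne_top hHi hc
  · have hHfin : ∀ᵐ x ∂μ, H x < ⊤ := ae_lt_top' hH hHi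
    filter_upwards [htae, hHfin] with x hx hxH
    have h1 : Tendsto (fun k => ‖ψ (s (t k)) x‖ₑ ^ r) atTop (𝓝 0) := by
      have h2 := (ENNReal.continuous_rpow_const (y := r)).tendsto 0
      rw [ENNReal.zero_rpow_of_pos hr] at h2
      have h3 : Tendsto (fun k => ‖ψ (s (t k)) x‖ₑ) atTop (𝓝 0) := by
        simpa using hx.enorm
      exact h2.comp h3
    have := ENNReal.Tendsto.const_mul (a := H x) h1 (Or.inr hxH.ne)
    simpa using this

lemma tendsto_integral_mul_of_L1 {w : ℕ → X → ℝ} {w₀ : X → ℝ} (hw : ∀ k, Integrable (w k) μ)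
    (hw₀ : Integrable w₀ μ) (hlim : Tendsto (fun k => ∫⁻ x, ‖w k x - w₀ x‖ₑ ∂μ) atTop (𝓝 0))
    {ψ : ℕ → X → ℝ} {ψ₀ : X → ℝ} (hψ : ∀ k, AEStronglyMeasurable (ψ k) μ)
    (hψ₀ : AEStronglyMeasurable ψ₀ μ) {C : ℝ} (hC : ∀ k x, ‖ψ k x‖ ≤ C)
    (hC₀ : ∀ x, ‖ψ₀ x‖ ≤ C) (hψlim : Tendsto (fun k => ∫⁻ x, ‖ψ k x - ψ₀ x‖ₑ ∂μ) atTop (𝓝 0)) :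
    Tendsto (fun k => ∫ x, w k x * ψ k x ∂μ) atTop (𝓝 (∫ x, w₀ x * ψ₀ x ∂μ)) := by
  have i1 : ∀ k, Integrable (fun x => w k x * ψ k x) μ := fun k =>
    (hw k).mul_bdd (hψ k) (Eventually.of_forall (hC k))
  have i2 : Integrable (fun x => w₀ x * ψ₀ x) μ := hw₀.mul_bdd hψ₀ (Eventually.of_forall hC₀)
  have h1 : Tendsto (fun k => ∫⁻ x, ‖w₀ x‖ₑ * ‖ψ k x - ψ₀ x‖ₑ ^ (1 : ℝ) ∂μ) atTop (𝓝 0) :=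
    tendsto_lintegral_mul_rpow_of_bounded (ψ := fun k x => ψ k x - ψ₀ x) (C := C + C) hw₀.1.enorm
      hw₀.2.ne (fun k => (hψ k).sub hψ₀)
      (fun k x => (norm_sub_le _ _).trans (add_le_add (hC k x) (hC₀ x))) hψlim one_pos
  have h2 : Tendsto (fun k => ENNReal.ofReal C * ∫⁻ x, ‖w k x - w₀ x‖ₑ ∂μ) atTop (𝓝 0) := by
    have := ENNReal.Tendsto.const_mul (a := ENNReal.ofReal C) hlim (Or.inr ENNReal.ofReal_ne_top)
    simpa using this
  have h3 := h2.add h1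
  rw [add_zero] at h3
  rw [tendsto_iff_edist_tendsto_0]
  refine tendsto_of_tendsto_of_tendsto_of_le_of_le tendsto_const_nhds h3 (fun _ => zero_le)
    fun k => ?_
  simp only
  rw [edist_eq_enorm_sub, ← integral_sub (i1 k) i2]
  refine (enorm_integral_le_lintegral_enorm _).trans ?_
  rw [← lintegral_const_mul' _ _ ENNReal.ofReal_ne_top, ← lintegral_add_left']
  · refine lintegral_mono fun x => ?_
    have : w k x * ψ k x - w₀ x * ψ₀ x = ψ k x * (w k x - w₀ x) + w₀ x * (ψ k x - ψ₀ x) := by ring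
    rw [this]
    refine (enorm_add_le _ _).trans ?_
    rw [enorm_mul, enorm_mul, ENNReal.rpow_one]
    gcongr
    rw [← ofReal_norm]
    exact ENNReal.ofReal_le_ofReal (hC k x)
  · exact (((hw k).1.sub hw₀.1).enorm).const_mul _

lemma WeakTendsto.tendsto_integral_inner {p q : ℝ≥0∞} [Fact (1 ≤ p)] [Fact (1 ≤ q)]
    [ENNReal.HolderConjugate p q] {g : ℕ → Lp F q μ} {g₀ : Lp F q μ} (h : WeakTendsto g g₀)
    {W : X → F} (hW : MemLp W p μ) :
    Tendsto (fun k => ∫ x, inner ℝ (W x) (g k x) ∂μ) atTop (𝓝 (∫ x, inner ℝ (W x) (g₀ x) ∂μ)) := by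
  have h1 := h.tendsto_apply ((innerSL ℝ (E := F)).lpPairing μ p q (hW.toLp W))
  have h2 : ∀ f : Lp F q μ, (innerSL ℝ (E := F)).lpPairing μ p q (hW.toLp W) f
      = ∫ x, inner ℝ (W x) (f x) ∂μ := by
    intro f
    rw [ContinuousLinearMap.lpPairing_eq_integral]
    refine integral_congr_ae ?_
    filter_upwards [hW.coeFn_toLp] with x hx
    rw [hx]
    rfl
  simpa only [h2] using h1

/-- The products `W ψ k` converge strongly in `L^p`, because `ψ k` is bounded and converges in
measure while `|W|^p` is integrable; a finite `p` is needed for this. Strong times weak convergence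
passes to the limit. -/
lemma WeakTendsto.tendsto_integral_mul_mul_inner {p q : ℝ≥0∞} [Fact (1 ≤ p)] [Fact (1 ≤ q)]
    [ENNReal.HolderConjugate p q] (hp : p ≠ ⊤) {g : ℕ → Lp F q μ} {g₀ : Lp F q μ}
    (h : WeakTendsto g g₀) {W : X → ℝ} (hW : MemLp W p μ)
    {ψ : ℕ → X → ℝ} {ψ₀ : X → ℝ} (hψ : ∀ k, AEStronglyMeasurable (ψ k) μ)
    (hψ₀ : AEStronglyMeasurable ψ₀ μ) {C : ℝ} (hC : ∀ k x, ‖ψ k x‖ ≤ C)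
    (hC₀ : ∀ x, ‖ψ₀ x‖ ≤ C) (hψlim : Tendsto (fun k => ∫⁻ x, ‖ψ k x - ψ₀ x‖ₑ ∂μ) atTop (𝓝 0))
    (ξ : F) :
    Tendsto (fun k => ∫ x, W x * ψ k x * inner ℝ ξ (g k x) ∂μ) atTop
      (𝓝 (∫ x, W x * ψ₀ x * inner ℝ ξ (g₀ x) ∂μ)) := by
  have hp0 : p ≠ 0 := (zero_lt_one.trans_le Fact.out).ne'
  have hpr : 0 < p.toReal := ENNReal.toReal_pos hp0 hp
  obtain ⟨M, hM⟩ := h.exists_norm_le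
  have hWb : ∀ {χ : X → ℝ} {c : ℝ}, AEStronglyMeasurable χ μ → (∀ x, ‖χ x‖ ≤ c) →
      MemLp (fun x => (W x * χ x) • ξ) p μ := by
    intro χ c hχ hχc
    refine MemLp.of_le_mul (c := c * ‖ξ‖) hW ((hW.1.mul hχ).smul_const ξ)
      (Eventually.of_forall fun x => ?_)
    rw [norm_smul, norm_mul]
    calc ‖W x‖ * ‖χ x‖ * ‖ξ‖ ≤ ‖W x‖ * c * ‖ξ‖ := by gcongr; exact hχc x
      _ = _ := by ring
  have h1 : Tendsto (fun k => ∫ x, W x * ψ₀ x * inner ℝ ξ (g k x) ∂μ) atTop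
      (𝓝 (∫ x, W x * ψ₀ x * inner ℝ ξ (g₀ x) ∂μ)) := by
    have := h.tendsto_integral_inner (hWb hψ₀ hC₀)
    simpa only [inner_smul_left, RCLike.conj_to_real] using this
  have hCC : ∀ k x, ‖ψ k x - ψ₀ x‖ ≤ C + C := fun k x =>
    (norm_sub_le _ _).trans (add_le_add (hC k x) (hC₀ x))
  have hsmall : Tendsto (fun k => eLpNorm (fun x => W x * (ψ k x - ψ₀ x)) p μ) atTop (𝓝 0) := by
    have hWr : ∫⁻ x, ‖W x‖ₑ ^ p.toReal ∂μ ≠ ⊤ :=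
      (lintegral_rpow_enorm_lt_top_of_eLpNorm_lt_top hp0 hp hW.2).ne
    have h2 := tendsto_lintegral_mul_rpow_of_bounded (hW.1.enorm.pow_const p.toReal) hWr
      (fun k => (hψ k).sub hψ₀) hCC hψlim hpr
    have h3 := (ENNReal.continuous_rpow_const (y := 1 / p.toReal)).tendsto 0
    rw [ENNReal.zero_rpow_of_pos (by positivity)] at h3
    refine (h3.comp h2).congr fun k => ?_
    rw [eLpNorm_eq_lintegral_rpow_enorm_toReal hp0 hp]
    simp only [Function.comp_apply, enorm_mul]
    congr 1
    refine lintegral_congr fun x => ?_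
    rw [ENNReal.mul_rpow_of_nonneg _ _ hpr.le]
    rfl
  have hgξ : ∀ f : Lp F q μ, MemLp (fun x => inner ℝ ξ (f x)) q μ := fun f =>
    (Lp.memLp f).const_inner ξ
  have hgM : ∀ k, eLpNorm (fun x => inner ℝ ξ (g k x)) q μ ≤ ENNReal.ofReal (‖ξ‖ * M) := by
    intro k
    have : eLpNorm (fun x => inner ℝ ξ (g k x)) q μ ≤ ENNReal.ofReal ‖ξ‖ * eLpNorm (g k) q μ :=
      eLpNorm_le_mul_eLpNorm_of_ae_le_mul
        (Eventually.of_forall fun x => norm_inner_le_norm _ _) q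
    refine this.trans ?_
    rw [← Lp.enorm_def, ← ofReal_norm, ← ENNReal.ofReal_mul (norm_nonneg _)]
    exact ENNReal.ofReal_le_ofReal (mul_le_mul_of_nonneg_left (hM k) (norm_nonneg _))
  have hle : ∀ k, ‖∫ x, W x * (ψ k x - ψ₀ x) * inner ℝ ξ (g k x) ∂μ‖ₑ
      ≤ eLpNorm (fun x => W x * (ψ k x - ψ₀ x)) p μ * ENNReal.ofReal (‖ξ‖ * M) := by
    intro k
    refine (enorm_integral_le_lintegral_enorm _).trans ?_
    rw [← eLpNorm_one_eq_lintegral_enorm]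
    refine (eLpNorm_smul_le_mul_eLpNorm (p := p) (q := q) (r := 1)
      (φ := fun x => W x * (ψ k x - ψ₀ x)) (f := fun x => inner ℝ ξ (g k x)) (hgξ _).1
      (hW.1.mul ((hψ k).sub hψ₀))).trans ?_
    gcongr
    exact hgM k
  have h2 : Tendsto (fun k => ∫ x, W x * (ψ k x - ψ₀ x) * inner ℝ ξ (g k x) ∂μ) atTop (𝓝 0) := by
    rw [tendsto_zero_iff_enorm_tendsto_zero]
    have h3 := ENNReal.Tendsto.mul_const (b := ENNReal.ofReal (‖ξ‖ * M)) hsmall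
      (Or.inr ENNReal.ofReal_ne_top)
    rw [zero_mul] at h3
    exact tendsto_of_tendsto_of_tendsto_of_le_of_le tendsto_const_nhds h3 (fun _ => zero_le) hle
  have h3 := h1.add h2
  rw [add_zero] at h3
  refine h3.congr fun k => ?_
  have hi : ∀ {χ : X → ℝ} {c : ℝ}, AEStronglyMeasurable χ μ → (∀ x, ‖χ x‖ ≤ c) →
      Integrable (fun x => W x * χ x * inner ℝ ξ (g k x)) μ := by
    intro χ c hχ hχc
    have : MemLp (fun x => W x * χ x) p μ := by
      refine MemLp.of_le_mul (c := c) hW (hW.1.mul hχ) (Eventually.of_forall fun x => ?_)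
      rw [norm_mul, mul_comm]
      exact mul_le_mul_of_nonneg_right (hχc x) (norm_nonneg _)
    exact this.integrable_mul (hgξ (g k))
  rw [← integral_add (hi hψ₀ hC₀) (hi (χ := fun x => ψ k x - ψ₀ x) ((hψ k).sub hψ₀) (hCC k))]
  refine integral_congr_ae (Eventually.of_forall fun x => ?_)
  simp only
  ring

end WeakConvergence

/-! ### Local `L¹` compactness in Sobolev spaces. -/

section Compactness

variable {n : ℕ} {Ω : Opens (Space n)} {q : ℝ≥0∞} [Fact (1 ≤ q)]

/-- The inclusion `W^{1,q}(Ω) → L^q(Ω)`. -/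
def sobolevFun : sobolev Ω q →L[ℝ] Lp ℝ q (volume : Measure Ω) :=
  (ContinuousLinearMap.fst ℝ _ _).comp (sobolev Ω q).subtypeL

/-- The gradient `W^{1,q}(Ω) → L^q(Ω; ℝⁿ)`. -/
def sobolevGrad : sobolev Ω q →L[ℝ] Lp (Space n) q (volume : Measure Ω) :=
  (ContinuousLinearMap.snd ℝ _ _).comp (sobolev Ω q).subtypeL

lemma sobolevFun_apply (β : sobolev Ω q) : sobolevFun β = β.1.1 := rfl

lemma sobolevGrad_apply (β : sobolev Ω q) : sobolevGrad β = β.1.2 := rfl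

lemma exists_lintegral_enorm_le_of_weakTendsto {X F : Type*} [MeasurableSpace X] {μ : Measure X}
    [IsFiniteMeasure μ] [NormedAddCommGroup F] [NormedSpace ℝ F] {f : ℕ → Lp F q μ} {f₀ : Lp F q μ}
    (h : WeakTendsto f f₀) :
    ∃ M : ℝ≥0∞, M ≠ ⊤ ∧ (∀ k, ∫⁻ x, ‖f k x‖ₑ ∂μ ≤ M) ∧ ∫⁻ x, ‖f₀ x‖ₑ ∂μ ≤ M := by
  obtain ⟨C, hC⟩ := h.exists_norm_le
  have hq1 : (1 : ℝ≥0∞) ≤ q := Fact.out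
  set c : ℝ≥0∞ := μ univ ^ (1 / (1 : ℝ≥0∞).toReal - 1 / q.toReal) with hc
  have hctop : c ≠ ⊤ := by
    refine ENNReal.rpow_ne_top_of_nonneg ?_ (measure_ne_top _ _)
    rcases eq_or_ne q ⊤ with h | h
    · simp [h]
    · have := ENNReal.toReal_mono h hq1
      rw [sub_nonneg]
      simp only [ENNReal.toReal_one] at this ⊢
      rw [div_le_div_iff_of_pos_left one_pos (by linarith) one_pos]
      exact this
  have hle : ∀ f : Lp F q μ, ∫⁻ x, ‖f x‖ₑ ∂μ ≤ ‖f‖ₑ * c := by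
    intro f
    rw [← eLpNorm_one_eq_lintegral_enorm, Lp.enorm_def]
    exact eLpNorm_le_eLpNorm_mul_rpow_measure_univ hq1 (Lp.aestronglyMeasurable f)
  refine ⟨(ENNReal.ofReal C + ‖f₀‖ₑ) * c,
    ENNReal.mul_ne_top (ENNReal.add_ne_top.2 ⟨ENNReal.ofReal_ne_top, by simp⟩) hctop,
    fun k => (hle _).trans ?_, (hle _).trans ?_⟩
  · gcongr
    refine le_add_right ?_
    rw [← ofReal_norm]
    exact ENNReal.ofReal_le_ofReal (hC k)
  · gcongr
    exact le_add_left le_rfl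

set_option maxHeartbeats 400000 in
/-- Weakly convergent sequences in `W^{1,q}(Ω)` converge strongly in `L^1_loc(Ω)`. -/
lemma tendsto_lintegral_cutoff_sub (hΩ : Bornology.IsBounded (Ω : Set (Space n)))
    {q' : ℝ≥0∞} [Fact (1 ≤ q')] [ENNReal.HolderConjugate q' q]
    {α : ℕ → sobolev Ω q} {α₀ : sobolev Ω q} (h : WeakTendsto α α₀)
    {χ : Space n → ℝ} (hχ : ContDiff ℝ ∞ χ) (hχc : HasCompactSupport χ) (hχΩ : tsupport χ ⊆ Ω) :
    Tendsto (fun k => ∫⁻ x : Ω, ‖χ x * ((α k).1.1 x - α₀.1.1 x)‖ₑ) atTop (𝓝 0) := by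
  have hfin : IsFiniteMeasure (volume : Measure Ω) := ⟨volume_opens_lt_top hΩ⟩
  have hq1 : (1 : ℝ≥0∞) ≤ q := Fact.out
  have ha := h.map sobolevFun
  have hg := h.map sobolevGrad
  simp only [sobolevFun_apply] at ha
  simp only [sobolevGrad_apply] at hg
  obtain ⟨M₁, hM₁, hM₁k, hM₁₀⟩ := exists_lintegral_enorm_le_of_weakTendsto ha
  obtain ⟨M₂, hM₂, hM₂k, hM₂₀⟩ := exists_lintegral_enorm_le_of_weakTendsto hg
  have hcg : Continuous (gradient χ) :=
    (InnerProductSpace.toDual ℝ (Space n)).symm.continuous.comp (hχ.continuous_fderiv (by simp))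
  have hgc : HasCompactSupport (gradient χ) :=
    (hχc.fderiv (𝕜 := ℝ)).comp_left (map_zero (InnerProductSpace.toDual ℝ (Space n)).symm)
  obtain ⟨C, hC⟩ := hχc.exists_bound_of_continuous hχ.continuous
  obtain ⟨C', hC'⟩ := hgc.exists_bound_of_continuous hcg
  have hmem : ∀ β : sobolev Ω q, Integrable β.1.1 ∧ Integrable β.1.2 := fun β =>
    ⟨(Lp.memLp β.1.1).integrable hq1, (Lp.memLp β.1.2).integrable hq1⟩
  set f : sobolev Ω q → Space n → ℝ := fun β x => χ x * zeroExt β.1.1 x with hf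
  set G : sobolev Ω q → Space n → Space n := fun β x =>
    χ x • zeroExt β.1.2 x + zeroExt β.1.1 x • gradient χ x with hG
  have hfG : ∀ β, HasWeakGrad (f β) (G β) := by
    intro β ξ
    have := IsWeakGradient.hasWeakDeriv_cutoff (hmem β).1 (hmem β).2 β.2 hχ hχc hχΩ ξ
    refine (show (fun x => inner ℝ (G β x) ξ) = _ from funext fun x => ?_) ▸ this
    simp [hG, inner_add_left, inner_smul_left, inner_gradient_left]
  have hfi : ∀ β, Integrable (f β) := fun β => (integrable_zeroExt (hmem β).1).bdd_mul (c := C)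
    hχ.continuous.aestronglyMeasurable (Eventually.of_forall hC)
  have hGm : ∀ β, AEStronglyMeasurable (G β) := fun β =>
    (hχ.continuous.aestronglyMeasurable.smul (integrable_zeroExt (hmem β).2).1).add
      ((integrable_zeroExt (hmem β).1).1.smul hcg.aestronglyMeasurable)
  obtain ⟨R, hR⟩ := hΩ.subset_closedBall 0
  have hfR : ∀ β x, R < ‖x‖ → f β x = 0 := by
    intro β x hx
    have : x ∉ Ω := fun hxΩ => by
      have := hR hxΩ
      rw [mem_closedBall_zero_iff] at this
      linarith
    simp only [hf, zeroExt_of_notMem _ this, mul_zero]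
  have hz : ∀ {F : Type} [NormedAddCommGroup F] (b : Ω → F),
      ∫⁻ x, ‖zeroExt b x‖ₑ = ∫⁻ x : Ω, ‖b x‖ₑ := by
    intro F _ b
    rw [← lintegral_coe (Ω := Ω) (f := fun x => ‖zeroExt b x‖ₑ)
      fun x hx => by simp [zeroExt_of_notMem b hx]]
    simp only [zeroExt_coe]
  have hfM : ∀ β, ∫⁻ x, ‖f β x‖ₑ ≤ ENNReal.ofReal C * ∫⁻ x : Ω, ‖β.1.1 x‖ₑ := by
    intro β
    rw [← hz, ← lintegral_const_mul' _ _ ENNReal.ofReal_ne_top]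
    refine lintegral_mono fun x => ?_
    rw [hf, enorm_mul]
    gcongr
    rw [← ofReal_norm]
    exact ENNReal.ofReal_le_ofReal (hC x)
  have hGM : ∀ β, ∫⁻ x, ‖G β x‖ₑ ≤ ENNReal.ofReal C * (∫⁻ x : Ω, ‖β.1.2 x‖ₑ)
      + ENNReal.ofReal C' * ∫⁻ x : Ω, ‖β.1.1 x‖ₑ := by
    intro β
    rw [← hz, ← hz, ← lintegral_const_mul' _ _ ENNReal.ofReal_ne_top,
      ← lintegral_const_mul' _ _ ENNReal.ofReal_ne_top, ← lintegral_add_left']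
    · refine lintegral_mono fun x => (enorm_add_le _ _).trans ?_
      rw [enorm_smul, enorm_smul, mul_comm ‖zeroExt _ x‖ₑ]
      gcongr
      · rw [← ofReal_norm]
        exact ENNReal.ofReal_le_ofReal (hC x)
      · rw [← ofReal_norm]
        exact ENNReal.ofReal_le_ofReal (hC' x)
    · exact ((integrable_zeroExt (hmem β).2).1.enorm).const_mul _
  set M : ℝ≥0∞ := ENNReal.ofReal C * M₁ + (ENNReal.ofReal C * M₂ + ENNReal.ofReal C' * M₁) with hM
  have hMtop : M ≠ ⊤ := by
    have h1 : ∀ {c : ℝ} {N : ℝ≥0∞}, N ≠ ⊤ → ENNReal.ofReal c * N ≠ ⊤ := fun hN =>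
      ENNReal.mul_ne_top ENNReal.ofReal_ne_top hN
    exact ENNReal.add_ne_top.2 ⟨h1 hM₁, ENNReal.add_ne_top.2 ⟨h1 hM₂, h1 hM₁⟩⟩
  -- The cut-off turns zero extensions into Sobolev functions on the whole space with a common
  -- support and a common `L¹` bound on the gradients.
  have key := tendsto_lintegral_enorm_sub_of_weak (f := fun k => f (α k)) (f₀ := f α₀)
    (g := fun k => G (α k)) (g₀ := G α₀) hMtop (fun k => hfi _) (hfi _) (fun k => hfR _) (hfR _)
    (fun k => hGm _) (hGm _) (fun k => hfG _) (hfG _)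
    (fun k => (hfM _).trans ((mul_le_mul_right (hM₁k k) _).trans le_self_add))
    (fun k => (hGM _).trans ((add_le_add (mul_le_mul_right (hM₂k k) _)
      (mul_le_mul_right (hM₁k k) _)).trans le_add_self))
    ((hGM _).trans ((add_le_add (mul_le_mul_right hM₂₀ _)
      (mul_le_mul_right hM₁₀ _)).trans le_add_self)) ?_
  · refine key.congr fun k => ?_
    rw [← lintegral_coe (Ω := Ω) (f := fun x => ‖f (α k) x - f α₀ x‖ₑ) fun x hx => by
      simp [hf, zeroExt_of_notMem _ hx]]
    simp only [hf, zeroExt_coe, mul_sub]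
  · intro ψ hψ hψc
    have hW : MemLp (fun x : Ω => χ x * ψ x) q' := by
      obtain ⟨c, hc⟩ := HasCompactSupport.exists_bound_of_continuous (f := fun x => χ x * ψ x)
        hχc.mul_right (hχ.continuous.mul hψ)
      exact MemLp.of_bound
        ((hχ.continuous.mul hψ).comp continuous_subtype_val).aestronglyMeasurable c
        (Eventually.of_forall fun x : Ω => hc x)
    have h1 := ha.tendsto_integral_inner hW
    have h2 : ∀ β : sobolev Ω q, ∫ x, f β x * ψ x
        = ∫ x : Ω, inner ℝ (χ x * ψ x) (β.1.1 x) := by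
      intro β
      rw [← integral_coe (Ω := Ω) (f := fun x => f β x * ψ x) fun x hx => by
        simp [hf, zeroExt_of_notMem _ hx]]
      refine integral_congr_ae (Eventually.of_forall fun x => ?_)
      simp only [hf, zeroExt_coe]
      change χ x * β.1.1 x * ψ x = β.1.1 x * (starRingEnd ℝ) (χ x * ψ x)
      simp only [RCLike.conj_to_real]
      ring
    simpa only [h2] using h1

end Compactness

/-! ### The critical product away from concentration points. -/

section Concentration

variable {n : ℕ}

/-- A finite smooth partition of unity subordinate to small balls around the points of a
compact set. -/
lemma exists_finite_partition {K U : Set (Space n)} (hK : IsCompact K) (hU : IsOpen U)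
    (hKU : K ⊆ U) {P : Space n → ℝ → Prop} (hP : ∀ x ∈ K, ∃ r, 0 < r ∧ P x r) :
    ∃ (N : ℕ) (c : Fin N → Space n) (r : Fin N → ℝ) (φ : Fin N → Space n → ℝ),
      (∀ i, P (c i) (r i)) ∧ (∀ i, ContDiff ℝ ∞ (φ i)) ∧ (∀ i, HasCompactSupport (φ i)) ∧
      (∀ i, tsupport (φ i) ⊆ Metric.ball (c i) (r i) ∩ U) ∧ (∀ i x, 0 ≤ φ i x) ∧
      (∀ x ∈ K, ∑ i, φ i x = 1) ∧ ∀ x, ∑ i, φ i x ≤ 1 := by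
  choose! ρ hρ hPρ using hP
  obtain ⟨t, htK, htc⟩ := hK.elim_nhds_subcover (fun x => Metric.ball x (ρ x))
    fun x hx => Metric.ball_mem_nhds x (hρ x hx)
  set e := t.equivFin
  set c : Fin t.card → Space n := fun i => (e.symm i).1
  have hcK : ∀ i, c i ∈ K := fun i => htK _ (e.symm i).2
  obtain ⟨f, hf⟩ := SmoothPartitionOfUnity.exists_isSubordinate
    (modelWithCornersSelf ℝ (Space n)) hK.isClosed
    (fun i => Metric.ball (c i) (ρ (c i)) ∩ U) (fun i => Metric.isOpen_ball.inter hU)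
    (fun x hx => by
      obtain ⟨y, hy, hxy⟩ := mem_iUnion₂.1 (htc hx)
      refine mem_iUnion.2 ⟨e ⟨y, hy⟩, ?_, hKU hx⟩
      simpa [c] using hxy)
  refine ⟨t.card, c, fun i => ρ (c i), fun i => f i, fun i => hPρ _ (hcK i),
    fun i => (f i).contMDiff.contDiff, fun i => ?_, fun i => hf i, fun i x => f.nonneg i x,
    fun x hx => ?_, fun x => ?_⟩
  · exact Metric.isCompact_of_isClosed_isBounded (isClosed_tsupport _)
      (Metric.isBounded_ball.subset ((hf i).trans inter_subset_left))
  · rw [← finsum_eq_sum_of_fintype]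
    exact f.sum_eq_one hx
  · rw [← finsum_eq_sum_of_fintype]
    exact f.sum_le_one x

/-- On each small ball Hölder pairs the `L^n` norm of `g`, at most `δ`, with the `L^{n/(n-1)}` norm
of a localised `w`, bounded linearly by the local mass of `m` and a lower order term. Linearity lets
a partition of unity add the local masses up to at most `M`, so `C` does not depend on how many
balls are needed. -/
lemma exists_eventually_lintegral_le_of_no_concentration (hn : 2 ≤ n) (Ω : Opens (Space n)) :
    ∃ C : ℝ≥0, ∀ (w : ℕ → Ω → Space n) (m : ℕ → Measure Ω) (g : ℕ → Ω → Space n) (M δ : ℝ≥0∞)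
      (l : Filter ℕ) (K : Set (Space n)), (∀ k, Integrable (w k)) → (∀ k, m k univ ≤ M) → M ≠ ⊤ →
      (∀ k, AEStronglyMeasurable (g k)) →
      (∀ (k : ℕ) (ξ : Space n) (φ : Space n → ℝ), ContDiff ℝ ∞ φ → HasCompactSupport φ →
        tsupport φ ⊆ Ω →
        |∫ x : Ω, inner ℝ (w k x) ξ * fderiv ℝ φ x ξ| ≤ ‖ξ‖ ^ 2 * ∫ x : Ω, |φ x| ∂(m k)) →
      Tendsto (fun k => ∫⁻ x : Ω, ‖w k x‖ₑ) l (𝓝 0) → IsCompact K → K ⊆ Ω →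
      (∀ x ∈ K, ∃ r, 0 < r ∧ ∀ᶠ k in l,
        ∫⁻ y in (Subtype.val : Ω → Space n) ⁻¹' Metric.ball x r, ‖g k y‖ₑ ^ (n : ℝ) ≤ δ ^ (n : ℝ)) →
      ∀ᶠ k in l, ∫⁻ x in (Subtype.val : Ω → Space n) ⁻¹' K, ‖w k x‖ₑ * ‖g k x‖ₑ
        ≤ C * δ * (M + 1) := by
  obtain ⟨C, hC⟩ := exists_lintegral_cutoff_rpow_le hn Ω
  have hn1 : (1 : ℝ) < n := by exact_mod_cast (by omega : 1 < n)
  set s : ℝ := (n : ℝ) / (n - 1) with hs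
  have hs0 : 0 < s := div_pos (by linarith) (by linarith)
  have hconj : Real.HolderConjugate s n := (Real.HolderConjugate.conjExponent hn1).symm
  refine ⟨C ^ (1 / s), fun w m g M δ l K hw hmM hM hg hdef hlim hK hKΩ hconc => ?_⟩
  have hfin : ∀ k, IsFiniteMeasure (m k) := fun k => ⟨(hmM k).trans_lt hM.lt_top⟩
  obtain ⟨N, c, r, φ, hP, hφ, hφc, hφU, hφ0, hφ1, hφle⟩ := exists_finite_partition hK Ω.isOpen hKΩ
    (P := fun x r => ∀ᶠ k in l,
      ∫⁻ y in (Subtype.val : Ω → Space n) ⁻¹' Metric.ball x r, ‖g k y‖ₑ ^ (n : ℝ) ≤ δ ^ (n : ℝ))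
    hconc
  have hφΩ : ∀ i, tsupport (φ i) ⊆ Ω := fun i => (hφU i).trans inter_subset_right
  have hb : ∀ i, ∃ A : ℝ, ∀ x, ‖fderiv ℝ (φ i) x‖ ≤ A := fun i =>
    ((hφc i).fderiv (𝕜 := ℝ)).exists_bound_of_continuous ((hφ i).continuous_fderiv (by simp))
  choose A hA using hb
  have hφm : ∀ i, Continuous fun x : Ω => φ i x := fun i =>
    (hφ i).continuous.comp continuous_subtype_val
  have hmeasφw : ∀ i k, AEMeasurable fun x : Ω => ‖φ i x • w k x‖ₑ := fun i k =>
    ((hφm i).aestronglyMeasurable.smul (hw k).1).enorm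
  set S : ℝ≥0∞ := ∑ i, ENNReal.ofReal (A i) with hS
  have hStop : S ≠ ⊤ := ENNReal.sum_ne_top.2 fun i _ => ENNReal.ofReal_ne_top
  -- The gradients of the partition may be huge but are fixed before `k`, and `w k` tends to zero in
  -- `L¹`; this is the `1` in `M + 1`.
  have hsmall : ∀ᶠ k in l, S * ∫⁻ x : Ω, ‖w k x‖ₑ ≤ 1 := by
    have := ENNReal.Tendsto.const_mul (a := S) hlim (Or.inr hStop)
    rw [mul_zero] at this
    filter_upwards [this.eventually (gt_mem_nhds zero_lt_one)] with k hk using hk.le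
  have hev : ∀ᶠ k in l, ∀ i, ∫⁻ y in (Subtype.val : Ω → Space n) ⁻¹' Metric.ball (c i) (r i),
      ‖g k y‖ₑ ^ (n : ℝ) ≤ δ ^ (n : ℝ) := eventually_all.2 hP
  filter_upwards [hsmall, hev] with k hk1 hk2
  have hterm : ∀ i, ∫⁻ x : Ω, ‖φ i x • w k x‖ₑ * ‖g k x‖ₑ ≤
      (C : ℝ≥0∞) ^ (1 / s) * (∫⁻ x : Ω, ‖φ i x‖ₑ ∂(m k)
        + ∫⁻ x : Ω, ‖fderiv ℝ (φ i) x‖ₑ * ‖w k x‖ₑ) * δ := by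
    intro i
    set B : Set Ω := (Subtype.val : Ω → Space n) ⁻¹' Metric.ball (c i) (r i) with hB
    have hBm : MeasurableSet B := Metric.isOpen_ball.measurableSet.preimage measurable_subtype_coe
    have e1 : ∫⁻ x : Ω, ‖φ i x • w k x‖ₑ * ‖g k x‖ₑ
        = ∫⁻ x in B, ‖φ i x • w k x‖ₑ * ‖g k x‖ₑ := by
      refine (setLIntegral_eq_of_support_subset fun x hx => ?_).symm
      by_contra hxB
      have : φ i x = 0 := image_eq_zero_of_notMem_tsupport fun h => hxB (hφU i h).1
      exact hx (by simp [this])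
    rw [e1]
    refine (ENNReal.lintegral_mul_le_Lp_mul_Lq (volume.restrict B) hconj (hmeasφw i k).restrict
      ((hg k).enorm.restrict)).trans ?_
    gcongr
    · have h1 : ∫⁻ x in B, ‖φ i x • w k x‖ₑ ^ s
          ≤ C * (∫⁻ x : Ω, ‖φ i x‖ₑ ∂(m k) + ∫⁻ x : Ω, ‖fderiv ℝ (φ i) x‖ₑ * ‖w k x‖ₑ) ^ s := by
        refine (lintegral_mono' Measure.restrict_le_self le_rfl).trans ?_
        refine le_trans (le_of_eq ?_) (hC (w k) (m k) (hw k) (hdef k) (φ i) (hφ i) (hφc i) (hφΩ i))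
        rw [← lintegral_coe (Ω := Ω) (f := fun x => ‖φ i x • zeroExt (w k) x‖ₑ ^ s) fun x hx => by
          simp [zeroExt_of_notMem _ hx, hs0]]
        simp only [zeroExt_coe]
      -- The root cancels the Sobolev exponent and makes the estimate linear in the local mass.
      refine (ENNReal.rpow_le_rpow h1 (by positivity)).trans_eq ?_
      rw [ENNReal.mul_rpow_of_nonneg _ _ (by positivity), ← ENNReal.rpow_mul,
        mul_one_div_cancel hs0.ne', ENNReal.rpow_one]
    · refine (ENNReal.rpow_le_rpow (hk2 i) (by positivity)).trans_eq ?_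
      rw [← ENNReal.rpow_mul, mul_one_div_cancel (by linarith), ENNReal.rpow_one]
  have hKm : MeasurableSet ((Subtype.val : Ω → Space n) ⁻¹' K) :=
    hK.isClosed.measurableSet.preimage measurable_subtype_coe
  calc ∫⁻ x in (Subtype.val : Ω → Space n) ⁻¹' K, ‖w k x‖ₑ * ‖g k x‖ₑ
      ≤ ∫⁻ x in (Subtype.val : Ω → Space n) ⁻¹' K, ∑ i, ‖φ i x • w k x‖ₑ * ‖g k x‖ₑ := by
        refine setLIntegral_mono' hKm fun x hx => ?_
        simp only [enorm_smul]
        rw [← Finset.sum_mul, ← Finset.sum_mul]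
        have : ∑ i, ‖φ i x‖ₑ = 1 := by
          have h1 : ∀ i, ‖φ i x‖ₑ = ENNReal.ofReal (φ i x) := fun i =>
            Real.enorm_of_nonneg (hφ0 i x)
          simp only [h1]
          rw [← ENNReal.ofReal_sum_of_nonneg fun i _ => hφ0 i x, hφ1 x hx, ENNReal.ofReal_one]
        rw [this, one_mul]
    _ ≤ ∫⁻ x : Ω, ∑ i, ‖φ i x • w k x‖ₑ * ‖g k x‖ₑ :=
        lintegral_mono' Measure.restrict_le_self le_rfl
    _ = ∑ i, ∫⁻ x : Ω, ‖φ i x • w k x‖ₑ * ‖g k x‖ₑ :=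
        lintegral_finsetSum' _ fun i _ => (hmeasφw i k).mul (hg k).enorm
    _ ≤ ∑ i, (C : ℝ≥0∞) ^ (1 / s) * (∫⁻ x : Ω, ‖φ i x‖ₑ ∂(m k)
        + ∫⁻ x : Ω, ‖fderiv ℝ (φ i) x‖ₑ * ‖w k x‖ₑ) * δ := Finset.sum_le_sum fun i _ => hterm i
    _ = (C : ℝ≥0∞) ^ (1 / s) * δ * (∑ i, ∫⁻ x : Ω, ‖φ i x‖ₑ ∂(m k)
        + ∑ i, ∫⁻ x : Ω, ‖fderiv ℝ (φ i) x‖ₑ * ‖w k x‖ₑ) := by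
        rw [← Finset.sum_add_distrib, Finset.mul_sum]
        exact Finset.sum_congr rfl fun i _ => by ring
    _ ≤ (C : ℝ≥0∞) ^ (1 / s) * δ * (M + 1) := by
        gcongr
        · rw [← lintegral_finsetSum' _ fun i _ => (hφm i).enorm.measurable.aemeasurable]
          refine le_trans ?_ (hmM k)
          rw [← lintegral_one]
          refine lintegral_mono fun x => ?_
          have h1 : ∀ i, ‖φ i x‖ₑ = ENNReal.ofReal (φ i x) := fun i =>
            Real.enorm_of_nonneg (hφ0 i x)
          simp only [h1]
          rw [← ENNReal.ofReal_sum_of_nonneg fun i _ => hφ0 i x]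
          exact ENNReal.ofReal_le_one.2 (hφle x)
        · refine le_trans ?_ hk1
          rw [hS, Finset.sum_mul]
          refine Finset.sum_le_sum fun i _ => ?_
          rw [← lintegral_const_mul' _ _ ENNReal.ofReal_ne_top]
          refine lintegral_mono fun x => ?_
          gcongr
          rw [← ofReal_norm]
          exact ENNReal.ofReal_le_ofReal (hA i x)
    _ = _ := by rw [ENNReal.coe_rpow_of_nonneg _ (by positivity)]

end Concentration

/-! ### Local integrability of `BD` functions and the chain rule for the plastic strain. -/

section BDFunctions

variable {n : ℕ} {Ω : Opens (Space n)}

/-- The exponent `n / (n - 1)`. -/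
def conjExp (n : ℕ) : ℝ≥0∞ := ENNReal.ofReal ((n : ℝ) / (n - 1))

section

variable [hn : Fact (2 ≤ n)]

lemma one_lt_cast : (1 : ℝ) < n := by exact_mod_cast hn.out

lemma toReal_conjExp : (conjExp n).toReal = (n : ℝ) / (n - 1) :=
  ENNReal.toReal_ofReal (div_nonneg (by positivity) (by linarith [one_lt_cast (n := n)]))

instance instFactOneLeConjExp : Fact (1 ≤ conjExp n) := by
  refine ⟨ENNReal.one_le_ofReal.2 ?_⟩
  have := one_lt_cast (n := n)
  rw [le_div_iff₀ (by linarith)]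
  linarith

instance instHolderConjugateConjExp : ENNReal.HolderConjugate (conjExp n) (n : ℝ≥0∞) := by
  have h : Real.HolderConjugate ((n : ℝ) / (n - 1)) n :=
    (Real.HolderConjugate.conjExponent (one_lt_cast (n := n))).symm
  have := h.ennrealOfReal
  rwa [ENNReal.ofReal_natCast] at this

end

/-- This is the hypothesis of the Sobolev inequality with the variation of the strain as dominating
measure: the polar density is a unit matrix and `‖ξ ⊗ ξ‖ = ‖ξ‖²`. -/
lemma abs_integral_inner_fderiv_le (u : BD Ω) (ξ : Space n) {φ : Space n → ℝ}
    (hφ : ContDiff ℝ ∞ φ) (hφc : HasCompactSupport φ) (hφΩ : tsupport φ ⊆ Ω) :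
    |∫ x : Ω, inner ℝ (u.1 x) ξ * fderiv ℝ φ x ξ|
      ≤ ‖ξ‖ ^ 2 * ∫ x : Ω, |φ x| ∂(BD.strain u).variation := by
  have h := integral_symSq_strain u hφ hφc hφΩ ξ
  rw [← abs_neg, ← h, ← integral_const_mul, ← Real.norm_eq_abs]
  obtain ⟨C, hC⟩ := hφc.exists_bound_of_continuous hφ.continuous
  refine norm_integral_le_of_norm_le ?_ ?_
  · refine Integrable.const_mul ?_ _
    exact Integrable.of_bound (hφ.continuous.abs.comp continuous_subtype_val).aestronglyMeasurable C
      (Eventually.of_forall fun x : Ω => by simpa using hC x)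
  · filter_upwards [norm_polarDensity (BD.strain u)] with x hx
    rw [norm_mul, Real.norm_eq_abs, mul_comm]
    refine mul_le_mul_of_nonneg_right ?_ (abs_nonneg _)
    refine (norm_inner_le_norm (𝕜 := ℝ) _ _).trans ?_
    rw [hx, mul_one, norm_symSq]

lemma memLp_cutoff_BD [hn : Fact (2 ≤ n)] (u : BD Ω) {θ : Space n → ℝ} (hθ : ContDiff ℝ ∞ θ)
    (hθc : HasCompactSupport θ) (hθΩ : tsupport θ ⊆ Ω) :
    MemLp (fun x => θ x • zeroExt u.1 x) (conjExp n) := by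
  obtain ⟨C, hC⟩ := exists_lintegral_cutoff_rpow_le hn.out Ω
  have hu := L1.integrable_coeFn u.1
  have h1 : (1 : ℝ≥0∞) ≤ conjExp n := Fact.out
  refine ⟨hθ.continuous.aestronglyMeasurable.smul (aestronglyMeasurable_zeroExt hu.1), ?_⟩
  rw [eLpNorm_lt_top_iff_lintegral_rpow_enorm_lt_top (zero_lt_one.trans_le h1).ne'
    ENNReal.ofReal_ne_top, toReal_conjExp]
  refine (hC u.1 (BD.strain u).variation hu
    (fun ξ φ hφ hφc hφΩ => abs_integral_inner_fderiv_le u ξ hφ hφc hφΩ) θ hθ hθc hθΩ).trans_lt ?_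
  have hpos : (0 : ℝ) ≤ (n : ℝ) / (n - 1) :=
    div_nonneg (by positivity) (by linarith [one_lt_cast (n := n)])
  refine ENNReal.mul_lt_top ENNReal.coe_lt_top (ENNReal.rpow_lt_top_of_nonneg hpos ?_)
  refine ENNReal.add_ne_top.2 ⟨?_, ?_⟩
  · obtain ⟨c, hc⟩ := hθc.exists_bound_of_continuous hθ.continuous
    exact (Integrable.of_bound (f := fun x : Ω => θ x)
      (hθ.continuous.comp continuous_subtype_val).aestronglyMeasurable c
      (Eventually.of_forall fun x : Ω => hc x)).2.ne
  · obtain ⟨c, hc⟩ := (hθc.fderiv (𝕜 := ℝ)).exists_bound_of_continuous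
      (hθ.continuous_fderiv (by simp))
    have hle : ∫⁻ x : Ω, ‖fderiv ℝ θ x‖ₑ * ‖u.1 x‖ₑ ≤ ENNReal.ofReal c * ∫⁻ x : Ω, ‖u.1 x‖ₑ := by
      rw [← lintegral_const_mul' _ _ ENNReal.ofReal_ne_top]
      refine lintegral_mono fun x => ?_
      gcongr
      rw [← ofReal_norm]
      exact ENNReal.ofReal_le_ofReal (hc x)
    exact (hle.trans_lt (ENNReal.mul_lt_top ENNReal.ofReal_lt_top hu.2)).ne

lemma memLp_cutoff_inner_BD [hn : Fact (2 ≤ n)] (u : BD Ω) {θ : Space n → ℝ}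
    (hθ : ContDiff ℝ ∞ θ) (hθc : HasCompactSupport θ) (hθΩ : tsupport θ ⊆ Ω) (ξ : Space n) :
    MemLp (fun x => θ x * zeroExt (fun y => inner ℝ (u.1 y) ξ) x) (conjExp n) := by
  have h : MemLp (fun x => inner ℝ (θ x • zeroExt u.1 x) ξ) (conjExp n) :=
    (memLp_cutoff_BD u hθ hθc hθΩ).inner_const ξ
  refine h.ae_eq (Eventually.of_forall fun x => ?_)
  by_cases hx : x ∈ Ω
  · lift x to Ω using hx
    simp [inner_smul_left]
  · simp [zeroExt_of_notMem _ hx]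

lemma memLp_coe {F : Type*} [NormedAddCommGroup F] {r : ℝ≥0∞} {f : Space n → F} (hf : MemLp f r) :
    MemLp (fun x : Ω => f x) r := by
  have h := (measurableEmbedding_coe (Ω := Ω)).memLp_map_measure_iff (μ := volume) (g := f) (p := r)
  rw [map_coe_volume] at h
  exact h.1 (hf.restrict _)

lemma integrable_inner_mul_mul_inner [hn : Fact (2 ≤ n)] (u : BD Ω) (α : sobolev Ω (n : ℝ≥0∞))
    {θ : Space n → ℝ} (hθ : ContDiff ℝ ∞ θ) (hθc : HasCompactSupport θ) (hθΩ : tsupport θ ⊆ Ω)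
    {f : ℝ → ℝ} (hf : Continuous f) {C : ℝ} (hC : ∀ s, ‖f s‖ ≤ C) (ξ : Space n) :
    Integrable fun x : Ω =>
      inner ℝ (u.1 x) ξ * (θ x * f (α.1.1 x)) * inner ℝ ξ (α.1.2 x) := by
  have hθu : MemLp (fun x : Ω => θ x * inner ℝ (u.1 x) ξ) (conjExp n) := by
    simpa only [zeroExt_coe] using memLp_coe (Ω := Ω) (memLp_cutoff_inner_BD u hθ hθc hθΩ ξ)
  have hgm : MemLp (fun x : Ω => inner ℝ ξ (α.1.2 x)) (n : ℝ≥0∞) := (Lp.memLp _).const_inner ξ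
  have h3 : Integrable fun x : Ω => θ x * inner ℝ (u.1 x) ξ * inner ℝ ξ (α.1.2 x) :=
    hθu.integrable_mul hgm
  refine (h3.mul_bdd (c := C) (hf.comp_aestronglyMeasurable (Lp.aestronglyMeasurable α.1.1))
    (Eventually.of_forall fun x => hC _)).congr (Eventually.of_forall fun x => ?_)
  simp only
  ring

/-- The chain rule for the plastic part of the strain. -/
lemma integral_comp_plastic [hn : Fact (2 ≤ n)] (hΩ : Bornology.IsBounded (Ω : Set (Space n)))
    (u : BD Ω) {p : VectorMeasure Ω (SymMat n)} {e : Ω → SymMat n} (he : Integrable e)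
    (h : BD.strain u = (volume : Measure Ω).withDensityᵥ e + p)
    {α : sobolev Ω (n : ℝ≥0∞)} {at' : Ω → ℝ} (hα : IsQuasicontinuousRep Ω n α at')
    {θ : Space n → ℝ} (hθ : ContDiff ℝ ∞ θ) (hθc : HasCompactSupport θ) (hθΩ : tsupport θ ⊆ Ω)
    {v : ℝ → ℝ} (hv : ContDiff ℝ ∞ v) (hvc : HasCompactSupport v) {ξ : Space n} (hξ : ξ ≠ 0) :
    AEStronglyMeasurable
        (fun x : Ω => θ x * v (at' x) * inner ℝ (symSq ξ) (polarDensity p x)) p.variation ∧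
      ∫ x : Ω, θ x * v (at' x) * inner ℝ (symSq ξ) (polarDensity p x) ∂p.variation =
        - (∫ x : Ω, θ x * v (α.1.1 x) * inner ℝ (symSq ξ) (e x))
        - (∫ x : Ω, inner ℝ (u.1 x) ξ * (v (α.1.1 x) * fderiv ℝ θ x ξ))
        - ∫ x : Ω, inner ℝ (u.1 x) ξ * (θ x * deriv v (α.1.1 x)) * inner ℝ ξ (α.1.2 x) := by
  have hfin : IsFiniteMeasure (volume : Measure Ω) := ⟨volume_opens_lt_top hΩ⟩
  have hu := L1.integrable_coeFn u.1
  have huξ : Integrable fun x : Ω => inner ℝ (u.1 x) ξ := hu.inner_const ξ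
  have hθu := memLp_cutoff_inner_BD u hθ hθc hθΩ ξ
  obtain ⟨h1, h2⟩ := integral_comp_quasicontinuous hΩ (q := (n : ℝ≥0∞)) (q' := conjExp n)
    (ENNReal.natCast_ne_top n) (m := p.variation)
    (d := fun x => inner ℝ (symSq ξ) (polarDensity p x))
    (e := fun x => inner ℝ (symSq ξ) (e x)) (w := fun x => inner ℝ (u.1 x) ξ)
    ((integrable_polarDensity p).const_inner _) (he.const_inner _) huξ hξ
    (fun φ hφ hφc hφΩ => integral_symSq_split u he h hφ hφc hφΩ ξ) hα hθ hθc hθΩ hθu hv hvc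
  refine ⟨h1, ?_⟩
  obtain ⟨Cv, hCv⟩ := hvc.exists_bound_of_continuous hv.continuous
  have hdvc : Continuous (deriv v) := hv.continuous_deriv (by simp)
  obtain ⟨Cv', hCv'⟩ := hvc.deriv.exists_bound_of_continuous hdvc
  have hcθ : Continuous fun x => fderiv ℝ θ x ξ :=
    (hθ.continuous_fderiv (by simp)).clm_apply continuous_const
  obtain ⟨Cθ', hCθ'⟩ := (hθc.fderiv_apply (𝕜 := ℝ) ξ).exists_bound_of_continuous hcθ
  have ham : AEStronglyMeasurable α.1.1 := Lp.aestronglyMeasurable _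
  have i1 : Integrable fun x : Ω => inner ℝ (u.1 x) ξ * (v (α.1.1 x) * fderiv ℝ θ x ξ) := by
    refine huξ.mul_bdd (c := Cv * Cθ') ((hv.continuous.comp_aestronglyMeasurable ham).mul
      (hcθ.comp continuous_subtype_val).aestronglyMeasurable) (Eventually.of_forall fun x => ?_)
    rw [norm_mul]
    exact mul_le_mul (hCv _) (hCθ' x) (norm_nonneg _) ((norm_nonneg _).trans (hCv 0))
  have i2 : Integrable fun x : Ω =>
      inner ℝ (u.1 x) ξ * (θ x * deriv v (α.1.1 x)) * inner ℝ ξ (α.1.2 x) :=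
    integrable_inner_mul_mul_inner u α hθ hθc hθΩ hdvc hCv' ξ
  have e1 : ∫ x : Ω, θ x * v (at' x) * inner ℝ (symSq ξ) (e x)
      = ∫ x : Ω, θ x * v (α.1.1 x) * inner ℝ (symSq ξ) (e x) :=
    integral_congr_ae (by filter_upwards [hα.2] with x hx; rw [hx])
  have e2 : ∫ x : Ω, inner ℝ (u.1 x) ξ * (v (at' x) * fderiv ℝ θ x ξ
      + θ x * deriv v (at' x) * inner ℝ (α.1.2 x) ξ)
      = (∫ x : Ω, inner ℝ (u.1 x) ξ * (v (α.1.1 x) * fderiv ℝ θ x ξ))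
        + ∫ x : Ω, inner ℝ (u.1 x) ξ * (θ x * deriv v (α.1.1 x)) * inner ℝ ξ (α.1.2 x) := by
    rw [← integral_add i1 i2]
    refine integral_congr_ae ?_
    filter_upwards [hα.2] with x hx
    rw [hx, real_inner_comm ξ (α.1.2 x)]
    ring
  rw [e1, e2] at h2
  linarith

end BDFunctions

/-! ### Polarisation, concentration points and the data of the theorem. -/

section Compactness

variable {n : ℕ} {Ω : Opens (Space n)}

/-- Polarisation: the squares `ξ ⊗ ξ` span the symmetric matrices, so properties stable under linear
combinations need only the one-directional case. -/
lemma symMat_induction {P : SymMat n → Prop} (hadd : ∀ a b, P a → P b → P (a + b))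
    (hsmul : ∀ (c : ℝ) a, P a → P (c • a)) (hsq : ∀ ξ, P (symSq ξ)) (a : SymMat n) : P a := by
  have h0 : P 0 := by simpa using hsmul 0 _ (hsq 0)
  have hsub : ∀ a b, P a → P b → P (a - b) := fun a b ha hb => by
    have := hadd _ _ ha (hsmul (-1) _ hb)
    rwa [neg_one_smul, ← sub_eq_add_neg] at this
  rw [symMat_eq_sum a]
  refine Finset.sum_induction _ P hadd h0 fun i _ => Finset.sum_induction _ P hadd h0 fun j _ => ?_
  exact hsmul _ _ (hsub _ _ (hsub _ _ (hsq _) (hsq _)) (hsq _))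

/-- The points at which the measures `f k` concentrate at least the mass `δ`. -/
lemma finite_concentration {f : ℕ → Ω → ℝ≥0∞} {M δ : ℝ≥0∞} (hM : ∀ k, ∫⁻ x, f k x ≤ M)
    (hMtop : M ≠ ⊤) (hδ : δ ≠ 0) (𝒰 : Ultrafilter ℕ) :
    {x : Space n | ∀ r > 0, ∀ᶠ k in (𝒰 : Filter ℕ),
      δ < ∫⁻ y in (Subtype.val : Ω → Space n) ⁻¹' Metric.ball x r, f k y}.Finite := by
  by_contra hinf
  -- With `N δ > M`, having `N` concentration points is impossible: they have disjoint balls, each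
  -- of mass above `δ` for a common index `k`.
  obtain ⟨N, hN⟩ := ENNReal.exists_nat_mul_gt hδ hMtop
  obtain ⟨s, hs, hcard⟩ := Set.Infinite.exists_subset_card_eq hinf N
  obtain ⟨U, hU, hdisj⟩ := s.finite_toSet.t2_separation
  have hr : ∀ x, ∃ r > 0, Metric.ball x r ⊆ U x := fun x =>
    Metric.isOpen_iff.1 (hU x).2 x (hU x).1
  choose r hr0 hrU using hr
  have hev : ∀ᶠ k in (𝒰 : Filter ℕ), ∀ x ∈ s,
      δ < ∫⁻ y in (Subtype.val : Ω → Space n) ⁻¹' Metric.ball x (r x), f k y :=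
    (Filter.eventually_all_finset s).2 fun x hx => hs hx (r x) (hr0 x)
  obtain ⟨k, hk⟩ := hev.exists
  have h1 : ∫⁻ y in ⋃ x ∈ s, (Subtype.val : Ω → Space n) ⁻¹' Metric.ball x (r x), f k y
      = ∑ x ∈ s, ∫⁻ y in (Subtype.val : Ω → Space n) ⁻¹' Metric.ball x (r x), f k y := by
    refine lintegral_biUnion_finset ?_ (fun x _ =>
      measurable_subtype_coe Metric.isOpen_ball.measurableSet) _
    intro x hx y hy hxy
    exact ((hdisj hx hy hxy).mono (hrU x) (hrU y)).preimage _
  have h2 : (N : ℝ≥0∞) * δ ≤ M := by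
    calc (N : ℝ≥0∞) * δ = ∑ _x ∈ s, δ := by rw [Finset.sum_const, hcard, nsmul_eq_mul]
      _ ≤ ∑ x ∈ s, ∫⁻ y in (Subtype.val : Ω → Space n) ⁻¹' Metric.ball x (r x), f k y :=
          Finset.sum_le_sum fun x hx => (hk x hx).le
      _ = _ := h1.symm
      _ ≤ ∫⁻ x, f k x := setLIntegral_le_lintegral _ _
      _ ≤ M := hM k
  exact (hN.trans_le h2).false

variable [hn : Fact (2 ≤ n)]

lemma tendsto_lintegral_cutoff_comp_sub (hΩ : Bornology.IsBounded (Ω : Set (Space n)))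
    {α : ℕ → sobolev Ω (n : ℝ≥0∞)} {α₀ : sobolev Ω (n : ℝ≥0∞)} (h : WeakTendsto α α₀)
    {χ : Space n → ℝ} (hχ : ContDiff ℝ ∞ χ) (hχc : HasCompactSupport χ) (hχΩ : tsupport χ ⊆ Ω)
    {f : ℝ → ℝ} {L : ℝ≥0} (hf : LipschitzWith L f) :
    Tendsto (fun k => ∫⁻ x : Ω, ‖χ x * f ((α k).1.1 x) - χ x * f (α₀.1.1 x)‖ₑ) atTop (𝓝 0) := by
  have h1 := tendsto_lintegral_cutoff_sub hΩ (q' := conjExp n) h hχ hχc hχΩ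
  have h2 := ENNReal.Tendsto.const_mul h1 (a := (L : ℝ≥0∞)) (Or.inr ENNReal.coe_ne_top)
  rw [mul_zero] at h2
  refine tendsto_of_tendsto_of_tendsto_of_le_of_le tendsto_const_nhds h2 (fun _ => zero_le)
    fun k => ?_
  simp only
  rw [← lintegral_const_mul' _ _ ENNReal.coe_ne_top]
  refine lintegral_mono fun x => ?_
  rw [← mul_sub, enorm_mul, enorm_mul, mul_left_comm]
  gcongr
  have := hf ((α k).1.1 x) (α₀.1.1 x)
  rwa [edist_eq_enorm_sub, edist_eq_enorm_sub] at this

/-- A sequence as in the lower semicontinuity theorem: displacements `u k`, elastic strains `e k`,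
plastic strains `p k` and damage variables `α k` with quasicontinuous representatives `αt k`. -/
structure PlasticSequence (Ω : Opens (Space n)) (q : ℝ≥0∞) [Fact (1 ≤ q)] where
  isBounded : Bornology.IsBounded (Ω : Set (Space n))
  one_lt : 1 < q
  α : ℕ → sobolev Ω (n : ℝ≥0∞)
  α₀ : sobolev Ω (n : ℝ≥0∞)
  u : ℕ → BD Ω
  u₀ : BD Ω
  e : ℕ → Lp (SymMat n) q (volume : Measure Ω)
  e₀ : Lp (SymMat n) q (volume : Measure Ω)
  p : ℕ → VectorMeasure Ω (SymMat n)
  p₀ : VectorMeasure Ω (SymMat n)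
  split : ∀ k, BD.strain (u k) = (volume : Measure Ω).withDensityᵥ (e k) + p k
  split₀ : BD.strain u₀ = (volume : Measure Ω).withDensityᵥ e₀ + p₀
  tendsto_u : BD.WeakStarTendsto u u₀
  tendsto_e : WeakTendsto e e₀
  tendsto_α : WeakTendsto α α₀
  αt : ℕ → Ω → ℝ
  αt₀ : Ω → ℝ
  isRep : ∀ k, IsQuasicontinuousRep Ω n (α k) (αt k)
  isRep₀ : IsQuasicontinuousRep Ω n α₀ αt₀

namespace PlasticSequence

variable {q : ℝ≥0∞} [hq1 : Fact (1 ≤ q)] (S : PlasticSequence Ω q)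

/-- The points where the gradients of the damage variables concentrate. -/
def concentrationSet (𝒰 : Ultrafilter ℕ) (δ : ℝ≥0) : Set (Space n) :=
  {x : Space n | ∀ r > 0, ∀ᶠ k in (𝒰 : Filter ℕ), (δ : ℝ≥0∞) ^ (n : ℝ) <
    ∫⁻ y in (Subtype.val : Ω → Space n) ⁻¹' Metric.ball x r, ‖(S.α k).1.2 y‖ₑ ^ (n : ℝ)}

lemma finite_concentrationSet (𝒰 : Ultrafilter ℕ) {δ : ℝ≥0} (hδ : 0 < δ) :
    (S.concentrationSet 𝒰 δ).Finite := by
  have hg := S.tendsto_α.map sobolevGrad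
  simp only [sobolevGrad_apply] at hg
  obtain ⟨C, hC⟩ := hg.exists_norm_le
  have hn0 : (n : ℝ≥0∞) ≠ 0 := by
    have := hn.out
    exact_mod_cast (by omega : n ≠ 0)
  refine finite_concentration (M := ENNReal.ofReal C ^ (n : ℝ)) (fun k => ?_)
    (ENNReal.rpow_ne_top_of_nonneg (by positivity) ENNReal.ofReal_ne_top) ?_ 𝒰
  · have h1 : eLpNorm (S.α k).1.2 (n : ℝ≥0∞) volume ≤ ENNReal.ofReal C := by
      have := hC k
      rw [Lp.norm_def] at this
      exact (ENNReal.le_ofReal_iff_toReal_le (Lp.eLpNorm_ne_top _)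
        (ENNReal.toReal_nonneg.trans this)).2 this
    have h2 := ENNReal.rpow_le_rpow h1 (z := (n : ℝ)) (by positivity)
    refine le_trans (le_of_eq ?_) h2
    rw [eLpNorm_eq_lintegral_rpow_enorm_toReal hn0 (ENNReal.natCast_ne_top n), ← ENNReal.rpow_mul,
      ENNReal.toReal_natCast, one_div_mul_cancel (by exact_mod_cast hn0), ENNReal.rpow_one]
  · exact (ENNReal.rpow_pos (by exact_mod_cast hδ) ENNReal.coe_ne_top).ne'

end PlasticSequence

end Compactness

/-! ### The three terms of the chain rule along the sequence. -/

section Convergence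

variable {n : ℕ} {Ω : Opens (Space n)} [hn : Fact (2 ≤ n)]

lemma conjExponent_ne_top {q : ℝ≥0∞} (hq : 1 < q) : ENNReal.conjExponent q ≠ ⊤ := by
  rw [ENNReal.conjExponent]
  refine ENNReal.add_ne_top.2 ⟨ENNReal.one_ne_top, ?_⟩
  rw [ENNReal.inv_ne_top]
  exact (tsub_pos_of_lt hq).ne'

lemma BD.WeakStarTendsto.tendsto_lintegral {u : ℕ → BD Ω} {u₀ : BD Ω} (h : BD.WeakStarTendsto u u₀) :
    Tendsto (fun k => ∫⁻ x : Ω, ‖(u k).1 x - u₀.1 x‖ₑ) atTop (𝓝 0) := by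
  have h1 := (Lp.tendsto_Lp_iff_tendsto_eLpNorm' _ _).1 h.1
  refine h1.congr fun k => ?_
  rw [eLpNorm_one_eq_lintegral_enorm]
  rfl

lemma abs_integral_inner_sub_fderiv_le (u u₀ : BD Ω) (ξ : Space n) {φ : Space n → ℝ}
    (hφ : ContDiff ℝ ∞ φ) (hφc : HasCompactSupport φ) (hφΩ : tsupport φ ⊆ Ω) :
    |∫ x : Ω, inner ℝ (u.1 x - u₀.1 x) ξ * fderiv ℝ φ x ξ|
      ≤ ‖ξ‖ ^ 2 * ∫ x : Ω, |φ x| ∂((BD.strain u).variation + (BD.strain u₀).variation) := by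
  have hcφ : Continuous fun x => fderiv ℝ φ x ξ :=
    (hφ.continuous_fderiv (by simp)).clm_apply continuous_const
  obtain ⟨C', hC'⟩ := (hφc.fderiv_apply (𝕜 := ℝ) ξ).exists_bound_of_continuous hcφ
  obtain ⟨C, hC⟩ := hφc.exists_bound_of_continuous hφ.continuous
  have hi : ∀ w : BD Ω, Integrable fun x : Ω => inner ℝ (w.1 x) ξ * fderiv ℝ φ x ξ := fun w =>
    ((L1.integrable_coeFn w.1).inner_const ξ).mul_bdd (c := C')
      (hcφ.comp continuous_subtype_val).aestronglyMeasurable (Eventually.of_forall fun x => hC' x)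
  have hm : ∀ w : BD Ω, Integrable (fun x : Ω => |φ x|) (BD.strain w).variation := fun w =>
    Integrable.of_bound (hφ.continuous.abs.comp continuous_subtype_val).aestronglyMeasurable C
      (Eventually.of_forall fun x : Ω => by simpa using hC x)
  simp only [inner_sub_left, sub_mul]
  rw [integral_sub (hi u) (hi u₀), integral_add_measure (hm u) (hm u₀), mul_add]
  exact (abs_sub _ _).trans (add_le_add (abs_integral_inner_fderiv_le u ξ hφ hφc hφΩ)
    (abs_integral_inner_fderiv_le u₀ ξ hφ hφc hφΩ))

namespace PlasticSequence

variable {q : ℝ≥0∞} [hq1 : Fact (1 ≤ q)]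

/-- `θ v(α_k)` is bounded and converges in `L¹`, hence strongly in the exponent conjugate to `q`,
which is finite because `q > 1`; `e_k` converges weakly in `L^q`. -/
lemma tendsto_elastic (S : PlasticSequence Ω q)
    {θ : Space n → ℝ} (hθ : ContDiff ℝ ∞ θ) (hθc : HasCompactSupport θ) (hθΩ : tsupport θ ⊆ Ω)
    {v : ℝ → ℝ} (hv : ContDiff ℝ ∞ v) (hvc : HasCompactSupport v) (a : SymMat n) :
    Tendsto (fun k => ∫ x : Ω, θ x * v ((S.α k).1.1 x) * inner ℝ a (S.e k x)) atTop
      (𝓝 (∫ x : Ω, θ x * v (S.α₀.1.1 x) * inner ℝ a (S.e₀ x))) := by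
  have hfin : IsFiniteMeasure (volume : Measure Ω) := ⟨volume_opens_lt_top S.isBounded⟩
  obtain ⟨Cv, hCv⟩ := hvc.exists_bound_of_continuous hv.continuous
  obtain ⟨Cθ, hCθ⟩ := hθc.exists_bound_of_continuous hθ.continuous
  obtain ⟨L, hL⟩ := hv.lipschitzWith_of_hasCompactSupport hvc (by simp)
  have hF : Fact (1 ≤ ENNReal.conjExponent q) := ⟨by rw [ENNReal.conjExponent]; exact le_self_add⟩
  have hm : ∀ β : sobolev Ω (n : ℝ≥0∞), AEStronglyMeasurable (fun x : Ω => θ x * v (β.1.1 x)) :=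
    fun β => (hθ.continuous.comp continuous_subtype_val).aestronglyMeasurable.mul
      (hv.continuous.comp_aestronglyMeasurable (Lp.aestronglyMeasurable β.1.1))
  have hb : ∀ (β : sobolev Ω (n : ℝ≥0∞)) (x : Ω), ‖θ x * v (β.1.1 x)‖ ≤ Cθ * Cv := fun β x => by
    rw [norm_mul]
    exact mul_le_mul (hCθ _) (hCv _) (norm_nonneg _) ((norm_nonneg _).trans (hCθ 0))
  have h := S.tendsto_e.tendsto_integral_mul_mul_inner (p := ENNReal.conjExponent q)
    (conjExponent_ne_top S.one_lt) (W := fun _ => (1 : ℝ)) (memLp_const 1) (fun k => hm (S.α k))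
    (hm S.α₀) (fun k => hb (S.α k)) (hb S.α₀)
    (tendsto_lintegral_cutoff_comp_sub S.isBounded S.tendsto_α hθ hθc hθΩ hL) a
  simpa only [one_mul] using h

lemma tendsto_lower (S : PlasticSequence Ω q)
    {θ : Space n → ℝ} (hθ : ContDiff ℝ ∞ θ) (hθc : HasCompactSupport θ) (hθΩ : tsupport θ ⊆ Ω)
    {v : ℝ → ℝ} (hv : ContDiff ℝ ∞ v) (hvc : HasCompactSupport v) (ξ : Space n) :
    Tendsto (fun k => ∫ x : Ω, inner ℝ ((S.u k).1 x) ξ * (v ((S.α k).1.1 x) * fderiv ℝ θ x ξ)) atTop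
      (𝓝 (∫ x : Ω, inner ℝ (S.u₀.1 x) ξ * (v (S.α₀.1.1 x) * fderiv ℝ θ x ξ))) := by
  have hcθ : ContDiff ℝ ∞ fun x => fderiv ℝ θ x ξ :=
    (hθ.fderiv_right (m := ∞) (by simp)).clm_apply contDiff_const
  have hcθc : HasCompactSupport fun x => fderiv ℝ θ x ξ := hθc.fderiv_apply (𝕜 := ℝ) ξ
  have hcθΩ : tsupport (fun x => fderiv ℝ θ x ξ) ⊆ Ω :=
    (tsupport_fderiv_apply_subset ℝ ξ).trans hθΩ
  obtain ⟨Cv, hCv⟩ := hvc.exists_bound_of_continuous hv.continuous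
  obtain ⟨Cθ, hCθ⟩ := hcθc.exists_bound_of_continuous hcθ.continuous
  obtain ⟨L, hL⟩ := hv.lipschitzWith_of_hasCompactSupport hvc (by simp)
  have hm : ∀ β : sobolev Ω (n : ℝ≥0∞),
      AEStronglyMeasurable (fun x : Ω => v (β.1.1 x) * fderiv ℝ θ x ξ) :=
    fun β => (hv.continuous.comp_aestronglyMeasurable (Lp.aestronglyMeasurable β.1.1)).mul
      (hcθ.continuous.comp continuous_subtype_val).aestronglyMeasurable
  have hb : ∀ (β : sobolev Ω (n : ℝ≥0∞)) (x : Ω), ‖v (β.1.1 x) * fderiv ℝ θ x ξ‖ ≤ Cv * Cθ :=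
    fun β x => by
      rw [norm_mul]
      exact mul_le_mul (hCv _) (hCθ _) (norm_nonneg _) ((norm_nonneg _).trans (hCv 0))
  have hlim := tendsto_lintegral_cutoff_comp_sub S.isBounded S.tendsto_α hcθ hcθc hcθΩ hL
  have hu := S.tendsto_u.tendsto_lintegral
  have hu' := ENNReal.Tendsto.const_mul hu (a := ‖ξ‖ₑ) (Or.inr enorm_ne_top)
  rw [mul_zero] at hu'
  refine tendsto_integral_mul_of_L1 (fun k => (L1.integrable_coeFn (S.u k).1).inner_const ξ)
    ((L1.integrable_coeFn S.u₀.1).inner_const ξ) ?_ (fun k => hm (S.α k))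
    (hm S.α₀) (fun k => hb (S.α k)) (hb S.α₀) (hlim.congr fun k => ?_)
  · refine tendsto_of_tendsto_of_tendsto_of_le_of_le tendsto_const_nhds hu' (fun _ => zero_le)
      fun k => ?_
    simp only
    rw [← lintegral_const_mul' _ _ enorm_ne_top]
    refine lintegral_mono fun x => ?_
    rw [← inner_sub_left, mul_comm, ← ofReal_norm, ← ofReal_norm, ← ofReal_norm,
      ← ENNReal.ofReal_mul (norm_nonneg _)]
    exact ENNReal.ofReal_le_ofReal (norm_inner_le_norm _ _)
  · simp only [mul_comm]

/-- With the displacement frozen at its limit there is no criticality: a cut-off of it is a fixed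
function in `L^{n/(n-1)}`, against which the weak convergence of the gradients in `L^n` may be
tested. -/
lemma tendsto_gradient (S : PlasticSequence Ω q)
    {θ : Space n → ℝ} (hθ : ContDiff ℝ ∞ θ) (hθc : HasCompactSupport θ) (hθΩ : tsupport θ ⊆ Ω)
    {f : ℝ → ℝ} (hf : ContDiff ℝ ∞ f) (hfc : HasCompactSupport f) (ξ : Space n) :
    Tendsto (fun k => ∫ x : Ω, inner ℝ (S.u₀.1 x) ξ * (θ x * f ((S.α k).1.1 x)) *
        inner ℝ ξ ((S.α k).1.2 x)) atTop
      (𝓝 (∫ x : Ω, inner ℝ (S.u₀.1 x) ξ * (θ x * f (S.α₀.1.1 x)) *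
        inner ℝ ξ (S.α₀.1.2 x))) := by
  obtain ⟨χ, hχ, hχc, hχΩ, hχ1, -⟩ := exists_cutoff hθc.isCompact Ω.isOpen hθΩ
  obtain ⟨Cv, hCv⟩ := hfc.exists_bound_of_continuous hf.continuous
  obtain ⟨Cθ, hCθ⟩ := hθc.exists_bound_of_continuous hθ.continuous
  obtain ⟨L, hL⟩ := hf.lipschitzWith_of_hasCompactSupport hfc (by simp)
  have hm : ∀ β : sobolev Ω (n : ℝ≥0∞), AEStronglyMeasurable (fun x : Ω => θ x * f (β.1.1 x)) :=
    fun β => (hθ.continuous.comp continuous_subtype_val).aestronglyMeasurable.mul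
      (hf.continuous.comp_aestronglyMeasurable (Lp.aestronglyMeasurable β.1.1))
  have hb : ∀ (β : sobolev Ω (n : ℝ≥0∞)) (x : Ω), ‖θ x * f (β.1.1 x)‖ ≤ Cθ * Cv := fun β x => by
    rw [norm_mul]
    exact mul_le_mul (hCθ _) (hCv _) (norm_nonneg _) ((norm_nonneg _).trans (hCθ 0))
  have hW : MemLp (fun x : Ω => χ x * inner ℝ (S.u₀.1 x) ξ) (conjExp n) := by
    simpa only [zeroExt_coe] using memLp_coe (Ω := Ω) (memLp_cutoff_inner_BD S.u₀ hχ hχc hχΩ ξ)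
  have hg := S.tendsto_α.map sobolevGrad
  simp only [sobolevGrad_apply] at hg
  have h := hg.tendsto_integral_mul_mul_inner (p := conjExp n) ENNReal.ofReal_ne_top hW
    (fun k => hm (S.α k)) (hm S.α₀) (fun k => hb (S.α k)) (hb S.α₀)
    (tendsto_lintegral_cutoff_comp_sub S.isBounded S.tendsto_α hθ hθc hθΩ hL) ξ
  have hχθ : ∀ x, χ x * θ x = θ x := fun x => by
    by_cases hx : x ∈ tsupport θ
    · rw [hχ1.self_of_nhdsSet x hx, one_mul]
    · rw [image_eq_zero_of_notMem_tsupport hx, mul_zero]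
  have key : ∀ (x : Ω) (s t r : ℝ), χ x * s * (θ x * t) * r = s * (θ x * t) * r := fun x s t r => by
    linear_combination (s * t * r) * hχθ x
  simpa only [key] using h

/-- The cost of freezing the displacement, from the concentration estimate applied to `u_k - u₀`,
whose deformation is dominated by the sum of the two strain variations. The constant precedes `δ`
and the test functions, so `δ` can later be chosen in terms of bounds on those functions. -/
lemma exists_eventually_abs_gradient_sub_le (S : PlasticSequence Ω q) :
    ∃ C : ℝ, 0 ≤ C ∧ ∀ (𝒰 : Ultrafilter ℕ), (𝒰 : Filter ℕ) ≤ atTop → ∀ (δ : ℝ≥0)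
      (θ : Space n → ℝ), ContDiff ℝ ∞ θ → HasCompactSupport θ → tsupport θ ⊆ Ω →
      Disjoint (tsupport θ) (S.concentrationSet 𝒰 δ) → ∀ T : ℝ, (∀ x, ‖θ x‖ ≤ T) →
      ∀ f : ℝ → ℝ, Continuous f → ∀ L : ℝ, (∀ s, ‖f s‖ ≤ L) → ∀ ξ : Space n,
      ∀ᶠ k in (𝒰 : Filter ℕ),
        |(∫ x : Ω, inner ℝ ((S.u k).1 x) ξ * (θ x * f ((S.α k).1.1 x)) * inner ℝ ξ ((S.α k).1.2 x)) -
          ∫ x : Ω, inner ℝ (S.u₀.1 x) ξ * (θ x * f ((S.α k).1.1 x)) * inner ℝ ξ ((S.α k).1.2 x)|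
        ≤ C * δ * (T * L * ‖ξ‖ ^ 2) := by
  obtain ⟨C, hC⟩ := exists_eventually_lintegral_le_of_no_concentration hn.out Ω
  obtain ⟨M, hM⟩ := exists_variation_le_of_weakStarTendsto S.tendsto_u.2
  have hM' : ∀ k, (BD.strain (S.u k)).variation univ ≤ ENNReal.ofReal M := fun k =>
    (ENNReal.le_ofReal_iff_toReal_le (measure_ne_top _ _)
      (ENNReal.toReal_nonneg.trans (hM k))).2 (hM k)
  set M' : ℝ≥0∞ := ENNReal.ofReal M + (BD.strain S.u₀).variation univ with hM'def
  have hM'top : M' ≠ ⊤ := ENNReal.add_ne_top.2 ⟨ENNReal.ofReal_ne_top, measure_ne_top _ _⟩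
  refine ⟨C * (M' + 1).toReal, by positivity, ?_⟩
  intro 𝒰 h𝒰 δ θ hθ hθc hθΩ hdisj T hT f hf L hL ξ
  have hT0 : 0 ≤ T := (norm_nonneg _).trans (hT 0)
  have hL0 : 0 ≤ L := (norm_nonneg _).trans (hL 0)
  have hev := hC (fun k x => (S.u k).1 x - S.u₀.1 x)
    (fun k => (BD.strain (S.u k)).variation + (BD.strain S.u₀).variation)
    (fun k => (S.α k).1.2) M' δ 𝒰 (tsupport θ)
    (fun k => (L1.integrable_coeFn (S.u k).1).sub (L1.integrable_coeFn S.u₀.1))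
    (fun k => by
      rw [Measure.add_apply]
      exact add_le_add (hM' k) le_rfl) hM'top
    (fun k => Lp.aestronglyMeasurable _)
    (fun k ξ φ hφ hφc hφΩ => abs_integral_inner_sub_fderiv_le (S.u k) S.u₀ ξ hφ hφc hφΩ)
    (S.tendsto_u.tendsto_lintegral.mono_left h𝒰) hθc.isCompact hθΩ
    (fun x hx => by
      have h1 : x ∉ S.concentrationSet 𝒰 δ := disjoint_left.1 hdisj hx
      simp only [concentrationSet, mem_ofPred_eq, not_forall] at h1
      obtain ⟨r, hr, h2⟩ := h1
      refine ⟨r, hr, ?_⟩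
      -- Here the ultrafilter is needed: failure to concentrate eventually becomes eventual
      -- smallness.
      rw [← Ultrafilter.eventually_not] at h2
      filter_upwards [h2] with k hk using not_lt.1 hk)
  filter_upwards [hev] with k hk
  rw [← integral_sub (integrable_inner_mul_mul_inner _ _ hθ hθc hθΩ hf hL ξ)
    (integrable_inner_mul_mul_inner _ _ hθ hθc hθΩ hf hL ξ), ← Real.norm_eq_abs]
  have hpt : ∀ x : Ω, ‖inner ℝ ((S.u k).1 x) ξ * (θ x * f ((S.α k).1.1 x)) * inner ℝ ξ ((S.α k).1.2 x)
      - inner ℝ (S.u₀.1 x) ξ * (θ x * f ((S.α k).1.1 x)) * inner ℝ ξ ((S.α k).1.2 x)‖ₑ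
      ≤ ENNReal.ofReal (T * L * ‖ξ‖ ^ 2) * ((Subtype.val : Ω → Space n) ⁻¹' tsupport θ).indicator
        (fun x => ‖(S.u k).1 x - S.u₀.1 x‖ₑ * ‖(S.α k).1.2 x‖ₑ) x := by
    intro x
    by_cases hx : x.1 ∈ tsupport θ
    · rw [indicator_of_mem (by exact hx), ← sub_mul, ← sub_mul, ← inner_sub_left]
      simp only [← ofReal_norm]
      rw [← ENNReal.ofReal_mul (norm_nonneg _), ← ENNReal.ofReal_mul (by positivity)]
      refine ENNReal.ofReal_le_ofReal ?_
      rw [norm_mul, norm_mul, norm_mul]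
      calc _ ≤ (‖(S.u k).1 x - S.u₀.1 x‖ * ‖ξ‖) * (T * L) * (‖ξ‖ * ‖(S.α k).1.2 x‖) := by
            gcongr
            · exact norm_inner_le_norm _ _
            · exact hT _
            · exact hL _
            · exact norm_inner_le_norm _ _
        _ = _ := by ring
    · rw [image_eq_zero_of_notMem_tsupport hx]
      simp
  have hmain : ‖∫ x : Ω, (inner ℝ ((S.u k).1 x) ξ * (θ x * f ((S.α k).1.1 x)) * inner ℝ ξ ((S.α k).1.2 x)
      - inner ℝ (S.u₀.1 x) ξ * (θ x * f ((S.α k).1.1 x)) * inner ℝ ξ ((S.α k).1.2 x))‖ₑ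
      ≤ ENNReal.ofReal (C * (M' + 1).toReal * δ * (T * L * ‖ξ‖ ^ 2)) := by
    refine (enorm_integral_le_lintegral_enorm _).trans ((lintegral_mono hpt).trans ?_)
    rw [lintegral_const_mul' _ _ ENNReal.ofReal_ne_top, lintegral_indicator
      (measurable_subtype_coe (isClosed_tsupport θ).measurableSet)]
    refine (mul_le_mul_right hk _).trans (le_of_eq ?_)
    have hM1 : M' + 1 ≠ ⊤ := ENNReal.add_ne_top.2 ⟨hM'top, ENNReal.one_ne_top⟩
    have hc : (C : ℝ≥0∞) * δ * (M' + 1) = ENNReal.ofReal (C * (M' + 1).toReal * δ) := by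
      rw [ENNReal.ofReal_mul (by positivity), ENNReal.ofReal_mul (by positivity),
        ENNReal.ofReal_toReal hM1, ENNReal.ofReal_coe_nnreal, ENNReal.ofReal_coe_nnreal]
      ring
    rw [hc, mul_comm, ← ENNReal.ofReal_mul (by positivity)]
  rw [← ofReal_norm] at hmain
  exact (ENNReal.ofReal_le_ofReal_iff (by positivity)).1 hmain

end PlasticSequence

end Convergence

/-! ### Convergence of the pairings and absence of atoms. -/

section Pairing

variable {n : ℕ} {Ω : Opens (Space n)}

lemma symSq_zero : symSq (0 : Space n) = 0 := by
  rw [← norm_eq_zero, norm_symSq]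
  simp

lemma inner_smul_symMat (c : ℝ) (a b : SymMat n) : inner ℝ (c • a) b = c * inner ℝ a b :=
  real_inner_smul_left a b c

/-- The integral `∫ θ v(b) ⟪a, dp⟫`. -/
def pairing (θ : Space n → ℝ) (v : ℝ → ℝ) (a : SymMat n) (b : Ω → ℝ)
    (p : VectorMeasure Ω (SymMat n)) : ℝ :=
  ∫ x : Ω, θ x * v (b x) * inner ℝ a (polarDensity p x) ∂p.variation

variable [hn : Fact (2 ≤ n)]

/-- Measurability is the point, as nothing says directly that `b` is measurable for the variation of
`p`. For `a = ξ ⊗ ξ` the integrand is an almost everywhere limit of measurable functions by the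
chain rule, and polarisation gives the rest. -/
lemma integrable_pairing (hΩ : Bornology.IsBounded (Ω : Set (Space n)))
    (u : BD Ω) {p : VectorMeasure Ω (SymMat n)} {e : Ω → SymMat n} (he : Integrable e)
    (h : BD.strain u = (volume : Measure Ω).withDensityᵥ e + p)
    {α : sobolev Ω (n : ℝ≥0∞)} {b : Ω → ℝ} (hα : IsQuasicontinuousRep Ω n α b)
    {θ : Space n → ℝ} (hθ : ContDiff ℝ ∞ θ) (hθc : HasCompactSupport θ) (hθΩ : tsupport θ ⊆ Ω)
    {v : ℝ → ℝ} (hv : ContDiff ℝ ∞ v) (hvc : HasCompactSupport v) (a : SymMat n) :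
    Integrable (fun x : Ω => θ x * v (b x) * inner ℝ a (polarDensity p x)) p.variation := by
  obtain ⟨Cv, hCv⟩ := hvc.exists_bound_of_continuous hv.continuous
  obtain ⟨Cθ, hCθ⟩ := hθc.exists_bound_of_continuous hθ.continuous
  refine Integrable.of_bound (C := Cθ * Cv * ‖a‖) ?_ ?_
  · refine symMat_induction (P := fun a => AEStronglyMeasurable
      (fun x : Ω => θ x * v (b x) * inner ℝ a (polarDensity p x)) p.variation) ?_ ?_ ?_ a
    · intro a a' ha ha'
      refine (ha.add ha').congr (Eventually.of_forall fun x => ?_)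
      simp only [Pi.add_apply, inner_add_left, mul_add]
    · intro c a ha
      refine (ha.const_mul c).congr (Eventually.of_forall fun x => ?_)
      simp only [inner_smul_symMat]
      ring
    · intro ξ
      rcases eq_or_ne ξ 0 with rfl | hξ
      · simpa [symSq_zero] using aestronglyMeasurable_const
      · exact (integral_comp_plastic hΩ u he h hα hθ hθc hθΩ hv hvc hξ).1
  · filter_upwards [norm_polarDensity p] with x hx
    rw [norm_mul, norm_mul]
    have h1 := norm_inner_le_norm (𝕜 := ℝ) a (polarDensity p x)
    rw [hx, mul_one] at h1
    have := (norm_nonneg _).trans (hCθ 0)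
    have := (norm_nonneg _).trans (hCv 0)
    gcongr
    · exact hCθ x
    · exact hCv _

namespace PlasticSequence

variable {q : ℝ≥0∞} [hq1 : Fact (1 ≤ q)]

lemma integrable_e (S : PlasticSequence Ω q) (k : ℕ) : Integrable (S.e k) := by
  have hfin : IsFiniteMeasure (volume : Measure Ω) := ⟨volume_opens_lt_top S.isBounded⟩
  exact (Lp.memLp _).integrable hq1.out

lemma integrable_e₀ (S : PlasticSequence Ω q) : Integrable S.e₀ := by
  have hfin : IsFiniteMeasure (volume : Measure Ω) := ⟨volume_opens_lt_top S.isBounded⟩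
  exact (Lp.memLp _).integrable hq1.out

/-- The chain rule is applied to the `k`-th and to the limit data. The convergent terms are absorbed
in `η`, and only replacing `u_k` by `u₀` in the gradient term costs a multiple of `δ`. -/
lemma exists_eventually_abs_pairing_symSq_sub_le (S : PlasticSequence Ω q) (ξ : Space n) :
    ∃ C : ℝ, 0 ≤ C ∧ ∀ (𝒰 : Ultrafilter ℕ), (𝒰 : Filter ℕ) ≤ atTop → ∀ (δ : ℝ≥0)
      (θ : Space n → ℝ), ContDiff ℝ ∞ θ → HasCompactSupport θ → tsupport θ ⊆ Ω →
      Disjoint (tsupport θ) (S.concentrationSet 𝒰 δ) → ∀ T : ℝ, (∀ x, ‖θ x‖ ≤ T) →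
      ∀ v : ℝ → ℝ, ContDiff ℝ ∞ v → HasCompactSupport v → ∀ L : ℝ, (∀ s, ‖deriv v s‖ ≤ L) →
      ∀ η : ℝ, 0 < η → ∀ᶠ k in (𝒰 : Filter ℕ),
        |pairing θ v (symSq ξ) (S.αt k) (S.p k) - pairing θ v (symSq ξ) S.αt₀ S.p₀|
        ≤ C * δ * (T * L) + η := by
  rcases eq_or_ne ξ 0 with rfl | hξ
  · refine ⟨0, le_rfl, fun 𝒰 _ δ θ _ _ _ _ T _ v _ _ L _ η hη => Eventually.of_forall fun k => ?_⟩
    simp [pairing, symSq_zero, hη.le]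
  obtain ⟨C, hC0, hC⟩ := S.exists_eventually_abs_gradient_sub_le
  refine ⟨C * ‖ξ‖ ^ 2, by positivity, ?_⟩
  intro 𝒰 h𝒰 δ θ hθ hθc hθΩ hdisj T hT v hv hvc L hL η hη
  have hdv : ContDiff ℝ ∞ (deriv v) := ((contDiff_infty_iff_deriv).1 hv).2
  have hA := (S.tendsto_elastic hθ hθc hθΩ hv hvc (symSq ξ)).mono_left h𝒰
  have hB := (S.tendsto_lower hθ hθc hθΩ hv hvc ξ).mono_left h𝒰
  have hD := (S.tendsto_gradient hθ hθc hθΩ hdv hvc.deriv ξ).mono_left h𝒰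
  have hE := hC 𝒰 h𝒰 δ θ hθ hθc hθΩ hdisj T hT (deriv v) hdv.continuous L hL ξ
  filter_upwards [hE, Metric.tendsto_nhds.1 ((hA.add hB).add hD) η hη] with k hk hk'
  rw [Real.dist_eq] at hk'
  have h1 := (integral_comp_plastic S.isBounded (S.u k) (S.integrable_e k) (S.split k) (S.isRep k)
    hθ hθc hθΩ hv hvc hξ).2
  have h2 := (integral_comp_plastic S.isBounded S.u₀ S.integrable_e₀ S.split₀ S.isRep₀
    hθ hθc hθΩ hv hvc hξ).2
  rw [pairing, pairing, h1, h2]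
  rw [abs_le] at hk ⊢
  rw [abs_lt] at hk'
  have : C * δ * (T * L * ‖ξ‖ ^ 2) = C * ‖ξ‖ ^ 2 * δ * (T * L) := by ring
  constructor <;> linarith [hk.1, hk.2, hk'.1, hk'.2]

/-- Convergence of the pairings with test functions that stay away from the concentration set. -/
lemma exists_eventually_abs_pairing_sub_le (S : PlasticSequence Ω q) (a : SymMat n) :
    ∃ C : ℝ, 0 ≤ C ∧ ∀ (𝒰 : Ultrafilter ℕ), (𝒰 : Filter ℕ) ≤ atTop → ∀ (δ : ℝ≥0)
      (θ : Space n → ℝ), ContDiff ℝ ∞ θ → HasCompactSupport θ → tsupport θ ⊆ Ω →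
      Disjoint (tsupport θ) (S.concentrationSet 𝒰 δ) → ∀ T : ℝ, (∀ x, ‖θ x‖ ≤ T) →
      ∀ v : ℝ → ℝ, ContDiff ℝ ∞ v → HasCompactSupport v → ∀ L : ℝ, (∀ s, ‖deriv v s‖ ≤ L) →
      ∀ η : ℝ, 0 < η → ∀ᶠ k in (𝒰 : Filter ℕ),
        |pairing θ v a (S.αt k) (S.p k) - pairing θ v a S.αt₀ S.p₀| ≤ C * δ * (T * L) + η := by
  induction a using symMat_induction with
  | hsq ξ => exact S.exists_eventually_abs_pairing_symSq_sub_le ξ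
  | hadd a b ha hb =>
    obtain ⟨C, hC0, hC⟩ := ha
    obtain ⟨C', hC'0, hC'⟩ := hb
    refine ⟨C + C', by positivity, ?_⟩
    intro 𝒰 h𝒰 δ θ hθ hθc hθΩ hdisj T hT v hv hvc L hL η hη
    have hadd : ∀ (u : BD Ω) (p : VectorMeasure Ω (SymMat n)) (e : Ω → SymMat n)
        (α : sobolev Ω (n : ℝ≥0∞)) (b' : Ω → ℝ), Integrable e →
        BD.strain u = (volume : Measure Ω).withDensityᵥ e + p → IsQuasicontinuousRep Ω n α b' →
        pairing θ v (a + b) b' p = pairing θ v a b' p + pairing θ v b b' p := by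
      intro u p e α b' he h hα
      rw [pairing, pairing, pairing, ← integral_add
        (integrable_pairing S.isBounded u he h hα hθ hθc hθΩ hv hvc a)
        (integrable_pairing S.isBounded u he h hα hθ hθc hθΩ hv hvc b)]
      simp only [inner_add_left, mul_add]
    filter_upwards [hC 𝒰 h𝒰 δ θ hθ hθc hθΩ hdisj T hT v hv hvc L hL (η / 2) (half_pos hη),
      hC' 𝒰 h𝒰 δ θ hθ hθc hθΩ hdisj T hT v hv hvc L hL (η / 2) (half_pos hη)] with k hk hk'
    rw [hadd (S.u k) (S.p k) (S.e k) (S.α k) _ (S.integrable_e k) (S.split k) (S.isRep k),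
      hadd S.u₀ S.p₀ S.e₀ S.α₀ _ S.integrable_e₀ S.split₀ S.isRep₀]
    rw [abs_le] at hk hk' ⊢
    constructor <;> linarith [hk.1, hk.2, hk'.1, hk'.2]
  | hsmul c a ha =>
    obtain ⟨C, hC0, hC⟩ := ha
    refine ⟨|c| * C, by positivity, ?_⟩
    intro 𝒰 h𝒰 δ θ hθ hθc hθΩ hdisj T hT v hv hvc L hL η hη
    have hsmul : ∀ (p : VectorMeasure Ω (SymMat n)) (b' : Ω → ℝ),
        pairing θ v (c • a) b' p = c * pairing θ v a b' p := by
      intro p b'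
      rw [pairing, pairing, ← integral_const_mul]
      congr 1
      ext x
      rw [inner_smul_symMat]
      ring
    filter_upwards [hC 𝒰 h𝒰 δ θ hθ hθc hθΩ hdisj T hT v hv hvc L hL (η / (|c| + 1))
      (by positivity)] with k hk
    rw [hsmul, hsmul, ← mul_sub, abs_mul]
    have h1 := mul_le_mul_of_nonneg_left hk (abs_nonneg c)
    have h2 : |c| * (η / (|c| + 1)) ≤ η := by
      rw [mul_div_assoc', div_le_iff₀ (by positivity)]
      nlinarith [abs_nonneg c]
    calc _ ≤ _ := h1
      _ = |c| * C * δ * (T * L) + |c| * (η / (|c| + 1)) := by ring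
      _ ≤ _ := by linarith

/-- `p_k = Eu_k - e_k`: the strains are bounded by weak* convergence, and `e_k` is bounded in `L¹`
because `Ω` has finite measure. -/
lemma exists_variation_le (S : PlasticSequence Ω q) :
    ∃ M : ℝ≥0∞, M ≠ ⊤ ∧ ∀ k, (S.p k).variation univ ≤ M := by
  have hfin : IsFiniteMeasure (volume : Measure Ω) := ⟨volume_opens_lt_top S.isBounded⟩
  obtain ⟨M, hM⟩ := exists_variation_le_of_weakStarTendsto S.tendsto_u.2
  obtain ⟨M', hM', hM'k, -⟩ := exists_lintegral_enorm_le_of_weakTendsto S.tendsto_e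
  have hMk : ∀ k, (BD.strain (S.u k)).variation univ ≤ ENNReal.ofReal M := fun k =>
    (ENNReal.le_ofReal_iff_toReal_le (measure_ne_top _ _)
      (ENNReal.toReal_nonneg.trans (hM k))).2 (hM k)
  refine ⟨ENNReal.ofReal M + M', ENNReal.add_ne_top.2 ⟨ENNReal.ofReal_ne_top, hM'⟩, fun k => ?_⟩
  have h1 : S.p k = BD.strain (S.u k) - (volume : Measure Ω).withDensityᵥ (S.e k) := by
    rw [S.split k, add_sub_cancel_left]
  rw [h1]
  refine (VectorMeasure.variation_sub_le univ).trans ?_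
  rw [Measure.add_apply, Measure.variation_withDensityᵥ (S.integrable_e k),
    withDensity_apply _ MeasurableSet.univ, Measure.restrict_univ]
  exact add_le_add (hMk k) (hM'k k)

end PlasticSequence

/-- The points whose line hits `z` form an affine subspace of dimension at most one, which is proper
because `n ≥ 2`. -/
lemma lineNull_singleton {ξ : Space n} (z : Space n) : LineNull ξ {z} := by
  have hne : AffineSubspace.mk' z (Submodule.span ℝ {ξ}) ≠ ⊤ := by
    intro h
    have h1 := congrArg AffineSubspace.direction h
    rw [AffineSubspace.direction_mk', AffineSubspace.direction_top] at h1
    have h2 := finrank_span_le_card (R := ℝ) ({ξ} : Set (Space n))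
    rw [h1, finrank_top, finrank_euclideanSpace_fin] at h2
    have := hn.out
    simp at h2
    omega
  refine measure_mono_null ?_ (Measure.addHaar_affineSubspace volume _ hne)
  rintro x ⟨t, ht⟩
  rw [mem_singleton_iff] at ht
  rw [SetLike.mem_coe, AffineSubspace.mem_mk', vsub_eq_sub, ← ht]
  have : x - (x + t • ξ) = (-t) • ξ := by module
  rw [this]
  exact Submodule.smul_mem _ _ (Submodule.mem_span_singleton_self ξ)

/-- The plastic strain does not charge points. -/
lemma variation_singleton (hΩ : Bornology.IsBounded (Ω : Set (Space n)))
    (u : BD Ω) {p : VectorMeasure Ω (SymMat n)} {e : Ω → SymMat n} (he : Integrable e)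
    (h : BD.strain u = (volume : Measure Ω).withDensityᵥ e + p) (z : Ω) :
    p.variation {z} = 0 := by
  have hfin : IsFiniteMeasure (volume : Measure Ω) := ⟨volume_opens_lt_top hΩ⟩
  -- All components of the polar density vanish at `z`; since it is a unit matrix almost everywhere,
  -- `z` carries no mass.
  have key : ∀ a : SymMat n, ∀ᵐ x ∂p.variation, x = z → inner ℝ a (polarDensity p x) = 0 := by
    refine symMat_induction ?_ ?_ ?_
    · intro a b ha hb
      filter_upwards [ha, hb] with x hx hx' hxz
      rw [inner_add_left, hx hxz, hx' hxz, add_zero]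
    · intro c a ha
      filter_upwards [ha] with x hx hxz
      rw [inner_smul_symMat, hx hxz, mul_zero]
    · intro ξ
      rcases eq_or_ne ξ 0 with rfl | hξ
      · simp [symSq_zero]
      have hw : Integrable fun x : Ω => inner ℝ (u.1 x) ξ :=
        (L1.integrable_coeFn u.1).inner_const ξ
      have hwE : ∀ φ : Space n → ℝ, ∫ x : Ω, inner ℝ (u.1 x) ξ * φ x
          = ∫ x, zeroExt (fun x : Ω => inner ℝ (u.1 x) ξ) x * φ x := by
        intro φ
        rw [← integral_coe (Ω := Ω)
          (f := fun x => zeroExt (fun x : Ω => inner ℝ (u.1 x) ξ) x * φ x)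
          fun x hx => by simp [zeroExt_of_notMem _ hx]]
        simp only [zeroExt_coe]
      have hN : LineNull ξ {z.1} := lineNull_singleton z.1
      have := ae_eq_zero_of_lineNull_add measurableEmbedding_coe
        ((integrable_polarDensity p).const_inner (symSq ξ)) (he.const_inner (symSq ξ))
        (integrable_zeroExt hw) Ω.isOpen hξ
        (fun φ hφ hφc hφΩ => by
          rw [integral_symSq_split u he h hφ hφc hφΩ ξ, hwE fun x => fderiv ℝ φ x ξ]) hN
        (by
          refine (ae_coe_iff (P := fun x => x ∉ ({z.1} : Set (Space n)))).2 ?_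
          filter_upwards [hN.ae_notMem] with x hx _ using hx)
      filter_upwards [this] with x hx hxz
      exact hx x.2 (by rw [hxz]; rfl)
  have hall := ae_all_iff.2 fun i => key (stdOrthonormalBasis ℝ (SymMat n) i)
  have hz : ∀ᵐ x ∂p.variation, x ≠ z := by
    filter_upwards [hall, norm_polarDensity p] with x hx hx1 hxz
    have h0 : polarDensity p x = 0 := by
      rw [← (stdOrthonormalBasis ℝ (SymMat n)).sum_repr' (polarDensity p x)]
      exact Finset.sum_eq_zero fun i _ => by rw [hx i hxz, zero_smul]
    rw [h0, norm_zero] at hx1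
    exact zero_ne_one hx1
  rw [ae_iff] at hz
  simpa using hz

namespace PlasticSequence

variable {q : ℝ≥0∞} [hq1 : Fact (1 ≤ q)]

lemma variation_concentrationSet (S : PlasticSequence Ω q) (𝒰 : Ultrafilter ℕ) {δ : ℝ≥0}
    (hδ : 0 < δ) :
    S.p₀.variation ((Subtype.val : Ω → Space n) ⁻¹' S.concentrationSet 𝒰 δ) = 0 := by
  have hf : ((Subtype.val : Ω → Space n) ⁻¹' S.concentrationSet 𝒰 δ).Finite :=
    (S.finite_concentrationSet 𝒰 hδ).preimage Subtype.val_injective.injOn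
  rw [← biUnion_of_singleton ((Subtype.val : Ω → Space n) ⁻¹' S.concentrationSet 𝒰 δ),
    measure_biUnion_null_iff hf.countable]
  exact fun z _ => variation_singleton S.isBounded S.u₀ S.integrable_e₀ S.split₀ z

end PlasticSequence

end Pairing

/-! ### Sublinear functions as suprema of linear ones. -/

section Sublinear

variable {E : Type*} [NormedAddCommGroup E] [InnerProductSpace ℝ E] [CompleteSpace E]

/-- A lower semicontinuous sublinear function is the supremum of the linear functions below it. -/
lemma exists_inner_le_of_sublinear {h : E → ℝ≥0∞} (hlsc : LowerSemicontinuous h)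
    (hhom : ∀ (ξ : E) (t : ℝ≥0), 0 < t → h (t • ξ) = t * h ξ) (hconv : ConvexOn ℝ≥0 univ h)
    {ξ₀ : E} (hξ₀ : ‖ξ₀‖ = 1) {B : ℝ≥0} (hB : (B : ℝ≥0∞) < h ξ₀) :
    ∃ a : E, (∀ ξ, ENNReal.ofReal (inner ℝ a ξ) ≤ h ξ) ∧ (B : ℝ) < inner ℝ a ξ₀ := by
  by_cases htop : ∀ ξ, h ξ = ⊤
  -- An empty epigraph cannot be separated in a useful way, but any linear function is admissible
  -- then.
  · refine ⟨((B : ℝ) + 1) • ξ₀, fun ξ => by rw [htop]; exact le_top, ?_⟩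
    rw [real_inner_smul_left, real_inner_self_eq_norm_sq, hξ₀]
    linarith
  push Not at htop
  obtain ⟨ξ₁, hξ₁⟩ := htop
  set C : Set (E × ℝ) := {z | 0 ≤ z.2 ∧ h z.1 ≤ ENNReal.ofReal z.2} with hC
  have hmem : ∀ ξ, h ξ ≠ ⊤ → ∀ s : ℝ, 0 ≤ s → (ξ, (h ξ).toReal + s) ∈ C := fun ξ hξ s hs =>
    ⟨by positivity, by
      rw [ENNReal.ofReal_add (by positivity) hs, ENNReal.ofReal_toReal hξ]
      exact le_self_add⟩
  have hclosed : IsClosed C := by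
    refine (isClosed_le continuous_const continuous_snd).inter ?_
    exact hlsc.isClosed_epigraph.preimage
      (continuous_fst.prodMk (ENNReal.continuous_ofReal.comp continuous_snd))
  have hcone : ∀ z ∈ C, ∀ t : ℝ, 0 < t → t • z ∈ C := by
    intro z hz t ht
    lift t to ℝ≥0 using ht.le
    refine ⟨mul_nonneg t.coe_nonneg hz.1, ?_⟩
    have h1 := hhom z.1 t (by exact_mod_cast ht)
    rw [Prod.smul_fst, Prod.smul_snd, smul_eq_mul, ENNReal.ofReal_mul t.coe_nonneg, ← NNReal.smul_def, h1,
      ENNReal.ofReal_coe_nnreal]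
    gcongr
    exact hz.2
  have hconvC : Convex ℝ C := by
    intro z hz w hw a b ha hb hab
    lift a to ℝ≥0 using ha
    lift b to ℝ≥0 using hb
    refine ⟨add_nonneg (mul_nonneg a.coe_nonneg hz.1) (mul_nonneg b.coe_nonneg hw.1), ?_⟩
    have h1 := hconv.2 (mem_univ z.1) (mem_univ w.1) a.2 b.2 (by exact_mod_cast hab)
    refine h1.trans ?_
    simp only [Prod.snd_add, Prod.smul_snd, smul_eq_mul, ENNReal.smul_def]
    rw [ENNReal.ofReal_add (mul_nonneg a.coe_nonneg hz.1) (mul_nonneg b.coe_nonneg hw.1), ENNReal.ofReal_mul a.coe_nonneg,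
      ENNReal.ofReal_mul b.coe_nonneg, ENNReal.ofReal_coe_nnreal, ENNReal.ofReal_coe_nnreal]
    gcongr
    · exact hz.2
    · exact hw.2
  have hnot : (ξ₀, (B : ℝ)) ∉ C := fun hmem => by
    have := hmem.2
    rw [ENNReal.ofReal_coe_nnreal] at this
    exact (hB.trans_le this).false
  obtain ⟨f, r, hfr, hr⟩ := geometric_hahn_banach_point_closed hconvC hclosed hnot
  -- The epigraph is a cone, so scaling forces the separating functional to be nonnegative on it and
  -- the threshold to be nonpositive.
  have hscale : ∀ z ∈ C, ∀ t : ℝ, 0 < t → r < t * f z := fun z hz t ht => by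
    have := hr _ (hcone z hz t ht)
    rwa [map_smul, smul_eq_mul] at this
  have hz₁ := hmem ξ₁ hξ₁ 0 le_rfl
  have hr0 : r ≤ 0 := by
    by_contra! hpos
    have h1 : 0 < f (ξ₁, (h ξ₁).toReal + 0) := hpos.trans (hr _ hz₁)
    have h2 := hscale _ hz₁ (r / (2 * f (ξ₁, (h ξ₁).toReal + 0))) (by positivity)
    have h3 : r / (2 * f (ξ₁, (h ξ₁).toReal + 0)) * f (ξ₁, (h ξ₁).toReal + 0) = r / 2 := by
      field_simp
    linarith
  have hnonneg : ∀ z ∈ C, 0 ≤ f z := by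
    intro z hz
    by_contra! hneg
    have h2 := hscale z hz ((1 - r) / (-f z)) (div_pos (by linarith) (by linarith))
    have h3 : (1 - r) / (-f z) * f z = r - 1 := by
      have := hneg.ne
      field_simp
      ring
    linarith
  have hdecomp : ∀ (ξ : E) (t : ℝ), f (ξ, t) = f (ξ, 0) + t * f (0, 1) := by
    intro ξ t
    have : ((ξ, t) : E × ℝ) = (ξ, 0) + t • (0, 1) := by simp
    rw [this, map_add, map_smul, smul_eq_mul]
  set lam := f (0, 1) with hlam
  have hlam0 : 0 ≤ lam := by
    by_contra! hneg
    have h1 := hnonneg _ hz₁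
    have h2 := hnonneg _ (hmem ξ₁ hξ₁ ((f (ξ₁, (h ξ₁).toReal + 0) + 1) / (-lam))
      (div_nonneg (by linarith) (by linarith)))
    rw [hdecomp] at h1 h2
    rw [hdecomp ξ₁ ((h ξ₁).toReal + 0)] at h2
    have h3 : (f (ξ₁, 0) + ((h ξ₁).toReal + 0) * lam + 1) / (-lam) * lam
        = -(f (ξ₁, 0) + ((h ξ₁).toReal + 0) * lam + 1) := by
      rw [div_neg, neg_mul, div_mul_cancel₀ _ hneg.ne]
    rw [add_mul, h3] at h2
    linarith
  have hf0 : f (ξ₀, 0) + B * lam < 0 := by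
    rw [← hdecomp]
    linarith
  -- The separating hyperplane may be vertical, with `lam = 0`. Tilting it by `κ > 0` keeps the
  -- functional nonnegative on the epigraph because `h ≥ 0`, and this `κ` is small enough to keep it
  -- negative at `(ξ₀, B)`.
  set κ := -(f (ξ₀, 0) + B * lam) / (2 * (B + 1)) with hκ
  have hB0 : (0 : ℝ) ≤ B := B.2
  have hκ0 : 0 < κ := div_pos (by linarith) (by positivity)
  have hκB : f (ξ₀, 0) + B * (lam + κ) < 0 := by
    have h1 : κ * (2 * (B + 1)) = -(f (ξ₀, 0) + B * lam) := by
      rw [hκ]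
      field_simp
    nlinarith
  have hμ : 0 < lam + κ := by linarith
  set a : E := (-(1 / (lam + κ))) •
    (InnerProductSpace.toDual ℝ E).symm (f.comp (ContinuousLinearMap.inl ℝ E ℝ)) with ha
  have hinner : ∀ ξ, inner ℝ a ξ = -f (ξ, 0) / (lam + κ) := by
    intro ξ
    rw [ha, real_inner_smul_left, InnerProductSpace.toDual_symm_apply]
    simp only [ContinuousLinearMap.comp_apply, ContinuousLinearMap.inl_apply]
    ring
  refine ⟨a, fun ξ => ?_, ?_⟩
  · by_cases hξ : h ξ = ⊤
    · rw [hξ]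
      exact le_top
    · refine ENNReal.ofReal_le_of_le_toReal ?_
      rw [hinner, div_le_iff₀ hμ]
      have h1 := hnonneg _ (hmem ξ hξ 0 le_rfl)
      rw [hdecomp, add_zero] at h1
      nlinarith [mul_nonneg (ENNReal.toReal_nonneg (a := h ξ)) hκ0.le]
  · rw [hinner, lt_div_iff₀ hμ]
    linarith

end Sublinear

/-! ### Smooth test functions below the integrand. -/

section Admissible

variable {n : ℕ} {Ω : Opens (Space n)}

/-- Smooth functions `φ(x) v(s) ⟪a, ξ⟫` that lie below `V(s) H(x, ξ) + ε`. -/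
structure AdmissibleTest (V : ℝ → ℝ≥0∞) (H : Ω × SymMat n → ℝ≥0∞) (ε : ℝ) where
  φ : Space n → ℝ
  v : ℝ → ℝ
  a : SymMat n
  contDiff_φ : ContDiff ℝ ∞ φ
  hasCompactSupport_φ : HasCompactSupport φ
  tsupport_φ : tsupport φ ⊆ Ω
  contDiff_v : ContDiff ℝ ∞ v
  hasCompactSupport_v : HasCompactSupport v
  le : ∀ (x : Ω) (s : ℝ) (ξ : SymMat n), ‖ξ‖ = 1 →
    ENNReal.ofReal (φ x * v s * inner ℝ a ξ) ≤ V s * H (x, ξ) + ENNReal.ofReal ε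

variable {V : ℝ → ℝ≥0∞} {H : Ω × SymMat n → ℝ≥0∞} {ε : ℝ}

instance instInhabitedAdmissibleTest : Inhabited (AdmissibleTest V H ε) :=
  ⟨{ φ := 0, v := 0, a := 0, contDiff_φ := contDiff_const, hasCompactSupport_φ := .zero
     tsupport_φ := by simp [tsupport_zero], contDiff_v := contDiff_const
     hasCompactSupport_v := .zero, le := by simp }⟩

/-- Factors `A < V(s₀)` and `B < H(x₀, ξ₀)` are chosen with `A B > τ`. Semicontinuity keeps `V`
above `A` near `s₀`, and with compactness of the unit sphere keeps `H(x, ·)` above the supporting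
linear function up to a small error for `x` near `x₀`; cut-offs localise to these neighbourhoods. -/
lemma exists_admissibleTest (hV : LowerSemicontinuous V) (hH : LowerSemicontinuous H)
    (hH_hom : ∀ (x : Ω) (ξ : SymMat n) (t : ℝ≥0), 0 < t → H (x, t • ξ) = t * H (x, ξ))
    (hH_conv : ∀ x : Ω, ConvexOn ℝ≥0 univ (fun ξ : SymMat n => H (x, ξ)))
    (hε : 0 < ε) (x₀ : Ω) (s₀ : ℝ) {ξ₀ : SymMat n} (hξ₀ : ‖ξ₀‖ = 1) {τ : ℝ≥0∞}
    (hτ : τ < V s₀ * H (x₀, ξ₀)) :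
    ∃ T : AdmissibleTest V H ε, τ < ENNReal.ofReal (T.φ x₀ * T.v s₀ * inner ℝ T.a ξ₀) := by
  obtain ⟨A, hA, B, hB, hAB⟩ : ∃ A, A < V s₀ ∧ ∃ B, B < H (x₀, ξ₀) ∧ τ < A * B := by
    by_contra! hcon
    exact (hτ.trans_le (ENNReal.mul_le_of_forall_lt fun A hA B hB => hcon A hA B hB)).false
  lift A to ℝ≥0 using hA.ne_top
  lift B to ℝ≥0 using hB.ne_top
  obtain ⟨a, ha, haB⟩ := exists_inner_le_of_sublinear (h := fun ξ => H (x₀, ξ))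
    (hH.comp (continuous_const.prodMk continuous_id)) (hH_hom x₀) (hH_conv x₀) hξ₀ hB
  -- The error in `H` will be multiplied by `A v(s) ≤ A`, and the product must stay below `ε`.
  set ε' : ℝ := ε / (A + 1) with hε'
  have hA0 : (0 : ℝ) ≤ A := A.2
  have hε'0 : 0 < ε' := by positivity
  -- Adding a function that is positive on the sphere rewrites the comparison as `G > ‖a‖`, an open
  -- condition on a lower semicontinuous function, to which the tube lemma applies.
  set G : Ω × SymMat n → ℝ≥0∞ := fun z => H z + ENNReal.ofReal (‖a‖ + ε' - inner ℝ a z.2) with hG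
  have hGlsc : LowerSemicontinuous G := by
    refine hH.add (Continuous.lowerSemicontinuous (ENNReal.continuous_ofReal.comp ?_))
    fun_prop
  have hball : ∀ ξ : SymMat n, ‖ξ‖ = 1 → inner ℝ a ξ ≤ ‖a‖ := fun ξ hξ => by
    have := real_inner_le_norm a ξ
    rwa [hξ, mul_one] at this
  have hsub : ({x₀} : Set Ω) ×ˢ Metric.sphere (0 : SymMat n) 1
      ⊆ G ⁻¹' Ioi (ENNReal.ofReal ‖a‖) := by
    rintro ⟨x, ξ⟩ ⟨hx, hξ⟩
    rw [mem_singleton_iff] at hx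
    simp only at hx
    subst hx
    have hξ1 : ‖ξ‖ = 1 := by simpa using hξ
    calc ENNReal.ofReal ‖a‖ < ENNReal.ofReal (‖a‖ + ε') :=
          (ENNReal.ofReal_lt_ofReal_iff (by positivity)).2 (by linarith)
      _ = ENNReal.ofReal (inner ℝ a ξ + (‖a‖ + ε' - inner ℝ a ξ)) := by congr 1; ring
      _ ≤ ENNReal.ofReal (inner ℝ a ξ) + ENNReal.ofReal (‖a‖ + ε' - inner ℝ a ξ) :=
          ENNReal.ofReal_add_le
      _ ≤ G (x, ξ) := add_le_add (ha ξ) le_rfl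
  obtain ⟨U, W, hU, -, hxU, hW, hUW⟩ := generalized_tube_lemma isCompact_singleton
    (isCompact_sphere (0 : SymMat n) 1) (hGlsc.isOpen_preimage _) hsub
  have hxU : x₀ ∈ U := hxU rfl
  have hle : ∀ x ∈ U, ∀ ξ : SymMat n, ‖ξ‖ = 1 →
      ENNReal.ofReal (inner ℝ a ξ) ≤ H (x, ξ) + ENNReal.ofReal ε' := by
    intro x hx ξ hξ
    have h1 : ENNReal.ofReal ‖a‖ < H (x, ξ) + ENNReal.ofReal (‖a‖ + ε' - inner ℝ a ξ) :=
      hUW (mk_mem_prod hx (hW (by simpa using hξ)))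
    have h2 := hball ξ hξ
    by_cases htop : H (x, ξ) = ⊤
    · simp [htop]
    · rw [← ENNReal.ofReal_toReal htop, ← ENNReal.ofReal_add ENNReal.toReal_nonneg
        (by linarith), ENNReal.ofReal_lt_ofReal_iff_of_nonneg (norm_nonneg a)] at h1
      rw [← ENNReal.ofReal_toReal htop, ← ENNReal.ofReal_add ENNReal.toReal_nonneg hε'0.le]
      exact ENNReal.ofReal_le_ofReal (by linarith)
  obtain ⟨φ, hφ, hφc, hφU, hφ1, hφI⟩ := exists_cutoff (E := Space n) (K := {x₀.1})
    isCompact_singleton (Ω.isOpen.isOpenMap_subtype_val U hU)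
    (singleton_subset_iff.2 ⟨x₀, hxU, rfl⟩)
  obtain ⟨v, hv, hvc, hvU, hv1, hvI⟩ := exists_cutoff (E := ℝ) (K := {s₀})
    isCompact_singleton (hV.isOpen_preimage A) (singleton_subset_iff.2 hA)
  refine ⟨{ φ := φ, v := fun s => A * v s, a := a, contDiff_φ := hφ, hasCompactSupport_φ := hφc
            tsupport_φ := hφU.trans (by rintro _ ⟨y, -, rfl⟩; exact y.2)
            contDiff_v := contDiff_const.mul hv, hasCompactSupport_v := hvc.mul_left
            le := ?_ }, ?_⟩
  · intro x s ξ hξ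
    by_cases hx : x.1 ∈ tsupport φ
    · obtain ⟨y, hyU, hyx⟩ := hφU hx
      have hxU' : x ∈ U := by rwa [← Subtype.ext hyx]
      have hvs : ENNReal.ofReal (A * v s) ≤ V s := by
        by_cases hs : s ∈ tsupport v
        · refine le_trans ?_ (hvU hs : (A : ℝ≥0∞) < V s).le
          rw [← ENNReal.ofReal_coe_nnreal]
          exact ENNReal.ofReal_le_ofReal (mul_le_of_le_one_right hA0 (hvI s).2)
        · rw [image_eq_zero_of_notMem_tsupport hs]
          simp
      have hAv : 0 ≤ A * v s := mul_nonneg hA0 (hvI s).1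
      have hAε : A * v s * ε' ≤ ε := by
        have h1 : A * v s ≤ A + 1 := by nlinarith [(hvI s).2]
        calc A * v s * ε' ≤ (A + 1) * ε' := by gcongr
          _ = ε := by rw [hε']; field_simp
      calc ENNReal.ofReal (φ x * (A * v s) * inner ℝ a ξ)
          = ENNReal.ofReal (φ x) * (ENNReal.ofReal (A * v s) * ENNReal.ofReal (inner ℝ a ξ)) := by
            rw [mul_assoc, ENNReal.ofReal_mul (hφI x).1, ENNReal.ofReal_mul hAv]
        _ ≤ 1 * (ENNReal.ofReal (A * v s) * (H (x, ξ) + ENNReal.ofReal ε')) := by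
            gcongr
            · exact ENNReal.ofReal_le_one.2 (hφI x).2
            · exact hle x hxU' ξ hξ
        _ = ENNReal.ofReal (A * v s) * H (x, ξ) + ENNReal.ofReal (A * v s * ε') := by
            rw [one_mul, mul_add, ENNReal.ofReal_mul hAv]
        _ ≤ V s * H (x, ξ) + ENNReal.ofReal ε := by gcongr
    · rw [image_eq_zero_of_notMem_tsupport hx]
      simp
  · simp only
    rw [hφ1.self_of_nhdsSet _ rfl, hv1.self_of_nhdsSet _ rfl, one_mul, mul_one]
    refine hAB.trans_le ?_
    rw [ENNReal.ofReal_mul hA0, ENNReal.ofReal_coe_nnreal]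
    gcongr
    rw [← ENNReal.ofReal_coe_nnreal]
    exact ENNReal.ofReal_le_ofReal haB.le

/-- Countably many admissible test functions suffice to approximate `V(s) H(x, ξ)`. -/
lemma exists_seq_admissibleTest (hV : LowerSemicontinuous V) (hH : LowerSemicontinuous H)
    (hH_hom : ∀ (x : Ω) (ξ : SymMat n) (t : ℝ≥0), 0 < t → H (x, t • ξ) = t * H (x, ξ))
    (hH_conv : ∀ x : Ω, ConvexOn ℝ≥0 univ (fun ξ : SymMat n => H (x, ξ))) (hε : 0 < ε) :
    ∃ T : ℕ → AdmissibleTest V H ε, ∀ (x : Ω) (s : ℝ) (ξ : SymMat n), ‖ξ‖ = 1 →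
      V s * H (x, ξ) ≤ ⨆ j, ENNReal.ofReal ((T j).φ x * (T j).v s * inner ℝ (T j).a ξ) := by
  have hcont : ∀ T : AdmissibleTest V H ε, Continuous fun z : Ω × ℝ × SymMat n =>
      ENNReal.ofReal (T.φ z.1 * T.v z.2.1 * inner ℝ T.a z.2.2) := by
    intro T
    have h1 := T.contDiff_φ.continuous
    have h2 := T.contDiff_v.continuous
    refine ENNReal.continuous_ofReal.comp ?_
    fun_prop
  -- Lindelöf at each rational level: countably many tests cover everything that all tests cover.
  have hcount : ∀ τ : ℚ, ∃ I : Set (AdmissibleTest V H ε), I.Countable ∧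
      ⋃ T ∈ I, {z : Ω × ℝ × SymMat n | ((τ : ℝ).toNNReal : ℝ≥0∞) <
        ENNReal.ofReal (T.φ z.1 * T.v z.2.1 * inner ℝ T.a z.2.2)} =
      ⋃ T : AdmissibleTest V H ε, {z : Ω × ℝ × SymMat n | ((τ : ℝ).toNNReal : ℝ≥0∞) <
        ENNReal.ofReal (T.φ z.1 * T.v z.2.1 * inner ℝ T.a z.2.2)} := fun τ =>
    isOpen_iUnion_countable _ fun T => isOpen_lt continuous_const (hcont T)
  choose I hI hIeq using hcount
  have hIc : (insert default (⋃ τ, I τ)).Countable := (countable_iUnion hI).insert _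
  obtain ⟨T, hT⟩ := hIc.exists_eq_range (insert_nonempty _ _)
  refine ⟨T, fun x s ξ hξ => le_of_forall_lt fun c hc => ?_⟩
  obtain ⟨τ, -, hcτ, hτ⟩ := ENNReal.lt_iff_exists_rat_btwn.1 hc
  obtain ⟨T₀, hT₀⟩ := exists_admissibleTest hV hH hH_hom hH_conv hε x s hξ hτ
  have hmem : (x, s, ξ) ∈ ⋃ T : AdmissibleTest V H ε, {z : Ω × ℝ × SymMat n |
      ((τ : ℝ).toNNReal : ℝ≥0∞) < ENNReal.ofReal (T.φ z.1 * T.v z.2.1 * inner ℝ T.a z.2.2)} :=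
    mem_iUnion.2 ⟨T₀, hT₀⟩
  rw [← hIeq τ] at hmem
  obtain ⟨T₁, hT₁I, hT₁⟩ := mem_iUnion₂.1 hmem
  have hrange : T₁ ∈ range T := hT ▸ mem_insert_of_mem _ (mem_iUnion.2 ⟨τ, hT₁I⟩)
  obtain ⟨j, rfl⟩ := hrange
  exact hcτ.trans (lt_of_lt_of_le hT₁ (le_iSup (fun j => ENNReal.ofReal
    ((T j).φ x * (T j).v s * inner ℝ (T j).a ξ)) j))

end Admissible

/-! ### Finite suprema, disjoint sets and smooth cut-offs. -/

section Localization

variable {n : ℕ} {Ω : Opens (Space n)}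

/-- Smooth functions with disjoint supports, vanishing near a given finite set, that approximate
the characteristic functions of finitely many disjoint sets. -/
lemma exists_disjoint_cutoffs (m : Measure Ω) [IsFiniteMeasure m] {F : Set (Space n)}
    (hF : F.Finite) (hmF : m ((Subtype.val : Ω → Space n) ⁻¹' F) = 0) {J : ℕ} {B : Fin J → Set Ω}
    (hB : ∀ j, MeasurableSet (B j)) (hdisj : Pairwise (Function.onFun Disjoint B)) {ρ : ℝ≥0∞}
    (hρ : ρ ≠ 0) :
    ∃ θ : Fin J → Space n → ℝ, (∀ j, ContDiff ℝ ∞ (θ j)) ∧ (∀ j, HasCompactSupport (θ j)) ∧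
      (∀ j, tsupport (θ j) ⊆ Ω) ∧ (∀ j, Disjoint (tsupport (θ j)) F) ∧
      (∀ j x, θ j x ∈ Icc (0 : ℝ) 1) ∧ (∀ x, ∑ j, θ j x ≤ 1) ∧
      ∀ j, m {x : Ω | θ j x ≠ (B j).indicator 1 x} ≤ ρ := by
  have hρ2 : ρ / 2 ≠ 0 := (ENNReal.half_pos hρ).ne'
  have hFm : MeasurableSet ((Subtype.val : Ω → Space n) ⁻¹' F) :=
    measurable_subtype_coe hF.measurableSet
  -- Disjoint compact sets from inner regularity have disjoint neighbourhoods, which gives `∑ θ j ≤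
  -- 1`. Removing `F` costs nothing because it is not charged.
  have hK : ∀ j, ∃ K : Set Ω, K ⊆ B j \ (Subtype.val : Ω → Space n) ⁻¹' F ∧ IsCompact K ∧
      m ((B j \ (Subtype.val : Ω → Space n) ⁻¹' F) \ K) < ρ / 2 := fun j =>
    ((hB j).diff hFm).exists_isCompact_sdiff_lt (measure_ne_top _ _) hρ2
  choose K hKB hKc hKm using hK
  have hO : ∀ j, ∃ O : Set Ω, O ⊇ K j ∧ IsOpen O ∧ m O < ⊤ ∧ m (O \ K j) < ρ / 2 := fun j =>
    (hKc j).measurableSet.exists_isOpen_sdiff_lt (measure_ne_top _ _) hρ2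
  choose O hKO hOo _ hOm using hO
  have hKi : ∀ j, IsCompact ((Subtype.val : Ω → Space n) '' K j) := fun j =>
    (hKc j).image continuous_subtype_val
  have hKd : Pairwise (Function.onFun Disjoint fun j => 𝓝ˢ ((Subtype.val : Ω → Space n) '' K j)) := by
    intro i j hij
    refine separatedNhds_iff_disjoint.1 (SeparatedNhds.of_isCompact_isCompact (hKi i) (hKi j) ?_)
    rw [disjoint_image_iff Subtype.val_injective]
    exact (hdisj hij).mono ((hKB i).trans sdiff_subset) ((hKB j).trans sdiff_subset)
  obtain ⟨s, hs, hsd⟩ := hKd.exists_mem_filter_of_disjoint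
  have hcut : ∀ j, ∃ χ : Space n → ℝ, ContDiff ℝ ∞ χ ∧ HasCompactSupport χ ∧
      tsupport χ ⊆ interior (s j) ∩ (((Subtype.val : Ω → Space n) '' O j) ∩ Fᶜ) ∧
      (∀ᶠ x in 𝓝ˢ ((Subtype.val : Ω → Space n) '' K j), χ x = 1) ∧
      ∀ x, χ x ∈ Icc (0 : ℝ) 1 := by
    intro j
    refine exists_cutoff (hKi j) (isOpen_interior.inter
      ((Ω.isOpen.isOpenMap_subtype_val _ (hOo j)).inter hF.isClosed.isOpen_compl)) ?_
    refine subset_inter (subset_interior_iff_mem_nhdsSet.2 (hs j))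
      (subset_inter (image_mono (hKO j)) ?_)
    rintro _ ⟨x, hx, rfl⟩
    exact (hKB j hx).2
  choose θ hθ hθc hθU hθ1 hθI using hcut
  refine ⟨θ, hθ, hθc, fun j x hx => ?_, fun j => ?_, hθI, fun x => ?_, fun j => ?_⟩
  · obtain ⟨y, -, rfl⟩ := (hθU j hx).2.1
    exact y.2
  · exact disjoint_left.2 fun x hx => (hθU j hx).2.2
  · by_cases hx : ∃ j, θ j x ≠ 0
    · obtain ⟨j, hj⟩ := hx
      rw [Finset.sum_eq_single j]
      · exact (hθI j x).2
      · intro i _ hij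
        by_contra hi
        exact disjoint_left.1 (hsd hij) (interior_subset (hθU i (subset_tsupport _ hi)).1)
          (interior_subset (hθU j (subset_tsupport _ hj)).1)
      · simp
    · push Not at hx
      simp [hx]
  · have hsub : {x : Ω | θ j x ≠ (B j).indicator 1 x} ⊆
        ((B j \ (Subtype.val : Ω → Space n) ⁻¹' F) \ K j) ∪
          ((O j \ K j) ∪ (Subtype.val : Ω → Space n) ⁻¹' F) := by
      intro x hx
      by_contra hcon
      simp only [mem_union, Set.mem_sdiff, not_or, not_and, not_not] at hcon
      obtain ⟨h1, h2, h3⟩ := hcon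
      refine hx ?_
      by_cases hxB : x ∈ B j
      · rw [indicator_of_mem hxB, (hθ1 j).self_of_nhdsSet _ ⟨x, h1 ⟨hxB, h3⟩, rfl⟩, Pi.one_apply]
      · rw [indicator_of_notMem hxB]
        by_contra h0
        obtain ⟨y, hy, hyx⟩ := (hθU j (subset_tsupport _ h0)).2.1
        rw [Subtype.ext hyx] at hy
        exact hxB (hKB j (h2 hy)).1
    calc m {x : Ω | θ j x ≠ (B j).indicator 1 x} ≤ _ := measure_mono hsub
      _ ≤ ρ / 2 + (ρ / 2 + 0) := (measure_union_le _ _).trans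
          (add_le_add (hKm j).le ((measure_union_le _ _).trans (add_le_add (hOm j).le hmF.le)))
      _ = ρ := by rw [add_zero, ENNReal.add_halves]

/-- The integral of a finite supremum is a sum of integrals over disjoint sets. -/
lemma exists_disjoint_lintegral_iSup_le {X : Type*} [MeasurableSpace X] (m : Measure X) {J : ℕ}
    {g : Fin J → X → ℝ} (hg : ∀ j, Integrable (g j) m) :
    ∃ B : Fin J → Set X, (∀ j, MeasurableSet (B j)) ∧ Pairwise (Function.onFun Disjoint B) ∧
      ∫⁻ x, ⨆ j, ENNReal.ofReal (g j x) ∂m ≤ ENNReal.ofReal (∑ j, ∫ x in B j, g j x ∂m) := by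
  set g' : Fin J → X → ℝ := fun j => (hg j).1.mk (g j) with hg'
  have hm : ∀ j, Measurable (g' j) := fun j => (hg j).1.stronglyMeasurable_mk.measurable
  have heq : ∀ j, g j =ᵐ[m] g' j := fun j => (hg j).1.ae_eq_mk
  -- Where `g j` is maximal and positive. Taking the first such index makes the sets disjoint; where
  -- none is positive the supremum of the truncated functions is zero.
  set A : Fin J → Set X := fun j => {x | 0 < g' j x ∧ ∀ i, g' i x ≤ g' j x} with hA
  have hAm : ∀ j, MeasurableSet (A j) := fun j =>
    (measurableSet_lt measurable_const (hm j)).inter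
      (MeasurableSet.congr (MeasurableSet.iInter fun i => measurableSet_le (hm i) (hm j))
        (by ext x; simp) : MeasurableSet {x | ∀ i, g' i x ≤ g' j x})
  refine ⟨fun j => A j \ ⋃ i : {i // i < j}, A i.1, fun j => (hAm j).diff
    (MeasurableSet.iUnion fun i => hAm i.1), ?_, ?_⟩
  · intro i j hij
    rcases lt_or_gt_of_ne hij with h | h
    · exact disjoint_left.2 fun x hx hx' => hx'.2 (mem_iUnion.2 ⟨⟨i, h⟩, hx.1⟩)
    · exact disjoint_left.2 fun x hx hx' => hx.2 (mem_iUnion.2 ⟨⟨j, h⟩, hx'.1⟩)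
  set B : Fin J → Set X := fun j => A j \ ⋃ i : {i // i < j}, A i.1 with hBdef
  have hBm : ∀ j, MeasurableSet (B j) := fun j => (hAm j).diff (MeasurableSet.iUnion fun i => hAm i.1)
  have hintegrable : ∀ j, ENNReal.ofReal (∫ x in B j, g j x ∂m)
      = ∫⁻ x in B j, ENNReal.ofReal (g' j x) ∂m := by
    intro j
    rw [setIntegral_congr_ae (hBm j) ((heq j).mono fun x hx _ => hx),
      ofReal_integral_eq_lintegral_ofReal ((hg j).congr (heq j)).integrableOn]
    filter_upwards [ae_restrict_mem (hBm j)] with x hx using hx.1.1.le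
  have hnn : ∀ j, 0 ≤ ∫ x in B j, g j x ∂m := by
    intro j
    rw [setIntegral_congr_ae (hBm j) ((heq j).mono fun x hx _ => hx)]
    exact setIntegral_nonneg (hBm j) fun x hx => hx.1.1.le
  rw [ENNReal.ofReal_sum_of_nonneg fun j _ => hnn j]
  simp only [hintegrable]
  simp only [← lintegral_indicator (hBm _)]
  rw [← lintegral_finsetSum _ fun j _ => (hm j).ennreal_ofReal.indicator (hBm j)]
  refine lintegral_mono_ae ?_
  filter_upwards [ae_all_iff.2 heq] with x hx
  refine iSup_le fun i => ?_
  rw [hx i]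
  by_cases hpos : 0 < g' i x
  · have hne : (Finset.univ.filter fun j => x ∈ A j).Nonempty := by
      obtain ⟨j, -, hj⟩ := Finset.exists_max_image Finset.univ (fun j => g' j x) ⟨i, Finset.mem_univ i⟩
      refine ⟨j, ?_⟩
      simp only [Finset.mem_filter, Finset.mem_univ, true_and]
      exact ⟨hpos.trans_le (hj i (Finset.mem_univ i)), fun k => hj k (Finset.mem_univ k)⟩
    classical
    set j := (Finset.univ.filter fun j => x ∈ A j).min' hne with hj
    have hjA : x ∈ A j := by
      have := Finset.min'_mem _ hne
      simpa using this
    have hjB : x ∈ B j := by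
      refine ⟨hjA, fun hcon => ?_⟩
      obtain ⟨⟨k, hk⟩, hkA⟩ := mem_iUnion.1 hcon
      exact (Finset.min'_le _ k (by simpa using hkA)).not_gt hk
    calc ENNReal.ofReal (g' i x) ≤ ENNReal.ofReal (g' j x) := ENNReal.ofReal_le_ofReal (hjA.2 i)
      _ = (B j).indicator (fun x => ENNReal.ofReal (g' j x)) x := by rw [indicator_of_mem hjB]
      _ ≤ _ := Finset.single_le_sum
          (f := fun j => (B j).indicator (fun x => ENNReal.ofReal (g' j x)) x)
          (fun _ _ => zero_le) (Finset.mem_univ j)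
  · rw [ENNReal.ofReal_of_nonpos (not_lt.1 hpos)]
    exact zero_le

end Localization

/-! ### The lower bound for the liminf. -/

section LowerSemicontinuity

lemma ofReal_integral_le_lintegral_ofReal {X : Type*} [MeasurableSpace X] {m : Measure X}
    {f : X → ℝ} (hf : Integrable f m) :
    ENNReal.ofReal (∫ x, f x ∂m) ≤ ∫⁻ x, ENNReal.ofReal (f x) ∂m := by
  calc ENNReal.ofReal (∫ x, f x ∂m) ≤ ENNReal.ofReal (∫ x, max (f x) 0 ∂m) :=
        ENNReal.ofReal_le_ofReal (integral_mono hf hf.pos_part fun x => le_max_left _ _)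
    _ = ∫⁻ x, ENNReal.ofReal (max (f x) 0) ∂m :=
        ofReal_integral_eq_lintegral_ofReal hf.pos_part
          (Eventually.of_forall fun x => le_max_right _ _)
    _ = ∫⁻ x, ENNReal.ofReal (f x) ∂m := by simp

variable {n : ℕ} {Ω : Opens (Space n)} [hn : Fact (2 ≤ n)] {q : ℝ≥0∞} [hq1 : Fact (1 ≤ q)]
  {V : ℝ → ℝ≥0∞} {H : Ω × SymMat n → ℝ≥0∞} {ε : ℝ}

/-- The polar density is a unit matrix, so pointwise every test lies below the integrand plus `ε`,
and the weights `θ j` sum to at most one. -/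
lemma sum_pairing_le {J : ℕ} (T : Fin J → AdmissibleTest V H ε) {θ : Fin J → Space n → ℝ}
    (hθ0 : ∀ j x, θ j x ∈ Icc (0 : ℝ) 1) (hθ1 : ∀ x, ∑ j, θ j x ≤ 1) (b : Ω → ℝ)
    (p : VectorMeasure Ω (SymMat n))
    (hi : ∀ j, Integrable (fun x : Ω => θ j x * (T j).φ x * (T j).v (b x) *
      inner ℝ (T j).a (polarDensity p x)) p.variation) :
    ENNReal.ofReal (∑ j, pairing (fun x => θ j x * (T j).φ x) (T j).v (T j).a b p)
      ≤ plasticPotential V H b p + ENNReal.ofReal ε * p.variation univ := by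
  simp only [pairing]
  rw [← integral_finsetSum _ fun j _ => hi j]
  refine (ofReal_integral_le_lintegral_ofReal (integrable_finsetSum _ fun j _ => hi j)).trans ?_
  -- Only the constant is required to be measurable; nothing is known about the composition of `V`
  -- with `b`.
  rw [plasticPotential, ← lintegral_const, ← lintegral_add_right _ measurable_const]
  refine lintegral_mono_ae ?_
  filter_upwards [norm_polarDensity p] with x hx
  by_cases htop : V (b x) * H (x, polarDensity p x) + ENNReal.ofReal ε = ⊤
  · rw [htop]
    exact le_top
  rw [ENNReal.ofReal_le_iff_le_toReal htop]
  set R := (V (b x) * H (x, polarDensity p x) + ENNReal.ofReal ε).toReal with hR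
  have hR0 : 0 ≤ R := ENNReal.toReal_nonneg
  calc ∑ j, θ j x * (T j).φ x * (T j).v (b x) * inner ℝ (T j).a (polarDensity p x)
      ≤ ∑ j, θ j x * R := by
        refine Finset.sum_le_sum fun j _ => ?_
        rw [mul_assoc (θ j x), mul_assoc (θ j x)]
        refine mul_le_mul_of_nonneg_left ?_ (hθ0 j x).1
        exact (ENNReal.ofReal_le_iff_le_toReal htop).1 ((T j).le x (b x) _ hx)
    _ = (∑ j, θ j x) * R := by rw [Finset.sum_mul]
    _ ≤ 1 * R := by gcongr; exact hθ1 x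
    _ = R := one_mul R

lemma abs_setIntegral_sub_integral_mul_le {X : Type*} [MeasurableSpace X] {m : Measure X}
    [IsFiniteMeasure m] {g θ : X → ℝ} (hg : Integrable g m) {G : ℝ} (hG : ∀ᵐ x ∂m, ‖g x‖ ≤ G)
    (hθ : Measurable θ) (hθI : ∀ x, θ x ∈ Icc (0 : ℝ) 1) {B : Set X} (hB : MeasurableSet B)
    {ρ : ℝ} (hρ0 : 0 ≤ ρ) (hG0 : 0 ≤ G)
    (hρ : m {x | θ x ≠ B.indicator 1 x} ≤ ENNReal.ofReal ρ) :
    |∫ x in B, g x ∂m - ∫ x, θ x * g x ∂m| ≤ G * ρ := by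
  have hE : MeasurableSet {x | θ x ≠ B.indicator 1 x} :=
    (measurableSet_eq_fun hθ (measurable_one.indicator hB)).compl
  have hθb : ∀ x, ‖θ x‖ ≤ 1 := fun x => by
    rw [Real.norm_eq_abs, abs_of_nonneg (hθI x).1]
    exact (hθI x).2
  have hi : Integrable (fun x => θ x * g x) m :=
    hg.bdd_mul (c := 1) hθ.aestronglyMeasurable (Eventually.of_forall hθb)
  rw [← integral_indicator hB, ← integral_sub (hg.indicator hB) hi, ← Real.norm_eq_abs]
  have hsub : ∀ x, B.indicator g x - θ x * g x = (B.indicator 1 x - θ x) * g x := fun x => by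
    by_cases hxB : x ∈ B
    · rw [indicator_of_mem hxB, indicator_of_mem hxB, Pi.one_apply]
      ring
    · rw [indicator_of_notMem hxB, indicator_of_notMem hxB]
      ring
  have hle : ∀ x, ‖B.indicator (1 : X → ℝ) x - θ x‖
      ≤ {x | θ x ≠ B.indicator 1 x}.indicator 1 x := by
    intro x
    by_cases hxE : x ∈ {x | θ x ≠ B.indicator 1 x}
    · rw [indicator_of_mem hxE, Pi.one_apply, Real.norm_eq_abs, abs_le]
      have := hθI x
      by_cases hxB : x ∈ B <;> simp [hxB] <;> constructor <;> linarith [this.1, this.2]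
    · rw [indicator_of_notMem hxE]
      have : θ x = B.indicator 1 x := not_not.1 hxE
      rw [this, sub_self, norm_zero]
  have hbound : ∀ᵐ x ∂m, ‖B.indicator g x - θ x * g x‖
      ≤ {x | θ x ≠ B.indicator 1 x}.indicator (fun _ => G) x := by
    filter_upwards [hG] with x hx
    rw [hsub, norm_mul]
    refine (mul_le_mul (hle x) hx (norm_nonneg _) (indicator_nonneg (by simp) x)).trans
      (le_of_eq ?_)
    by_cases hxE : x ∈ {x | θ x ≠ B.indicator 1 x}
    · rw [indicator_of_mem hxE, indicator_of_mem hxE, Pi.one_apply, one_mul]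
    · rw [indicator_of_notMem hxE, indicator_of_notMem hxE, zero_mul]
  refine (norm_integral_le_of_norm_le ((integrable_const G).indicator hE) hbound).trans ?_
  rw [integral_indicator_const _ hE, smul_eq_mul, mul_comm]
  exact mul_le_mul_of_nonneg_left (ENNReal.toReal_le_of_le_ofReal hρ0 hρ) hG0

namespace PlasticSequence

-- The localised form of the inequality. The finite supremum becomes a sum over disjoint sets, then
-- a sum of pairings with cut-offs avoiding the concentration set. The pairings are compared with
-- those of a late index `k`, which lie below its potential up to `ε` times the mass.
set_option maxHeartbeats 1000000 in
lemma lintegral_iSup_le (S : PlasticSequence Ω q) {𝒰 : Ultrafilter ℕ}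
    (h𝒰 : (𝒰 : Filter ℕ) ≤ atTop) {c M : ℝ≥0∞}
    (hc : ∀ᶠ k in (𝒰 : Filter ℕ), plasticPotential V H (S.αt k) (S.p k) ≤ c)
    (hM : ∀ k, (S.p k).variation univ ≤ M) {J : ℕ} (T : Fin J → AdmissibleTest V H ε) :
    ∫⁻ x : Ω, ⨆ j, ENNReal.ofReal ((T j).φ x * (T j).v (S.αt₀ x) *
      inner ℝ (T j).a (polarDensity S.p₀ x)) ∂S.p₀.variation ≤ c + ENNReal.ofReal ε * M := by
  have hg : ∀ j, Integrable (fun x : Ω => (T j).φ x * (T j).v (S.αt₀ x) *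
      inner ℝ (T j).a (polarDensity S.p₀ x)) S.p₀.variation := fun j =>
    integrable_pairing S.isBounded S.u₀ S.integrable_e₀ S.split₀ S.isRep₀ (T j).contDiff_φ
      (T j).hasCompactSupport_φ (T j).tsupport_φ (T j).contDiff_v (T j).hasCompactSupport_v _
  obtain ⟨B, hBm, hBd, hB⟩ := exists_disjoint_lintegral_iSup_le S.p₀.variation hg
  refine hB.trans (ENNReal.le_of_forall_pos_le_add fun ζ hζ _ => ?_)
  have hζ' : (0 : ℝ) < ζ := by exact_mod_cast hζ
  choose C hC0 hC using fun j => S.exists_eventually_abs_pairing_sub_le (T j).a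
  choose Cφ hCφ using fun j =>
    (T j).hasCompactSupport_φ.exists_bound_of_continuous (T j).contDiff_φ.continuous
  choose Cv hCv using fun j =>
    (T j).hasCompactSupport_v.exists_bound_of_continuous (T j).contDiff_v.continuous
  choose L hL using fun j => (T j).hasCompactSupport_v.deriv.exists_bound_of_continuous
    ((T j).contDiff_v.continuous_deriv (by simp))
  have hCφ0 : ∀ j, 0 ≤ Cφ j := fun j => (norm_nonneg _).trans (hCφ j 0)
  have hCv0 : ∀ j, 0 ≤ Cv j := fun j => (norm_nonneg _).trans (hCv j 0)
  have hL0 : ∀ j, 0 ≤ L j := fun j => (norm_nonneg _).trans (hL j 0)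
  set G : Fin J → ℝ := fun j => Cφ j * Cv j * ‖(T j).a‖ with hGdef
  have hG0 : ∀ j, 0 ≤ G j := fun j =>
    mul_nonneg (mul_nonneg (hCφ0 j) (hCv0 j)) (norm_nonneg _)
  have hG : ∀ j, ∀ᵐ x : Ω ∂S.p₀.variation, ‖(T j).φ x * (T j).v (S.αt₀ x) *
      inner ℝ (T j).a (polarDensity S.p₀ x)‖ ≤ G j := by
    intro j
    filter_upwards [norm_polarDensity S.p₀] with x hx
    rw [norm_mul, norm_mul]
    have h1 := norm_inner_le_norm (𝕜 := ℝ) (T j).a (polarDensity S.p₀ x)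
    rw [hx, mul_one] at h1
    exact mul_le_mul (mul_le_mul (hCφ j _) (hCv j _) (norm_nonneg _) (hCφ0 j)) h1 (norm_nonneg _)
      (mul_nonneg (hCφ0 j) (hCv0 j))
  set s₁ := ∑ j, C j * (Cφ j * L j) with hs₁
  have hs₁0 : 0 ≤ s₁ :=
    Finset.sum_nonneg fun j _ => mul_nonneg (hC0 j) (mul_nonneg (hCφ0 j) (hL0 j))
  set s₂ := ∑ j, G j with hs₂
  have hs₂0 : 0 ≤ s₂ := Finset.sum_nonneg fun j _ => hG0 j
  -- One small number serves as concentration level `δ`, as measure of the cut-off error and as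
  -- tolerance `η`. The respective costs are `s₁ κ`, `s₂ κ` and `J κ`. It depends only on the tests,
  -- while the concentration set and the cut-offs depend on it.
  set κ : ℝ := ζ / (s₁ + s₂ + J + 1) with hκ
  have hκ0 : 0 < κ := by positivity
  have hκζ : κ * (s₁ + s₂ + J) ≤ ζ := by
    rw [hκ, div_mul_eq_mul_div, div_le_iff₀ (by positivity)]
    exact mul_le_mul_of_nonneg_left (by linarith) hζ'.le
  set δ : ℝ≥0 := ⟨κ, hκ0.le⟩ with hδ
  have hδ0 : 0 < δ := hκ0
  obtain ⟨θ, hθ, hθc, hθΩ, hθF, hθI, hθ1, hθB⟩ := exists_disjoint_cutoffs S.p₀.variation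
    (S.finite_concentrationSet 𝒰 hδ0) (S.variation_concentrationSet 𝒰 hδ0) hBm hBd
    (ρ := ENNReal.ofReal κ) (ENNReal.ofReal_pos.2 hκ0).ne'
  have hφc : ∀ j, ContDiff ℝ ∞ fun x => θ j x * (T j).φ x := fun j => (hθ j).mul (T j).contDiff_φ
  have hφs : ∀ j, HasCompactSupport fun x => θ j x * (T j).φ x := fun j => (hθc j).mul_right
  have hφsub : ∀ j, tsupport (fun x => θ j x * (T j).φ x) ⊆ tsupport (θ j) := fun j =>
    tsupport_mul_subset_left
  have hev := fun j => hC j 𝒰 h𝒰 δ (fun x => θ j x * (T j).φ x) (hφc j) (hφs j)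
    ((hφsub j).trans (hθΩ j)) ((hθF j).mono_left (hφsub j)) (Cφ j)
    (fun x => by
      rw [norm_mul, Real.norm_eq_abs, abs_of_nonneg (hθI j x).1]
      calc _ ≤ 1 * Cφ j := mul_le_mul (hθI j x).2 (hCφ j x) (norm_nonneg _) zero_le_one
        _ = Cφ j := one_mul _)
    (T j).v (T j).contDiff_v (T j).hasCompactSupport_v (L j) (hL j) κ hκ0
  -- A single index is enough, because every error has already been made at most `ζ`.
  obtain ⟨k, hk, hkc⟩ := ((eventually_all.2 hev).and hc).exists
  have hsum := sum_pairing_le T hθI hθ1 (S.αt k) (S.p k) fun j =>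
    integrable_pairing S.isBounded (S.u k) (S.integrable_e k) (S.split k) (S.isRep k) (hφc j)
      (hφs j) ((hφsub j).trans (hθΩ j)) (T j).contDiff_v (T j).hasCompactSupport_v _
  have hlim : ∀ j, ∫ x in B j, (T j).φ x * (T j).v (S.αt₀ x) *
      inner ℝ (T j).a (polarDensity S.p₀ x) ∂S.p₀.variation
      ≤ pairing (fun x => θ j x * (T j).φ x) (T j).v (T j).a (S.αt k) (S.p k)
        + κ * (C j * (Cφ j * L j) + G j + 1) := by
    intro j
    have h1 := abs_setIntegral_sub_integral_mul_le (hg j) (hG j) (θ := fun x : Ω => θ j x)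
      ((hθ j).continuous.comp continuous_subtype_val).measurable (fun x => hθI j x) (hBm j)
      hκ0.le (hG0 j) (hθB j)
    have h2 : pairing (fun x => θ j x * (T j).φ x) (T j).v (T j).a S.αt₀ S.p₀
        = ∫ x : Ω, θ j x * ((T j).φ x * (T j).v (S.αt₀ x) *
          inner ℝ (T j).a (polarDensity S.p₀ x)) ∂S.p₀.variation := by
      rw [pairing]
      congr 1
      ext x
      ring
    rw [← h2] at h1
    have h3 := hk j
    have h4 : (δ : ℝ) = κ := rfl
    rw [h4] at h3
    have h5 := (abs_le.1 h1).2
    have h6 := (abs_le.1 h3).1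
    nlinarith
  calc ENNReal.ofReal (∑ j, ∫ x in B j, (T j).φ x * (T j).v (S.αt₀ x) *
      inner ℝ (T j).a (polarDensity S.p₀ x) ∂S.p₀.variation)
      ≤ ENNReal.ofReal ((∑ j, pairing (fun x => θ j x * (T j).φ x) (T j).v (T j).a (S.αt k) (S.p k))
          + ζ) := by
        refine ENNReal.ofReal_le_ofReal ((Finset.sum_le_sum fun j _ => hlim j).trans ?_)
        rw [Finset.sum_add_distrib, ← Finset.mul_sum, Finset.sum_add_distrib,
          Finset.sum_add_distrib]
        simp only [Finset.sum_const, Finset.card_univ, Fintype.card_fin, nsmul_eq_mul, mul_one]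
        gcongr
    _ ≤ ENNReal.ofReal (∑ j, pairing (fun x => θ j x * (T j).φ x) (T j).v (T j).a (S.αt k) (S.p k))
          + ζ := by
        refine ENNReal.ofReal_add_le.trans ?_
        rw [ENNReal.ofReal_coe_nnreal]
    _ ≤ c + ENNReal.ofReal ε * M + ζ := by
        gcongr
        refine hsum.trans (add_le_add hkc ?_)
        gcongr
        exact hM k

/-- Monotone convergence passes from finitely many tests to the countable family, whose supremum
dominates the integrand; `ε` is then sent to zero against the uniform mass bound on the plastic
strains. -/
lemma plasticPotential_le (S : PlasticSequence Ω q) (hV : LowerSemicontinuous V)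
    (hH : LowerSemicontinuous H)
    (hH_hom : ∀ (x : Ω) (ξ : SymMat n) (t : ℝ≥0), 0 < t → H (x, t • ξ) = t * H (x, ξ))
    (hH_conv : ∀ x : Ω, ConvexOn ℝ≥0 univ (fun ξ : SymMat n => H (x, ξ))) {𝒰 : Ultrafilter ℕ}
    (h𝒰 : (𝒰 : Filter ℕ) ≤ atTop) {c : ℝ≥0∞}
    (hc : ∀ᶠ k in (𝒰 : Filter ℕ), plasticPotential V H (S.αt k) (S.p k) ≤ c) :
    plasticPotential V H S.αt₀ S.p₀ ≤ c := by
  obtain ⟨M, hMtop, hM⟩ := S.exists_variation_le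
  have key : ∀ ε : ℝ, 0 < ε → plasticPotential V H S.αt₀ S.p₀ ≤ c + ENNReal.ofReal ε * M := by
    intro ε hε
    obtain ⟨T, hT⟩ := exists_seq_admissibleTest hV hH hH_hom hH_conv hε
    set g : ℕ → Ω → ℝ≥0∞ := fun j x => ENNReal.ofReal ((T j).φ x * (T j).v (S.αt₀ x) *
      inner ℝ (T j).a (polarDensity S.p₀ x)) with hgdef
    have hg : ∀ j, AEMeasurable (g j) S.p₀.variation := fun j =>
      (integrable_pairing S.isBounded S.u₀ S.integrable_e₀ S.split₀ S.isRep₀ (T j).contDiff_φ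
        (T j).hasCompactSupport_φ (T j).tsupport_φ (T j).contDiff_v (T j).hasCompactSupport_v
        _).1.aemeasurable.ennreal_ofReal
    have hsup : ∀ x, ⨆ j, g j x = ⨆ J : ℕ, ⨆ j : Fin J, g j x := fun x =>
      le_antisymm (iSup_le fun j => le_iSup_of_le (j + 1)
        (le_iSup (fun i : Fin (j + 1) => g i x) ⟨j, j.lt_succ_self⟩))
        (iSup_le fun J => iSup_le fun j => le_iSup (fun i => g i x) j)
    have hmono : ∀ x, Monotone fun J : ℕ => ⨆ j : Fin J, g j x := fun x J J' hJ =>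
      iSup_le fun j => le_iSup (fun i : Fin J' => g i x) (Fin.castLE hJ j)
    calc plasticPotential V H S.αt₀ S.p₀
        ≤ ∫⁻ x, ⨆ j, g j x ∂S.p₀.variation := by
          refine lintegral_mono_ae ?_
          filter_upwards [norm_polarDensity S.p₀] with x hx using hT x (S.αt₀ x) _ hx
      _ = ∫⁻ x, ⨆ J : ℕ, ⨆ j : Fin J, g j x ∂S.p₀.variation := by simp only [hsup]
      _ = ⨆ J : ℕ, ∫⁻ x, ⨆ j : Fin J, g j x ∂S.p₀.variation :=
          lintegral_iSup' (fun J => AEMeasurable.iSup fun j => hg j)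
            (Eventually.of_forall hmono)
      _ ≤ c + ENNReal.ofReal ε * M := iSup_le fun J =>
          S.lintegral_iSup_le h𝒰 hc hM fun j : Fin J => T j
  refine ENNReal.le_of_forall_pos_le_add fun ζ hζ _ => ?_
  have hζ' : (0 : ℝ) < ζ := by exact_mod_cast hζ
  refine (key (ζ / (M.toReal + 1)) (by positivity)).trans ?_
  gcongr
  rw [← ENNReal.ofReal_toReal hMtop, ← ENNReal.ofReal_mul (by positivity),
    ENNReal.toReal_ofReal ENNReal.toReal_nonneg, ← ENNReal.ofReal_coe_nnreal]
  refine ENNReal.ofReal_le_ofReal ?_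
  rw [div_mul_eq_mul_div, div_le_iff₀ (by positivity)]
  exact mul_le_mul_of_nonneg_left (by linarith) hζ'.le

/-- Lower semicontinuity of the plastic potential along admissible sequences. -/
lemma plasticPotential_le_liminf (S : PlasticSequence Ω q) (hV : LowerSemicontinuous V)
    (hH : LowerSemicontinuous H)
    (hH_hom : ∀ (x : Ω) (ξ : SymMat n) (t : ℝ≥0), 0 < t → H (x, t • ξ) = t * H (x, ξ))
    (hH_conv : ∀ x : Ω, ConvexOn ℝ≥0 univ (fun ξ : SymMat n => H (x, ξ))) :
    plasticPotential V H S.αt₀ S.p₀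
      ≤ liminf (fun k => plasticPotential V H (S.αt k) (S.p k)) atTop := by
  refine le_of_forall_gt fun c hc => ?_
  obtain ⟨c', hc', hcc'⟩ := exists_between hc
  have hfreq := frequently_lt_of_liminf_lt (by isBoundedDefault) hc'
  have hne : NeBot (atTop ⊓ 𝓟 {k | plasticPotential V H (S.αt k) (S.p k) < c'}) :=
    frequently_mem_iff_neBot.1 hfreq
  -- Replaces a subsequence realising the liminf: the potential stays below `c'` along this
  -- ultrafilter, which is still finer than `atTop`.
  set 𝒰 := Ultrafilter.of (atTop ⊓ 𝓟 {k | plasticPotential V H (S.αt k) (S.p k) < c'})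
  have h𝒰 : (𝒰 : Filter ℕ) ≤ atTop ⊓ 𝓟 {k | plasticPotential V H (S.αt k) (S.p k) < c'} :=
    Ultrafilter.of_le _
  have hev : ∀ᶠ k in (𝒰 : Filter ℕ), plasticPotential V H (S.αt k) (S.p k) < c' :=
    le_principal_iff.1 (h𝒰.trans inf_le_right)
  exact (S.plasticPotential_le hV hH hH_hom hH_conv (h𝒰.trans inf_le_left)
    (hev.mono fun k hk => hk.le)).trans_lt hcc'

end PlasticSequence

end LowerSemicontinuity

end PlasticDamage

end

/-! ### The theorem. -/

theorem theorem1p1 {n : ℕ} [Fact (2 ≤ n)]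
    (Ω : Opens (PlasticDamage.Space n))
    (hΩ : Bornology.IsBounded (Ω : Set (PlasticDamage.Space n)))
    (hLip : PlasticDamage.HasLipschitzBoundary Ω)
    (V : ℝ → ℝ≥0∞) (hV : LowerSemicontinuous V)
    (H : Ω × PlasticDamage.SymMat n → ℝ≥0∞) (hH : LowerSemicontinuous H)
    (hH_hom : ∀ (x : Ω) (ξ : PlasticDamage.SymMat n) (t : ℝ≥0), 0 < t →
      H (x, t • ξ) = t * H (x, ξ))
    (hH_conv : ∀ x : Ω, ConvexOn ℝ≥0 Set.univ (fun ξ : PlasticDamage.SymMat n => H (x, ξ)))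
    (q : ℝ≥0∞) [Fact (1 ≤ q)] (hq : 1 < q)
    (α : ℕ → PlasticDamage.sobolev Ω (n : ℝ≥0∞)) (α₀ : PlasticDamage.sobolev Ω (n : ℝ≥0∞))
    (u : ℕ → PlasticDamage.BD Ω) (u₀ : PlasticDamage.BD Ω)
    (e : ℕ → Lp (PlasticDamage.SymMat n) q (volume : Measure Ω))
    (e₀ : Lp (PlasticDamage.SymMat n) q (volume : Measure Ω))
    (p : ℕ → VectorMeasure Ω (PlasticDamage.SymMat n))
    (p₀ : VectorMeasure Ω (PlasticDamage.SymMat n))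
    (h_split : ∀ k, PlasticDamage.BD.strain (u k) =
      (volume : Measure Ω).withDensityᵥ (e k) + p k)
    (h_split₀ : PlasticDamage.BD.strain u₀ = (volume : Measure Ω).withDensityᵥ e₀ + p₀)
    (hu : PlasticDamage.BD.WeakStarTendsto u u₀)
    (he : PlasticDamage.WeakTendsto e e₀)
    (hα : PlasticDamage.WeakTendsto α α₀)
    -- quasicontinuous representatives of the functions `α k` and `α₀`
    (αt : ℕ → Ω → ℝ) (αt₀ : Ω → ℝ)
    (hαt : ∀ k, PlasticDamage.IsQuasicontinuousRep Ω n (α k) (αt k))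
    (hαt₀ : PlasticDamage.IsQuasicontinuousRep Ω n α₀ αt₀) :
    PlasticDamage.plasticPotential V H αt₀ p₀ ≤
      liminf (fun k => PlasticDamage.plasticPotential V H (αt k) (p k)) atTop := by
  exact PlasticDamage.PlasticSequence.plasticPotential_le_liminf
    { isBounded := hΩ, one_lt := hq, α := α, α₀ := α₀, u := u, u₀ := u₀, e := e, e₀ := e₀, p := p
      p₀ := p₀, split := h_split, split₀ := h_split₀, tendsto_u := hu, tendsto_e := he
      tendsto_α := hα, αt := αt, αt₀ := αt₀, isRep := hαt, isRep₀ := hαt₀ } hV hH hH_hom hH_conv
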